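/- **Setting.** Let $q,d\in\mathbb{C}^{\times}$ satisfy $q^nd^m\neq 1$ for all $(n,m)\in\mathbb{Z}^2\setminus\{(0,0)\}$. Put $q_1=q^{-1}d$, $q_2=q^2$, $q_3=q^{-1}d^{-1}$. Fix a square root $q^{1/2}$ of $q$ and values of $\log q_1$, $\log q_3$, so that $q_1^{a}=e^{a\log q_1}$ for $a\in\mathbb{C}$, and put $\beta=-\log q_3/\log q_1$. Let $u\in\mathbb{C}$; all indices $i,j$ run over $\{1,2\}$. **The algebra.** The quantum toroidal $\mathfrak{gl}_2$ algebra $\mathcal{E}_2$ is the unital associative $\mathbb{C}$-algebra generated by $E_{i,n},F_{i,n}$ ($n\in\mathbb{Z}$), $H_{i,k}$ ($k\in\mathbb{Z}\setminus\{0\}$), $K_i^{\pm1}$ and central elements $q^{\pm c}$. With $E_i(z)=\sum_n E_{i,n}z^{-n}$, $F_i(z)=\sum_n F_{i,n}z^{-n}$, $K_i^{\pm}(z)=K_i^{\pm1}\exp\bigl(\pm(q-q^{-1})\sum_{n\ge1}H_{i,\pm n}z^{\mp n}\bigr)$, the defining relations are $$K_iK_i^{-1}=K_i^{-1}K_i=1,\qquad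 q^cq^{-c}=q^{-c}q^c=1,\qquad K_i^{\pm}(z)K_j^{\pm}(w)=K_j^{\pm}(w)K_i^{\pm}(z),$$ $$\frac{g_{i,j}(q^{-c}z,w)}{g_{i,j}(q^{c}z,w)}K_i^-(z)K_j^+(w)=\frac{g_{j,i}(w,q^{-c}z)}{g_{j,i}(w,q^{c}z)}K_j^+(w)K_i^-(z)\quad(\text{ratios expanded in powers of }z/w),$$ $$d_{i,j}g_{i,j}(z,w)K_i^{\pm}(q^{(1\mp1)c/2}z)E_j(w)+g_{j,i}(w,z)E_j(w)K_i^{\pm}(q^{(1\mp1)c/2}z)=0,$$ $$d_{j,i}g_{j,i}(w,z)K_i^{\pm}(q^{(1\pm1)c/2}z)F_j(w)+g_{i,j}(z,w)F_j(w)K_i^{\pm}(q^{(1\pm1)c/2}z)=0,$$ $$d_{i,j}g_{i,j}(z,w)E_i(z)E_j(w)+g_{j,i}(w,z)E_j(w)E_i(z)=0,\qquad d_{j,i}g_{j,i}(w,z)F_i(z)F_j(w)+g_{i,j}(z,w)F_j(w)F_i(z)=0,$$ $$[E_i(z),F_j(w)]=\frac{\delta_{i,j}}{q-q^{-1}}\Bigl(\delta\bigl(q^c\tfrac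 wz\bigr)K_i^+(z)-\delta\bigl(q^c\tfrac zw\bigr)K_i^-(w)\Bigr),\qquad \delta(z)=\sum_{n\in\mathbb{Z}}z^n,$$ and, for $i\neq j$, the Serre relations $$\operatorname*{Sym}_{z_1,z_2,z_3}\bigl[E_i(z_1),[E_i(z_2),[E_i(z_3),E_j(w)]_{q_2}]\bigr]_{q_2^{-1}}=0,\qquad \operatorname*{Sym}_{z_1,z_2,z_3}\bigl[F_i(z_1),[F_i(z_2),[F_i(z_3),F_j(w)]_{q_2}]\bigr]_{q_2^{-1}}=0,$$ where $[A,B]_p=AB-pBA$, $[A,B]=[A,B]_1$, $g_{i,i}(z,w)=z-q_2w$, $g_{i,j}(z,w)=(z-q_1w)(z-q_3w)$ for $i\ne j$, $d_{i,i}=1$, and $d_{i,j}=-1$ for $i\neq j$. **The Fock module.** Let $\alpha_{i,n},\chi_i$ ($n\in\mathbb{Z}$), $\mathsf{a}_0,\mathsf{Q}$ satisfy $[\alpha_{i,n},\alpha_{i,m}]=n(1+q_2^{-|n|})\delta_{n+m,0}$, $[\alpha_{i,n},\alpha_{j,m}]=-n(q_1^{|n|}+q_3^{|n|})\delta_{n+m,0}$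 for $i\ne j$, $[\alpha_{i,n},\chi_i]=2\delta_{n,0}$, $[\alpha_{i,n},\chi_j]=-2\delta_{n,0}$ for $i\neq j$, $[\mathsf{a}_0,\mathsf{Q}]=\beta$, all other commutators being zero, together with $\alpha_{1,0}=-\alpha_{2,0}$ and $\chi_1=-\chi_2$. Let $|0\rangle$ be the vacuum, annihilated by $\mathsf{a}_0$ and by $\alpha_{i,n}$ for $n\ge0$, and put $|n,u\rangle=e^{\frac n2\chi_1+\frac u\beta\mathsf{Q}}|0\rangle$. Thus $\alpha_{1,0}|n,u\rangle=n|n,u\rangle$, $\mathsf{a}_0|n,u\rangle=u|n,u\rangle$ and $e^{\pm\chi_1}|n,u\rangle=|n\pm2,u\rangle$. Let $\mathcal{F}_u=\bigoplus_{n\in\mathbb{Z}}\mathbb{C}[\alpha_{1,-1},\alpha_{1,-2},\dots,\alpha_{2,-1},\alpha_{2,-2},\dots]\,|n,u\rangle$. **Vertex operators.** With $:\ :$ the normal ordering (all $\alpha_{i,-n}$, $n>0$, to the left of all $\alpha_{i,n}$, $n>0$), set $$\eta_i(z)=:\exp\Bigl(-\sum_{n\ne0}\tfrac1n\alpha_{i,n}z^{-n}\Bigr):,\qquad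 \xi_i(z)=:\exp\Bigl(\sum_{n\neq0}\tfrac{q^{|n|}}n\alpha_{i,n}z^{-n}\Bigr):,$$ $$\varphi_i^+(z)=\exp\Bigl(-\sum_{n>0}\tfrac{1-q_2^n}{n}q^{-n/2}\alpha_{i,n}z^{-n}\Bigr),\qquad \varphi_i^-(z)=\exp\Bigl(\sum_{n>0}\tfrac{1-q_2^n}{n}q^{-n/2}\alpha_{i,-n}z^{n}\Bigr).$$ **Proposition.** The assignment $$\rho_u(E_i(z))=\eta_i(z)\,e^{\chi_i}z^{\alpha_{i,0}+1}q_1^{\mathsf{a}_0},\qquad \rho_u(F_i(z))=\xi_i(z)\,e^{-\chi_i}z^{-\alpha_{i,0}+1}q_1^{-\mathsf{a}_0},$$ $$\rho_u(K_i^+(z))=\varphi_i^+(q^{-1/2}z)\,q^{\alpha_{i,0}},\qquad \rho_u(K_i^-(z))=\varphi_i^-(q^{-1/2}z)\,q^{-\alpha_{i,0}},\qquad \rho_u(q^{\pm c})=q^{\pm1}$$ gives a representation of $\mathcal{E}_2$ on $\mathcal{F}_u$: there is exactly one homomorphism of unital $\mathbb{C}$-algebras $\rho_u:\mathcal{E}_2\to\operatorname{End}(\mathcal{F}_u)$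 satisfying these equations coefficientwise in $z$. -/

import Mathlib

open scoped PowerSeries

namespace QToroidal

noncomputable section

/-! ## Parameters -/

/-- `q₁ = q⁻¹ d`. -/
def q1 (q d : ℂ) : ℂ := q⁻¹ * d

/-- `q₂ = q²`. -/
def q2 (q : ℂ) : ℂ := q ^ 2

/-- `q₃ = q⁻¹ d⁻¹`. -/
def q3 (q d : ℂ) : ℂ := q⁻¹ * d⁻¹

/-- The structure function `g_{i,j}(z,w)`, with `z` and `w` in an arbitrary `ℂ`-algebra. The two
values of the indices `i, j` are written `0, 1 : Fin 2` instead of `1, 2`. -/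
def g (q d : ℂ) (i j : Fin 2) {R : Type} [Ring R] [Algebra ℂ R] (z w : R) : R :=
  if i = j then z - q2 q • w else (z - q1 q d • w) * (z - q3 q d • w)

/-- The signs `d_{i,j}`. -/
def dsign (i j : Fin 2) : ℂ := if i = j then 1 else -1

/-! ## Formal series -/

/-- The exponential `exp(h)` of a power series `h` without constant term over a (not necessarily
commutative) `ℂ`-algebra: since `h ^ k` has order at least `k`, only the summands `h ^ k / k!` with
`k ≤ n` contribute to the coefficient of degree `n`. -/
def expSeries {A : Type} [Ring A] [Algebra ℂ A] (h : A⟦X⟧) : A⟦X⟧ :=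
  PowerSeries.mk fun n =>
    ∑ k ∈ Finset.range (n + 1), ((k.factorial : ℂ)⁻¹) • PowerSeries.coeff n (h ^ k)

/-- Multiplication by `z` on formal series `∑ f_{m,n} z^{-m} w^{-n}`. -/
def mulZ (A : Type) [Ring A] [Algebra ℂ A] : Module.End ℂ (ℤ → ℤ → A) where
  toFun f := fun m n => f (m + 1) n
  map_add' _ _ := rfl
  map_smul' _ _ := rfl

/-- Multiplication by `w` on formal series `∑ f_{m,n} z^{-m} w^{-n}`. -/
def mulW (A : Type) [Ring A] [Algebra ℂ A] : Module.End ℂ (ℤ → ℤ → A) where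
  toFun f := fun m n => f m (n + 1)
  map_add' _ _ := rfl
  map_smul' _ _ := rfl

/-- For `a(z) = ∑ a_m z^{-m}` and `b(w) = ∑ b_n w^{-n}`, the series `a(z) b(w)`. -/
def prodZW {A : Type} [Ring A] (a b : ℤ → A) : ℤ → ℤ → A := fun m n => a m * b n

/-- For `a(z) = ∑ a_m z^{-m}` and `b(w) = ∑ b_n w^{-n}`, the series `b(w) a(z)`. -/
def prodWZ {A : Type} [Ring A] (a b : ℤ → A) : ℤ → ℤ → A := fun m n => b n * a m

/-- The expansion of `1 / (c x - a)` in powers of `x`, for `a ∈ ℂ` nonzero and `c` in an algebra. -/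
def invLin {A : Type} [Ring A] [Algebra ℂ A] (a : ℂ) (c : A) : A⟦X⟧ :=
  PowerSeries.mk fun k => (-(a ^ (k + 1))⁻¹) • c ^ k

/-- The expansion of `1 / (1 - a c x)` in powers of `x`. -/
def invOneSub {A : Type} [Ring A] [Algebra ℂ A] (a : ℂ) (c : A) : A⟦X⟧ :=
  PowerSeries.mk fun k => a ^ k • c ^ k

/-- The expansion of `1 / g_{i,j}(c x, 1)` in powers of `x`. -/
def invGLeft (q d : ℂ) (i j : Fin 2) {A : Type} [Ring A] [Algebra ℂ A] (c : A) : A⟦X⟧ :=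
  if i = j then invLin (q2 q) c else invLin (q3 q d) c * invLin (q1 q d) c

/-- The expansion of `1 / g_{j,i}(1, c x)` in powers of `x`. -/
def invGRight (q d : ℂ) (i j : Fin 2) {A : Type} [Ring A] [Algebra ℂ A] (c : A) : A⟦X⟧ :=
  if j = i then invOneSub (q2 q) c else invOneSub (q3 q d) c * invOneSub (q1 q d) c

/-- The monomial `c x`. -/
def lin {A : Type} [Ring A] [Algebra ℂ A] (c : A) : A⟦X⟧ := PowerSeries.C c * PowerSeries.X

theorem lin_mul_invLin {A : Type} [Ring A] [Algebra ℂ A] {a : ℂ} (ha : a ≠ 0) (c : A) :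
    (lin c - a • (1 : A⟦X⟧)) * invLin a c = 1 := by
  ext n
  rw [sub_mul, map_sub, lin, mul_assoc, PowerSeries.coeff_C_mul, smul_mul_assoc, one_mul]
  cases n with
  | zero => simp [invLin, smul_smul, ha]
  | succ n =>
    rw [PowerSeries.coeff_succ_X_mul]
    have h : a * (a ^ (n + 1 + 1))⁻¹ = (a ^ (n + 1))⁻¹ := by
      rw [pow_succ' a (n + 1), mul_inv, ← mul_assoc, mul_inv_cancel₀ ha, one_mul]
    simp only [invLin, PowerSeries.coeff_mk, PowerSeries.coeff_smul, mul_smul_comm, smul_smul,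
      PowerSeries.coeff_one, mul_neg, h]
    simp [pow_succ']

theorem oneSub_mul_invOneSub {A : Type} [Ring A] [Algebra ℂ A] (a : ℂ) (c : A) :
    (1 - a • lin c) * invOneSub a c = 1 := by
  ext n
  rw [sub_mul, map_sub, lin, smul_mul_assoc, mul_assoc, one_mul, PowerSeries.coeff_smul,
    PowerSeries.coeff_C_mul]
  cases n with
  | zero => simp [invOneSub]
  | succ n =>
    rw [PowerSeries.coeff_succ_X_mul]
    simp [invOneSub, smul_smul, pow_succ', PowerSeries.coeff_one]

theorem g_mul_invGLeft {q d : ℂ} (hq : q ≠ 0) (hd : d ≠ 0) (i j : Fin 2)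
    {A : Type} [Ring A] [Algebra ℂ A] (c : A) :
    g q d i j (lin c) (1 : A⟦X⟧) * invGLeft q d i j c = 1 := by
  unfold g invGLeft
  split_ifs
  · exact lin_mul_invLin (by simp [q2, hq]) c
  · rw [mul_assoc, ← mul_assoc _ (invLin (q3 q d) c),
      lin_mul_invLin (by simp [q3, hq, hd]), one_mul, lin_mul_invLin (by simp [q1, hq, hd])]

theorem g_mul_invGRight (q d : ℂ) (i j : Fin 2) {A : Type} [Ring A] [Algebra ℂ A] (c : A) :
    g q d j i (1 : A⟦X⟧) (lin c) * invGRight q d i j c = 1 := by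
  unfold g invGRight
  split_ifs
  · exact oneSub_mul_invOneSub _ c
  · rw [mul_assoc, ← mul_assoc _ (invOneSub (q3 q d) c), oneSub_mul_invOneSub, one_mul,
      oneSub_mul_invOneSub]

/-- `[a, b]_p = a b - p b a`. -/
def brk {A : Type} [Ring A] [Algebra ℂ A] (p : ℂ) (a b : A) : A := a * b - p • (b * a)

/-! ## The quantum toroidal algebra of type `gl₂` -/

/-- The generators `E_{i,n}`, `F_{i,n}` (`n ∈ ℤ`), `H_{i,n}` (`n ∈ ℤ`, `n ≠ 0`), `K_i`, `K_i⁻¹`,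
`q^c`, `q^{-c}`. -/
inductive Gen : Type
  | E (i : Fin 2) (n : ℤ)
  | F (i : Fin 2) (n : ℤ)
  | H (i : Fin 2) (n : ℤ) (hn : n ≠ 0)
  | K (i : Fin 2)
  | Kinv (i : Fin 2)
  | C
  | Cinv

section Relations

variable {A : Type} [Ring A] [Algebra ℂ A]

/-- `K_i^+(z) = K_i exp((q - q⁻¹) ∑_{n ≥ 1} H_{i,n} z^{-n})` as a power series in `z⁻¹`. -/
def KplusS (q : ℂ) (x : Gen → A) (i : Fin 2) : A⟦X⟧ :=
  PowerSeries.C (x (Gen.K i)) * expSeries (PowerSeries.mk fun n =>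
    if hn : (n : ℤ) ≠ 0 then (q - q⁻¹) • x (Gen.H i n hn) else 0)

/-- `K_i^-(z) = K_i⁻¹ exp(-(q - q⁻¹) ∑_{n ≥ 1} H_{i,-n} z^n)` as a power series in `z`. -/
def KminusS (q : ℂ) (x : Gen → A) (i : Fin 2) : A⟦X⟧ :=
  PowerSeries.C (x (Gen.Kinv i)) * expSeries (PowerSeries.mk fun n =>
    if hn : -(n : ℤ) ≠ 0 then (-(q - q⁻¹)) • x (Gen.H i (-n) hn) else 0)

/-- The coefficient of `z^{-n}` in `K_i^+(z)`. -/
def Kplus (q : ℂ) (x : Gen → A) (i : Fin 2) (n : ℤ) : A :=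
  if 0 ≤ n then PowerSeries.coeff n.toNat (KplusS q x i) else 0

/-- The coefficient of `z^{-n}` in `K_i^-(z)`. -/
def Kminus (q : ℂ) (x : Gen → A) (i : Fin 2) (n : ℤ) : A :=
  if n ≤ 0 then PowerSeries.coeff (-n).toNat (KminusS q x i) else 0

/-- `q^{nc}` for an integer `n`. -/
def Cpow (x : Gen → A) (n : ℤ) : A :=
  if 0 ≤ n then x Gen.C ^ n.toNat else x Gen.Cinv ^ (-n).toNat

/-- The series `a(q^c z)`, for `a(z) = ∑ a_n z^{-n}`. -/
def scaleC (x : Gen → A) (a : ℤ → A) : ℤ → A := fun n => Cpow x (-n) * a n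

/-- The expansion in powers of `z/w` of `g_{i,j}(q^{-c} z, w) / g_{i,j}(q^c z, w)`; as `g_{i,j}` is
homogeneous, this ratio depends on `z/w` only. -/
def ratioLeft (q d : ℂ) (x : Gen → A) (i j : Fin 2) : A⟦X⟧ :=
  g q d i j (lin (x Gen.Cinv)) 1 * invGLeft q d i j (x Gen.C)

/-- The expansion in powers of `z/w` of `g_{j,i}(w, q^{-c} z) / g_{j,i}(w, q^c z)`. -/
def ratioRight (q d : ℂ) (x : Gen → A) (i j : Fin 2) : A⟦X⟧ :=
  g q d j i 1 (lin (x Gen.Cinv)) * invGRight q d i j (x Gen.C)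

/-- The defining relations, for a family `x` of elements indexed by the generators: `DefRel q d x a b`
means that `a = b` is one of them. A relation between formal series stands for the
relations between all of its coefficients. -/
inductive DefRel (q d : ℂ) (x : Gen → A) : A → A → Prop
  | K_Kinv (i : Fin 2) : DefRel q d x (x (Gen.K i) * x (Gen.Kinv i)) 1
  | Kinv_K (i : Fin 2) : DefRel q d x (x (Gen.Kinv i) * x (Gen.K i)) 1
  | C_Cinv : DefRel q d x (x Gen.C * x Gen.Cinv) 1
  | Cinv_C : DefRel q d x (x Gen.Cinv * x Gen.C) 1
  /-- `q^c` is central. -/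
  | C_central (y : Gen) : DefRel q d x (x Gen.C * x y) (x y * x Gen.C)
  /-- `q^{-c}` is central. -/
  | Cinv_central (y : Gen) : DefRel q d x (x Gen.Cinv * x y) (x y * x Gen.Cinv)
  /-- `K_i^+(z) K_j^+(w) = K_j^+(w) K_i^+(z)`. -/
  | KK_plus (i j : Fin 2) (m n : ℤ) :
      DefRel q d x (Kplus q x i m * Kplus q x j n) (Kplus q x j n * Kplus q x i m)
  /-- `K_i^-(z) K_j^-(w) = K_j^-(w) K_i^-(z)`. -/
  | KK_minus (i j : Fin 2) (m n : ℤ) :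
      DefRel q d x (Kminus q x i m * Kminus q x j n) (Kminus q x j n * Kminus q x i m)
  /-- The coefficient of `z^a w^{-b}` in the relation
  `g_{i,j}(q^{-c}z,w)/g_{i,j}(q^c z,w) K_i^-(z) K_j^+(w)
    = g_{j,i}(w,q^{-c}z)/g_{j,i}(w,q^c z) K_j^+(w) K_i^-(z)`. -/
  | KK_mixed (i j : Fin 2) (a b : ℕ) :
      DefRel q d x
        (∑ k ∈ Finset.range (min a b + 1), PowerSeries.coeff k (ratioLeft q d x i j) *
          (PowerSeries.coeff (a - k) (KminusS q x i) * PowerSeries.coeff (b - k) (KplusS q x j)))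
        (∑ k ∈ Finset.range (min a b + 1), PowerSeries.coeff k (ratioRight q d x i j) *
          (PowerSeries.coeff (b - k) (KplusS q x j) * PowerSeries.coeff (a - k) (KminusS q x i)))
  /-- `d_{i,j} g_{i,j}(z,w) K_i^+(z) E_j(w) + g_{j,i}(w,z) E_j(w) K_i^+(z) = 0`. -/
  | KE_plus (i j : Fin 2) (m n : ℤ) :
      DefRel q d x
        ((dsign i j • g q d i j (mulZ A) (mulW A)
              (prodZW (Kplus q x i) fun l => x (Gen.E j l))
          + g q d j i (mulW A) (mulZ A)
              (prodWZ (Kplus q x i) fun l => x (Gen.E j l))) m n) 0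
  /-- `d_{i,j} g_{i,j}(z,w) K_i^-(q^c z) E_j(w) + g_{j,i}(w,z) E_j(w) K_i^-(q^c z) = 0`. -/
  | KE_minus (i j : Fin 2) (m n : ℤ) :
      DefRel q d x
        ((dsign i j • g q d i j (mulZ A) (mulW A)
              (prodZW (scaleC x (Kminus q x i)) fun l => x (Gen.E j l))
          + g q d j i (mulW A) (mulZ A)
              (prodWZ (scaleC x (Kminus q x i)) fun l => x (Gen.E j l))) m n) 0
  /-- `d_{j,i} g_{j,i}(w,z) K_i^+(q^c z) F_j(w) + g_{i,j}(z,w) F_j(w) K_i^+(q^c z) = 0`. -/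
  | KF_plus (i j : Fin 2) (m n : ℤ) :
      DefRel q d x
        ((dsign j i • g q d j i (mulW A) (mulZ A)
              (prodZW (scaleC x (Kplus q x i)) fun l => x (Gen.F j l))
          + g q d i j (mulZ A) (mulW A)
              (prodWZ (scaleC x (Kplus q x i)) fun l => x (Gen.F j l))) m n) 0
  /-- `d_{j,i} g_{j,i}(w,z) K_i^-(z) F_j(w) + g_{i,j}(z,w) F_j(w) K_i^-(z) = 0`. -/
  | KF_minus (i j : Fin 2) (m n : ℤ) :
      DefRel q d x
        ((dsign j i • g q d j i (mulW A) (mulZ A)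
              (prodZW (Kminus q x i) fun l => x (Gen.F j l))
          + g q d i j (mulZ A) (mulW A)
              (prodWZ (Kminus q x i) fun l => x (Gen.F j l))) m n) 0
  /-- `d_{i,j} g_{i,j}(z,w) E_i(z) E_j(w) + g_{j,i}(w,z) E_j(w) E_i(z) = 0`. -/
  | EE (i j : Fin 2) (m n : ℤ) :
      DefRel q d x
        ((dsign i j • g q d i j (mulZ A) (mulW A)
              (prodZW (fun l => x (Gen.E i l)) fun l => x (Gen.E j l))
          + g q d j i (mulW A) (mulZ A)
              (prodWZ (fun l => x (Gen.E i l)) fun l => x (Gen.E j l))) m n) 0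
  /-- `d_{j,i} g_{j,i}(w,z) F_i(z) F_j(w) + g_{i,j}(z,w) F_j(w) F_i(z) = 0`. -/
  | FF (i j : Fin 2) (m n : ℤ) :
      DefRel q d x
        ((dsign j i • g q d j i (mulW A) (mulZ A)
              (prodZW (fun l => x (Gen.F i l)) fun l => x (Gen.F j l))
          + g q d i j (mulZ A) (mulW A)
              (prodWZ (fun l => x (Gen.F i l)) fun l => x (Gen.F j l))) m n) 0
  /-- The coefficient of `z^{-m} w^{-n}` in the relation `[E_i(z), F_j(w)]
    = δ_{i,j}/(q - q⁻¹) (δ(q^c w/z) K_i^+(z) - δ(q^c z/w) K_i^-(w))`. -/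
  | EF (i j : Fin 2) (m n : ℤ) :
      DefRel q d x
        (x (Gen.E i m) * x (Gen.F j n) - x (Gen.F j n) * x (Gen.E i m))
        (if i = j then
          (q - q⁻¹)⁻¹ • (Cpow x (-n) * Kplus q x i (m + n) - Cpow x (-m) * Kminus q x i (m + n))
        else 0)
  /-- `Sym_{z₁,z₂,z₃} [E_i(z₁), [E_i(z₂), [E_i(z₃), E_j(w)]_{q₂}]]_{q₂⁻¹} = 0` for `i ≠ j`. -/
  | serreE (i j : Fin 2) (hij : i ≠ j) (n : Fin 3 → ℤ) (m : ℤ) :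
      DefRel q d x
        (∑ σ : Equiv.Perm (Fin 3),
          brk (q2 q)⁻¹ (x (Gen.E i (n (σ 0)))) (brk 1 (x (Gen.E i (n (σ 1))))
            (brk (q2 q) (x (Gen.E i (n (σ 2)))) (x (Gen.E j m))))) 0
  /-- `Sym_{z₁,z₂,z₃} [F_i(z₁), [F_i(z₂), [F_i(z₃), F_j(w)]_{q₂}]]_{q₂⁻¹} = 0` for `i ≠ j`. -/
  | serreF (i j : Fin 2) (hij : i ≠ j) (n : Fin 3 → ℤ) (m : ℤ) :
      DefRel q d x
        (∑ σ : Equiv.Perm (Fin 3),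
          brk (q2 q)⁻¹ (x (Gen.F i (n (σ 0)))) (brk 1 (x (Gen.F i (n (σ 1))))
            (brk (q2 q) (x (Gen.F i (n (σ 2)))) (x (Gen.F j m))))) 0

end Relations

/-- The quantum toroidal algebra `𝓔₂` of type `gl₂`: the unital associative `ℂ`-algebra with the
above generators and defining relations. -/
abbrev E2 (q d : ℂ) : Type := RingQuot (DefRel q d (FreeAlgebra.ι ℂ : Gen → FreeAlgebra ℂ Gen))

/-- The generators, as elements of `𝓔₂`. -/
def E2.gen (q d : ℂ) (y : Gen) : E2 q d :=
  RingQuot.mkAlgHom ℂ (DefRel q d (FreeAlgebra.ι ℂ : Gen → FreeAlgebra ℂ Gen)) (FreeAlgebra.ι ℂ y)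

/-! ## The Fock module and the Heisenberg algebra acting on it -/

/-- The polynomial algebra `ℂ[α_{1,-1}, α_{1,-2}, …, α_{2,-1}, α_{2,-2}, …]`; the variable `(i, k)`
stands for `α_{i,-(k+1)}`. -/
abbrev Poly : Type := MvPolynomial (Fin 2 × ℕ) ℂ

/-- The vector space underlying the Fock module `𝓕_u = ⨁_{n ∈ ℤ} 𝓕(n,u)`, where
`𝓕(n,u) = ℂ[α_{1,-1}, α_{1,-2}, …, α_{2,-1}, α_{2,-2}, …] |n,u⟩`. The parameter `u` only enters
through the action of `𝖺₀`. -/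
def Fock : Type := ℤ →₀ Poly

instance : AddCommGroup Fock := inferInstanceAs (AddCommGroup (ℤ →₀ Poly))

instance : Module ℂ Fock := inferInstanceAs (Module ℂ (ℤ →₀ Poly))

/-- The identification of `Fock` with the finitely supported functions `ℤ → Poly`. -/
def Fock.of : (ℤ →₀ Poly) ≃ₗ[ℂ] Fock := LinearEquiv.refl ℂ (ℤ →₀ Poly)

/-- The inclusion of the summand `𝓕(n,u)`: it sends `p` to `p |n,u⟩`. -/
def inj (n : ℤ) : Poly →ₗ[ℂ] Fock := Fock.of.toLinearMap ∘ₗ Finsupp.lsingle n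

/-- The operator on the Fock module given by `f n` on the summand `𝓕(n,u)`. -/
def ofSectors (f : ℤ → Poly →ₗ[ℂ] Fock) : Module.End ℂ Fock :=
  (Finsupp.lsum ℂ f) ∘ₗ Fock.of.symm.toLinearMap

theorem ofSectors_inj (f : ℤ → Poly →ₗ[ℂ] Fock) (n : ℤ) (p : Poly) :
    ofSectors f (inj n p) = f n p := by
  simp [ofSectors, inj]

theorem fock_induction {P : Fock → Prop} (h0 : P 0) (hadd : ∀ v w, P v → P w → P (v + w))
    (hinj : ∀ n p, P (inj n p)) (v : Fock) : P v :=
  Finsupp.induction_linear (motive := fun w => P (Fock.of w)) v h0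
    (fun _ _ hv hw => hadd _ _ hv hw) hinj

theorem end_ext {S T : Module.End ℂ Fock} (h : ∀ n p, S (inj n p) = T (inj n p)) : S = T :=
  LinearMap.ext <| fock_induction (by simp) (fun v w hv hw => by simp [hv, hw]) h

/-- The vector `|n,u⟩`. -/
def ket (n : ℤ) : Fock := inj n 1

/-- The scalar `[α_{i,n}, α_{j,-n}]` (for `n > 0`): `n (1 + q₂^{-n})` if `i = j`, and
`-n (q₁^n + q₃^n)` otherwise. -/
def pairing (q d : ℂ) (i j : Fin 2) (n : ℕ) : ℂ :=
  if i = j then n * (1 + ((q2 q) ^ n)⁻¹) else -n * ((q1 q d) ^ n + (q3 q d) ^ n)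

/-- `α_{1,0}` and `α_{2,0} = -α_{1,0}` act on `𝓕(n,u)` by `n` and `-n`. -/
def eps (i : Fin 2) : ℤ := if i = 0 then 1 else -1

/-- The operator acting on each `𝓕(n,u)` by the scalar `f n`. -/
def diag (f : ℤ → ℂ) : Module.End ℂ Fock :=
  ofSectors fun n => f n • inj n

/-- The creation operator `α_{i,-(k+1)}`. -/
def creation (i : Fin 2) (k : ℕ) : Module.End ℂ Fock :=
  ofSectors fun n => inj n ∘ₗ LinearMap.mulLeft ℂ (MvPolynomial.X (i, k))

/-- The annihilation operator `α_{i,k+1}`: the derivation of the polynomial algebra that sends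
`α_{j,-(k+1)}` to `[α_{i,k+1}, α_{j,-(k+1)}]` and kills the other variables. -/
def annihilation (q d : ℂ) (i : Fin 2) (k : ℕ) : Module.End ℂ Fock :=
  ofSectors fun n => inj n ∘ₗ
    (∑ j : Fin 2, pairing q d i j (k + 1) • (MvPolynomial.pderiv (R := ℂ) (j, k)).toLinearMap)

/-- The action of `α_{i,n}` on the Fock module. -/
def alpha (q d : ℂ) (i : Fin 2) : ℤ → Module.End ℂ Fock
  | Int.ofNat 0 => diag fun n => (eps i * n : ℤ)
  | Int.ofNat (k + 1) => annihilation q d i k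
  | Int.negSucc k => creation i k

/-- The action of `e^{t χ_i}` (`t ∈ ℤ`): as `|n,u⟩ = e^{(n/2) χ_1 + (u/β) 𝖰}|0⟩` and `χ_2 = -χ_1`,
it sends `p |n,u⟩` to `p |n + 2t,u⟩` if `i` is the first index, and to `p |n - 2t,u⟩` otherwise. -/
def expChi (i : Fin 2) (t : ℤ) : Module.End ℂ Fock :=
  ofSectors fun n => inj (n + 2 * t * eps i)

/-! The Heisenberg relations hold for these operators. -/

theorem diag_inj (f : ℤ → ℂ) (n : ℤ) (p : Poly) : diag f (inj n p) = inj n (f n • p) := by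
  simp [diag, ofSectors_inj]

theorem creation_inj (i : Fin 2) (k : ℕ) (n : ℤ) (p : Poly) :
    creation i k (inj n p) = inj n (MvPolynomial.X (i, k) * p) := by
  simp [creation, ofSectors_inj]

theorem annihilation_inj (q d : ℂ) (i : Fin 2) (k : ℕ) (n : ℤ) (p : Poly) :
    annihilation q d i k (inj n p)
      = inj n (∑ j : Fin 2, pairing q d i j (k + 1) • MvPolynomial.pderiv (j, k) p) := by
  simp [annihilation, ofSectors_inj]

theorem expChi_inj (i : Fin 2) (t n : ℤ) (p : Poly) :
    expChi i t (inj n p) = inj (n + 2 * t * eps i) p := by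
  simp [expChi, ofSectors_inj]

theorem alpha_zero_inj (q d : ℂ) (i : Fin 2) (n : ℤ) (p : Poly) :
    alpha q d i 0 (inj n p) = ((eps i * n : ℤ) : ℂ) • inj n p := by
  change diag _ _ = _
  rw [diag_inj, map_smul]

theorem alpha_zero_expChi (q d : ℂ) (i j : Fin 2) (t : ℤ) :
    alpha q d i 0 * expChi j t - expChi j t * alpha q d i 0
      = ((if i = j then 2 else -2) * t : ℂ) • expChi j t := by
  refine end_ext fun n p => ?_
  simp only [LinearMap.sub_apply, Module.End.mul_apply, LinearMap.smul_apply, alpha_zero_inj,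
    map_smul, expChi_inj]
  rw [← sub_smul]
  congr 1
  fin_cases i <;> fin_cases j <;> simp [eps]

theorem annihilation_creation (q d : ℂ) (i j : Fin 2) (k l : ℕ) :
    annihilation q d i k * creation j l - creation j l * annihilation q d i k
      = (if k = l then pairing q d i j (k + 1) else 0) • (1 : Module.End ℂ Fock) := by
  refine end_ext fun n p => ?_
  simp only [LinearMap.sub_apply, Module.End.mul_apply, LinearMap.smul_apply, Module.End.one_apply,
    creation_inj, annihilation_inj, ← map_sub, ← map_smul]
  congr 1
  by_cases hkl : k = l
  · subst hkl
    fin_cases j <;>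
    simp [Fin.sum_univ_two, MvPolynomial.pderiv_X, Derivation.leibniz, Pi.single_apply,
      MvPolynomial.smul_eq_C_mul] <;> ring
  · fin_cases j <;>
    simp [Fin.sum_univ_two, MvPolynomial.pderiv_X, Derivation.leibniz,
      MvPolynomial.smul_eq_C_mul, hkl, Ne.symm hkl] <;> ring

theorem diag_comm (f h : ℤ → ℂ) : diag f * diag h = diag h * diag f := by
  refine end_ext fun n p => ?_
  simp only [Module.End.mul_apply, diag_inj, smul_smul, mul_comm]

theorem diag_creation (f : ℤ → ℂ) (j : Fin 2) (l : ℕ) :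
    diag f * creation j l = creation j l * diag f := by
  refine end_ext fun n p => ?_
  simp only [Module.End.mul_apply, creation_inj, diag_inj, mul_smul_comm]

theorem diag_annihilation (f : ℤ → ℂ) (q d : ℂ) (j : Fin 2) (l : ℕ) :
    diag f * annihilation q d j l = annihilation q d j l * diag f := by
  refine end_ext fun n p => ?_
  simp only [Module.End.mul_apply, annihilation_inj, diag_inj, Finset.smul_sum,
    Derivation.map_smul, smul_comm (f n)]

theorem creation_comm (i j : Fin 2) (k l : ℕ) :
    creation i k * creation j l = creation j l * creation i k := by
  refine end_ext fun n p => ?_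
  simp only [Module.End.mul_apply, creation_inj, mul_left_comm]

theorem pderiv_comm (a b : Fin 2 × ℕ) (p : Poly) :
    MvPolynomial.pderiv a (MvPolynomial.pderiv b p)
      = MvPolynomial.pderiv b (MvPolynomial.pderiv a p) := by
  have h : ⁅MvPolynomial.pderiv (R := ℂ) a, MvPolynomial.pderiv (R := ℂ) b⁆ = 0 := by
    refine MvPolynomial.derivation_ext fun c => ?_
    classical
    simp [Derivation.commutator_apply, MvPolynomial.pderiv_X, Pi.single_apply, apply_ite]
  have := congrArg (fun D => D p) h
  simpa [Derivation.commutator_apply, sub_eq_zero] using this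

theorem annihilation_comm (q d : ℂ) (i j : Fin 2) (k l : ℕ) :
    annihilation q d i k * annihilation q d j l = annihilation q d j l * annihilation q d i k := by
  refine end_ext fun n p => ?_
  rw [Module.End.mul_apply, Module.End.mul_apply, annihilation_inj, annihilation_inj,
    annihilation_inj, annihilation_inj]
  refine congrArg (inj n) ?_
  simp only [map_sum, Derivation.map_smul, Finset.smul_sum]
  refine Finset.sum_comm.trans ?_
  refine Finset.sum_congr rfl fun a _ => Finset.sum_congr rfl fun b _ => ?_
  rw [pderiv_comm, smul_comm]

theorem alpha_commutator (q d : ℂ) (i j : Fin 2) (m n : ℤ) :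
    alpha q d i m * alpha q d j n - alpha q d j n * alpha q d i m
      = (if m + n = 0 then
          (if i = j then (m : ℂ) * (1 + (q2 q) ^ (-|m|))
            else -(m : ℂ) * ((q1 q d) ^ |m| + (q3 q d) ^ |m|))
        else 0) • (1 : Module.End ℂ Fock) := by
  rcases m with (_ | k) | k <;> rcases n with (_ | l) | l
  · simp only [alpha, diag_comm]
    simp
  · simp only [alpha, diag_annihilation, sub_self]
    rw [if_neg (by simp; omega), zero_smul]
  · simp only [alpha, diag_creation, sub_self]
    rw [if_neg (by simp), zero_smul]
  · simp only [alpha, diag_annihilation, sub_self]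
    rw [if_neg (by simp; omega), zero_smul]
  · simp only [alpha, annihilation_comm q d i j, sub_self]
    rw [if_neg (by simp; omega), zero_smul]
  · simp only [alpha, annihilation_creation]
    congr 1
    have h : (Int.ofNat (k + 1) + Int.negSucc l = 0) ↔ k = l := by
      rw [Int.ofNat_eq_natCast, Int.negSucc_eq]; push_cast; omega
    have h2 : |Int.ofNat (k + 1)| = ((k + 1 : ℕ) : ℤ) := by
      rw [Int.ofNat_eq_natCast]; exact abs_of_nonneg (by omega)
    simp only [h]
    rw [h2, zpow_neg, zpow_natCast, zpow_natCast, zpow_natCast]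
    simp only [pairing, Int.ofNat_eq_natCast, Int.cast_natCast]
  · simp only [alpha, diag_creation, sub_self]
    rw [if_neg (by simp), zero_smul]
  · refine (neg_sub _ _).symm.trans ?_
    simp only [alpha]
    rw [annihilation_creation, ← neg_smul]
    congr 1
    have h : (Int.negSucc k + Int.ofNat (l + 1) = 0) ↔ l = k := by
      rw [Int.ofNat_eq_natCast, Int.negSucc_eq]; push_cast; omega
    have h2 : |Int.negSucc k| = ((k + 1 : ℕ) : ℤ) := by
      rw [Int.negSucc_eq, abs_neg]; exact abs_of_nonneg (by omega)
    simp only [h]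
    rw [h2, zpow_neg, zpow_natCast, zpow_natCast, zpow_natCast]
    simp only [pairing, Int.cast_negSucc, eq_comm (a := j)]
    by_cases hkl : l = k
    · subst hkl
      by_cases hij : i = j <;> simp [hij] <;> ring
    · simp [hkl]
  · simp only [alpha, creation_comm i j, sub_self]
    rw [if_neg (by rw [Int.negSucc_eq, Int.negSucc_eq]; omega), zero_smul]

/-! ## Vertex operators -/

/-- The power series in `z⁻¹`, with operator coefficients, `exp(∑_{n > 0} c_n α_{i,n} z^{-n})`. -/
def expPos (q d : ℂ) (i : Fin 2) (c : ℤ → ℂ) : (Module.End ℂ Fock)⟦X⟧ :=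
  expSeries (PowerSeries.mk fun n => if n = 0 then 0 else c n • alpha q d i n)

/-- The power series in `z`, with operator coefficients, `exp(∑_{n > 0} c_{-n} α_{i,-n} z^n)`. -/
def expNeg (q d : ℂ) (i : Fin 2) (c : ℤ → ℂ) : (Module.End ℂ Fock)⟦X⟧ :=
  expSeries (PowerSeries.mk fun n => if n = 0 then 0 else c (-n) • alpha q d i (-n))

/-- The sum of a locally finite family of operators: on every vector, all but finitely many
operators vanish. -/
def locSum (T : ℕ → Module.End ℂ Fock)
    (hT : ∀ v, (Function.support fun l => T l v).Finite) : Module.End ℂ Fock where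
  toFun v := ∑ᶠ l, T l v
  map_add' v w := by
    simp only [map_add]
    exact finsum_add_distrib (hT v) (hT w)
  map_smul' c v := by
    simp only [map_smul, RingHom.id_apply]
    exact (smul_finsum c _).symm

/-- The vectors of degree `D`, where `α_{i,-(k+1)}` has degree `k + 1`. -/
def gradedPart (D : ℤ) : Submodule ℂ Fock where
  carrier := {v | ∀ n, MvPolynomial.IsWeightedHomogeneous
    (fun a : Fin 2 × ℕ => ((a.2 : ℤ) + 1)) (Fock.of.symm v n) D}
  add_mem' hv hw n := (hv n).add (hw n)
  zero_mem' _ := MvPolynomial.isWeightedHomogeneous_zero ℂ _ D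
  smul_mem' c _ hv n :=
    (MvPolynomial.weightedHomogeneousSubmodule ℂ _ D).smul_mem c (hv n)

theorem gradedPart_neg {D : ℤ} (hD : D < 0) {v : Fock} (hv : v ∈ gradedPart D) : v = 0 := by
  refine Finsupp.ext fun n => MvPolynomial.ext _ _ fun e => ?_
  by_contra h
  have := hv n h
  have h2 : 0 ≤ Finsupp.weight (fun a : Fin 2 × ℕ => ((a.2 : ℤ) + 1)) e := by
    rw [Finsupp.weight_apply]
    exact Finset.sum_nonneg fun a _ => smul_nonneg (Nat.zero_le _) (by positivity)
  omega

theorem alpha_mem_gradedPart (q d : ℂ) (i : Fin 2) (n : ℕ) (hn : n ≠ 0) (D : ℤ) {v : Fock}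
    (hv : v ∈ gradedPart D) : alpha q d i n v ∈ gradedPart (D - n) := by
  obtain ⟨k, rfl⟩ := Nat.exists_eq_succ_of_ne_zero hn
  intro m
  change MvPolynomial.IsWeightedHomogeneous _ (Fock.of.symm (annihilation q d i k v) m) _
  have h : Fock.of.symm (annihilation q d i k v) m = ∑ j : Fin 2,
      pairing q d i j (k + 1) • MvPolynomial.pderiv (j, k) (Fock.of.symm v m) := by
    clear hv
    induction v using fock_induction with
    | h0 => simp
    | hadd v w hv hw => simp only [map_add, Finsupp.add_apply, hv, hw, smul_add,
        Finset.sum_add_distrib]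
    | hinj n p =>
      rw [annihilation_inj]
      by_cases hnm : n = m
      · subst hnm
        simp [inj]
      · simp [inj, hnm]
  rw [h]
  refine (MvPolynomial.weightedHomogeneousSubmodule ℂ _ _).sum_mem fun j _ =>
    (MvPolynomial.weightedHomogeneousSubmodule ℂ _ _).smul_mem _ ?_
  exact MvPolynomial.IsWeightedHomogeneous.pderiv (hv m) (by push_cast; ring)

theorem coeff_expPos_mem (q d : ℂ) (i : Fin 2) (c : ℤ → ℂ) (l : ℕ) (D : ℤ) {v : Fock}
    (hv : v ∈ gradedPart D) :
    PowerSeries.coeff l (expPos q d i c) v ∈ gradedPart (D - l) := by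
  have key : ∀ (k l : ℕ) (D : ℤ) (v : Fock), v ∈ gradedPart D →
      PowerSeries.coeff l ((PowerSeries.mk fun n : ℕ =>
        if n = 0 then 0 else c n • alpha q d i n : (Module.End ℂ Fock)⟦X⟧) ^ k) v
          ∈ gradedPart (D - l) := by
    intro k
    induction k with
    | zero =>
      intro l D v hv
      rw [pow_zero, PowerSeries.coeff_one]
      split_ifs with h
      · subst h
        simpa using hv
      · simp
    | succ k ih =>
      intro l D v hv
      rw [pow_succ, PowerSeries.coeff_mul, LinearMap.sum_apply]
      refine Submodule.sum_mem _ fun p hp => ?_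
      rw [Finset.HasAntidiagonal.mem_antidiagonal] at hp
      have hD : D - (l : ℤ) = D - p.2 - p.1 := by rw [← hp]; push_cast; ring
      rw [Module.End.mul_apply, hD]
      apply ih
      rw [PowerSeries.coeff_mk]
      split_ifs with h
      · simp
      · exact Submodule.smul_mem _ _ (alpha_mem_gradedPart q d i _ h D hv)
  rw [expPos, expSeries, PowerSeries.coeff_mk, LinearMap.sum_apply]
  exact Submodule.sum_mem _ fun k _ => Submodule.smul_mem _ _ (key k l D v hv)

theorem finite_support_expPos (q d : ℂ) (i : Fin 2) (c : ℤ → ℂ) (v : Fock) :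
    (Function.support fun l => PowerSeries.coeff l (expPos q d i c) v).Finite := by
  have hadd : ∀ v w : Fock,
      (Function.support fun l => PowerSeries.coeff l (expPos q d i c) v).Finite →
      (Function.support fun l => PowerSeries.coeff l (expPos q d i c) w).Finite →
      (Function.support fun l => PowerSeries.coeff l (expPos q d i c) (v + w)).Finite := by
    intro v w hv hw
    simp only [map_add]
    exact (hv.union hw).subset (Function.support_add _ _)
  induction v using fock_induction with
  | h0 => simp
  | hadd v w hv hw => exact hadd v w hv hw
  | hinj n p =>
    induction p using MvPolynomial.induction_on' with
    | monomial e a =>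
      refine (Set.finite_Iic
        (Finsupp.weight (fun a : Fin 2 × ℕ => ((a.2 : ℤ) + 1)) e).toNat).subset fun l hl => ?_
      by_contra h
      rw [Set.mem_Iic, not_le] at h
      refine hl (gradedPart_neg (D := Finsupp.weight
        (fun a : Fin 2 × ℕ => ((a.2 : ℤ) + 1)) e - l) (by omega)
        (coeff_expPos_mem q d i c l _ fun m => ?_))
      change MvPolynomial.IsWeightedHomogeneous _ (Finsupp.single n _ m) _
      rw [Finsupp.single_apply]
      split_ifs
      · exact MvPolynomial.isWeightedHomogeneous_monomial _ _ _ rfl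
      · exact MvPolynomial.isWeightedHomogeneous_zero ℂ _ _
    | add p p' hp hp' =>
      rw [map_add]
      exact hadd _ _ hp hp'

/-- The coefficient of `z^{-m}` in the normally ordered exponential
`:exp(∑_{n ≠ 0} c_n α_{i,n} z^{-n}): = exp(∑_{n > 0} c_{-n} α_{i,-n} z^n) exp(∑_{n > 0} c_n α_{i,n} z^{-n})`. -/
def normalExp (q d : ℂ) (i : Fin 2) (c : ℤ → ℂ) (m : ℤ) : Module.End ℂ Fock :=
  locSum (fun l : ℕ => if m ≤ l then PowerSeries.coeff (l - m).toNat (expNeg q d i c) *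
      PowerSeries.coeff l (expPos q d i c) else 0) <| by
    intro v
    refine (finite_support_expPos q d i c v).subset fun l hl h => hl ?_
    dsimp only at h ⊢
    split_ifs
    · rw [Module.End.mul_apply, h, map_zero]
    · rfl

/-- The coefficient of `z^{-m}` in `η_i(z) = :exp(-∑_{n ≠ 0} (1/n) α_{i,n} z^{-n}):`. -/
def eta (q d : ℂ) (i : Fin 2) : ℤ → Module.End ℂ Fock :=
  normalExp q d i fun n => -(1 / (n : ℂ))

/-- The coefficient of `z^{-m}` in `ξ_i(z) = :exp(∑_{n ≠ 0} (q^{|n|}/n) α_{i,n} z^{-n}):`. -/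
def xi (q d : ℂ) (i : Fin 2) : ℤ → Module.End ℂ Fock :=
  normalExp q d i fun n => q ^ |n| / (n : ℂ)

/-- `φ_i^+(z) = exp(-∑_{n > 0} ((1 - q₂^n)/n) q^{-n/2} α_{i,n} z^{-n})` as a power series in `z⁻¹`.
Here `s` is the chosen square root of `q`. -/
def phiPlus (q d s : ℂ) (i : Fin 2) : (Module.End ℂ Fock)⟦X⟧ :=
  expPos q d i fun n => -((1 - (q2 q) ^ n) / (n : ℂ) * s ^ (-n))

/-- `φ_i^-(z) = exp(∑_{n > 0} ((1 - q₂^n)/n) q^{-n/2} α_{i,-n} z^n)` as a power series in `z`. -/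
def phiMinus (q d s : ℂ) (i : Fin 2) : (Module.End ℂ Fock)⟦X⟧ :=
  expNeg q d i fun n => (1 - (q2 q) ^ (-n)) / ((-n : ℤ) : ℂ) * s ^ n

/-- The operator `q₁^{t 𝖺₀}` (`t ∈ ℤ`). As `𝖺₀` acts on `𝓕_u` by `u`, it is the scalar
`q₁^{t u} = exp(t u log q₁)`, where `L` is the chosen value of `log q₁`. -/
def q1PowA0 (u L : ℂ) (t : ℤ) : Module.End ℂ Fock :=
  algebraMap ℂ (Module.End ℂ Fock) (Complex.exp (t * u * L))

/-- The coefficient of `z^{-m}` in `v(z) e^{t χ_i} z^{t α_{i,0} + 1} q₁^{t 𝖺₀}`, for `t ∈ ℤ` and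
`v(z) = ∑ v_m z^{-m}`: on `𝓕(n,u)`, the factor `z^{t α_{i,0} + 1}` is `z^{t eps_i n + 1}`. -/
def dressed (u L : ℂ) (i : Fin 2) (t : ℤ) (v : ℤ → Module.End ℂ Fock) (m : ℤ) :
    Module.End ℂ Fock :=
  ofSectors fun n => (v (m + (t * (eps i * n) + 1)) * expChi i t * q1PowA0 u L t) ∘ₗ inj n

/-- The coefficient of `z^{-m}` in `η_i(z) e^{χ_i} z^{α_{i,0} + 1} q₁^{𝖺₀}`. -/
def rhoE (q d u L : ℂ) (i : Fin 2) (m : ℤ) : Module.End ℂ Fock :=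
  dressed u L i 1 (eta q d i) m

/-- The coefficient of `z^{-m}` in `ξ_i(z) e^{-χ_i} z^{-α_{i,0} + 1} q₁^{-𝖺₀}`. -/
def rhoF (q d u L : ℂ) (i : Fin 2) (m : ℤ) : Module.End ℂ Fock :=
  dressed u L i (-1) (xi q d i) m

/-- The coefficient of `z^{-k}` (`k ≥ 0`) in `φ_i^+(q^{-1/2} z) q^{α_{i,0}}`. -/
def rhoKplus (q d s : ℂ) (i : Fin 2) (k : ℕ) : Module.End ℂ Fock :=
  ((s⁻¹) ^ (-(k : ℤ)) • PowerSeries.coeff k (phiPlus q d s i)) * diag fun n => q ^ (eps i * n)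

/-- The coefficient of `z^k` (`k ≥ 0`) in `φ_i^-(q^{-1/2} z) q^{-α_{i,0}}`. -/
def rhoKminus (q d s : ℂ) (i : Fin 2) (k : ℕ) : Module.End ℂ Fock :=
  ((s⁻¹) ^ k • PowerSeries.coeff k (phiMinus q d s i)) * diag fun n => q ^ (-(eps i * n))

end

end QToroidal

/-! Most relations are reduced to scalar identities by one principle, `eq_zero_of_vac`: a space of
operators that is stable under commutators with all α_{j,k}, k ≠ 0, is zero as soon as its matrix
coefficients between the vectors |n,u⟩ vanish. Creation operators on the right and annihilation
operators on the left are commuted through until only these coefficients remain; this needs the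
Heisenberg pairing to be nondegenerate in every degree, which is where genericity of q, d enters
(`pairing_nondegenerate`). The images of the currents are primary, [α_{j,k}, U(z)] = s_{j,k} z^k
U(z), and weights add in products, so the coefficients of a relation between products of equal
weights span such a space.

The scalar identities come from reordering exponentials. An exponential is handled through the
recursion n a_n = Σ k h_k a_{n-k} (`IsExp`), and moving one exponential past another costs a scalar
series, the contraction, which here is always a product of factors (1 - a x)^{±1}. Combined with the
powers of z and q from the zero modes it gives two-point functions that are expansions of rational
functions. For EE, FF, KE and KF, clearing the denominators gives the relation. For E_i and F_j with
i ≠ j the contraction is a palindromic polynomial, and the operators commute. For i = j it is 1/((1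
- qx)(1 - q⁻¹x)); its two expansions differ by delta functions at the poles, where η and ξ fuse into
K^±. The relations among the K^± alone are proved by direct reordering.

For the Serre relations the words in three U's and one D are computed on vectors |k,u⟩. Each U
contributes an expansion of 1/((1 - ax)(1 - bx)), in a direction that depends on its side of D. Both
expansions are images of one symmetric sequence `theta` under difference operators with mutually
reversed symbols, so every word is the value of a single linear functional on a polynomial. The
relation then follows from a polynomial identity, `serre_identity`, and delta-function terms need no
separate treatment.

Existence follows by choosing the images of the H_{i,k} so that K_i^±(z) becomes φ^± and factoring
through the presentation, whose relations are natural in the algebra. Uniqueness holds because K_i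
is invertible, an exponential determines its exponent, and q - q⁻¹ ≠ 0. -/

namespace QToroidal

/-! ## Exponential series -/

section Exponential

variable {A : Type} [Ring A] [Algebra ℂ A]

/-- The recursion `n a_n = ∑_{k+r=n} k h_k a_r` that characterizes `a = exp(h)`. -/
structure IsExp (h a : ℕ → A) : Prop where
  zero : a 0 = 1
  step : ∀ n : ℕ, (n : ℂ) • a n = ∑ p ∈ Finset.HasAntidiagonal.antidiagonal n, (p.1 : ℂ) • (h p.1 * a p.2)

/-- The summand with `p.1 = 0` has weight 0, so the recursion expresses n a_n through earlier
coefficients, and n is invertible in ℂ. -/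
theorem IsExp.unique {h a b : ℕ → A} (ha : IsExp h a) (hb : IsExp h b) : a = b := by
  funext n
  induction n using Nat.strong_induction_on with
  | _ n ih =>
    rcases Nat.eq_zero_or_pos n with rfl | hn
    · rw [ha.zero, hb.zero]
    · have key : (n : ℂ) • a n = (n : ℂ) • b n := by
        rw [ha.step, hb.step]
        refine Finset.sum_congr rfl fun p hp => ?_
        rw [Finset.HasAntidiagonal.mem_antidiagonal] at hp
        rcases Nat.eq_zero_or_pos p.1 with h0 | h0
        · simp [h0]
        · rw [ih p.2 (by omega)]
      have hn' : (n : ℂ) ≠ 0 := by exact_mod_cast hn.ne'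
      exact smul_right_injective A hn' key

/-- The Euler operator `x d/dx` on power series. -/
noncomputable def euler (f : A⟦X⟧) : A⟦X⟧ := PowerSeries.mk fun n => (n : ℂ) • PowerSeries.coeff n f

theorem euler_mul (f g : A⟦X⟧) : euler (f * g) = euler f * g + f * euler g := by
  ext n
  simp only [euler, PowerSeries.coeff_mk, map_add, PowerSeries.coeff_mul, Finset.smul_sum,
    ← Finset.sum_add_distrib]
  refine Finset.sum_congr rfl fun p hp => ?_
  rw [Finset.HasAntidiagonal.mem_antidiagonal] at hp
  rw [← hp, smul_mul_assoc, mul_smul_comm, ← add_smul]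
  push_cast
  rfl

theorem euler_pow {f : A⟦X⟧} (hf : Commute (euler f) f) (k : ℕ) :
    euler (f ^ (k + 1)) = ((k + 1 : ℕ) : ℂ) • (euler f * f ^ k) := by
  induction k with
  | zero => simp
  | succ k ih =>
    rw [pow_succ, euler_mul, ih, smul_mul_assoc, mul_assoc, ← pow_succ, ← (hf.pow_right _).eq]
    push_cast
    module

theorem coeff_pow_eq_zero {B : Type} [Ring B] {f : B⟦X⟧} (hf : PowerSeries.coeff 0 f = 0) {k n : ℕ} (h : n < k) :
    PowerSeries.coeff n (f ^ k) = 0 := by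
  induction k generalizing n with
  | zero => omega
  | succ k ih =>
    rw [pow_succ, PowerSeries.coeff_mul]
    refine Finset.sum_eq_zero fun p hp => ?_
    rw [Finset.HasAntidiagonal.mem_antidiagonal] at hp
    rcases Nat.eq_zero_or_pos p.2 with h0 | h0
    · rw [h0, hf, mul_zero]
    · rw [ih (by omega), zero_mul]

/-- Termwise differentiation: the Euler operator sends h^(k+1)/(k+1)! to (x h') h^k/k!, since the
coefficients of h commute. -/
theorem isExp_expSeries {h : A⟦X⟧} (h0 : PowerSeries.coeff 0 h = 0)
    (hc : ∀ k l, Commute (PowerSeries.coeff k h) (PowerSeries.coeff l h)) :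
    IsExp (fun n => PowerSeries.coeff n h) fun n => PowerSeries.coeff n (expSeries h) where
  zero := by simp [expSeries]
  step n := by
    have hcomm : Commute (euler h) h := by
      ext n
      rw [PowerSeries.coeff_mul, PowerSeries.coeff_mul, ← Finset.Nat.sum_antidiagonal_swap]
      refine Finset.sum_congr rfl fun p _ => ?_
      simp only [euler, PowerSeries.coeff_mk, Prod.fst_swap, Prod.snd_swap]
      rw [smul_mul_assoc, mul_smul_comm, (hc _ _).eq]
    have h1 : (n : ℂ) • PowerSeries.coeff n (expSeries h)
        = ∑ k ∈ Finset.range n, ((k.factorial : ℂ)⁻¹) • PowerSeries.coeff n (euler h * h ^ k) := by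
      rw [expSeries, PowerSeries.coeff_mk, Finset.smul_sum, Finset.sum_range_succ']
      have hz : (n : ℂ) • ((Nat.factorial 0 : ℂ)⁻¹ • PowerSeries.coeff n (h ^ 0)) = 0 := by
        rw [pow_zero, PowerSeries.coeff_one]
        split_ifs with hn <;> simp [hn]
      rw [hz, add_zero]
      refine Finset.sum_congr rfl fun k _ => ?_
      have he : (n : ℂ) • PowerSeries.coeff n (h ^ (k + 1))
          = PowerSeries.coeff n (euler (h ^ (k + 1))) := by
        rw [euler, PowerSeries.coeff_mk]
      rw [smul_comm, he, euler_pow hcomm, PowerSeries.coeff_smul, smul_smul]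
      congr 1
      have : ((k + 1 : ℕ) : ℂ) ≠ 0 := by exact_mod_cast k.succ_ne_zero
      rw [Nat.factorial_succ, Nat.cast_mul, mul_inv, mul_assoc, mul_comm, mul_assoc,
        mul_inv_cancel₀ this, mul_one]
    rw [h1]
    simp only [PowerSeries.coeff_mul, Finset.smul_sum]
    rw [Finset.sum_comm]
    refine Finset.sum_congr rfl fun p hp => ?_
    rw [Finset.HasAntidiagonal.mem_antidiagonal] at hp
    simp only [euler, PowerSeries.coeff_mk, smul_mul_assoc]
    rcases Nat.eq_zero_or_pos p.1 with hp0 | hp0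
    · simp [hp0]
    rw [expSeries, PowerSeries.coeff_mk, Finset.mul_sum, Finset.smul_sum]
    -- `expSeries` in degree `p.2` stops at k = p.2, while the outer sum runs to k = n - 1. The
    -- extra powers of h have order larger than `p.2`. The inequality `p.2 + 1 ≤ n` uses `p.1 > 0`.
    rw [← Finset.sum_subset (Finset.range_mono (show p.2 + 1 ≤ n by omega))]
    · refine Finset.sum_congr rfl fun k _ => ?_
      rw [mul_smul_comm, smul_comm]
    · intro k _ hk
      rw [Finset.mem_range] at hk
      rw [coeff_pow_eq_zero h0 (by omega)]
      simp

theorem coeff_zero_expSeries (h : A⟦X⟧) : PowerSeries.coeff 0 (expSeries h) = 1 := by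
  simp [expSeries]

theorem map_expSeries {B : Type} [Ring B] [Algebra ℂ B] (φ : A →ₐ[ℂ] B) (h : A⟦X⟧) (n : ℕ) :
    φ (PowerSeries.coeff n (expSeries h))
      = PowerSeries.coeff n (expSeries (PowerSeries.map (φ : A →+* B) h)) := by
  simp only [expSeries, PowerSeries.coeff_mk, map_sum, map_smul, ← map_pow,
    PowerSeries.coeff_map]
  rfl

theorem IsExp.smul_pow {h a : ℕ → A} (ha : IsExp h a) (c : ℂ) :
    IsExp (fun n => c ^ n • h n) fun n => c ^ n • a n where
  zero := by simp [ha.zero]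
  step n := by
    rw [smul_comm, ha.step, Finset.smul_sum]
    refine Finset.sum_congr rfl fun p hp => ?_
    rw [Finset.HasAntidiagonal.mem_antidiagonal] at hp
    rw [← hp, pow_add, smul_mul_assoc, mul_smul_comm, smul_smul, smul_smul, smul_smul]
    congr 1
    ring

/-- The exponential of a series with commuting coefficients commutes with whatever commutes with
the coefficients. -/
theorem IsExp.commute {h a : ℕ → A} (ha : IsExp h a) {b : A} (hb : ∀ k, k ≠ 0 → Commute b (h k))
    (n : ℕ) : Commute b (a n) := by
  induction n using Nat.strong_induction_on with
  | _ n ih =>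
    rcases Nat.eq_zero_or_pos n with rfl | hn
    · rw [ha.zero]; exact Commute.one_right b
    · have hn' : (n : ℂ) ≠ 0 := by exact_mod_cast hn.ne'
      have h1 : Commute b ((n : ℂ) • a n) := by
        rw [ha.step]
        refine Commute.sum_right _ _ _ fun p hp => ?_
        rw [Finset.HasAntidiagonal.mem_antidiagonal] at hp
        rcases Nat.eq_zero_or_pos p.1 with hp0 | hp0
        · simp [hp0]
        · exact ((hb _ hp0.ne').mul_right (ih _ (by omega))).smul_right _
      have h2 := h1.smul_right ((n : ℂ)⁻¹)
      rwa [smul_smul, inv_mul_cancel₀ hn', one_smul] at h2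

/-- Commuting h_k also commute with the exponential, so h may stand on the right. This form is
needed when an annihilation operator must hit a vector first, and in the opposite algebra. -/
theorem IsExp.step_right {h a : ℕ → A} (ha : IsExp h a) (hc : ∀ k l, Commute (h k) (h l)) (n : ℕ) :
    (n : ℂ) • a n = ∑ p ∈ Finset.HasAntidiagonal.antidiagonal n, (p.1 : ℂ) • (a p.2 * h p.1) := by
  rw [ha.step]
  refine Finset.sum_congr rfl fun p _ => ?_
  rw [(ha.commute (fun k _ => hc p.1 k) p.2).eq]

/-- If `[h_k, U_m] = s_k U_{m+k}` for all `k`, then `exp(h)` is moved to the right past `U` at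
the cost of the scalar series `exp(s)`. -/
theorem IsExp.mul_family {h a : ℕ → A} (ha : IsExp h a)
    {s κ : ℕ → ℂ} (hκ : IsExp s κ) {U : ℤ → A}
    (hU : ∀ k : ℕ, k ≠ 0 → ∀ m, h k * U m - U m * h k = s k • U (m + k)) (l : ℕ) (m : ℤ) :
    a l * U m = ∑ p ∈ Finset.HasAntidiagonal.antidiagonal l, κ p.1 • (U (m + p.1) * a p.2) := by
  induction l using Nat.strong_induction_on generalizing m with
  | _ l ih =>
  rcases Nat.eq_zero_or_pos l with rfl | hl
  · simp [ha.zero, hκ.zero]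
  have hl' : (l : ℂ) ≠ 0 := by exact_mod_cast hl.ne'
  refine smul_right_injective A hl' ?_
  change (l : ℂ) • (a l * U m) = (l : ℂ) • _
  -- Expand `a l` by its recursion, move the remaining factor past U by induction, then commute h
  -- with U. The terms in which h passes through resum to weight `p.2` (`e2`, recursion for a); the
  -- commutator terms resum to weight `p.1` (`e3`, recursion for κ). The weights add up to l.
  have e1 : (l : ℂ) • (a l * U m) = ∑ p ∈ Finset.HasAntidiagonal.antidiagonal l,
      ∑ r ∈ Finset.HasAntidiagonal.antidiagonal p.2, ((p.1 : ℂ) * κ r.1) • (U (m + r.1) * (h p.1 * a r.2)) +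
      ∑ p ∈ Finset.HasAntidiagonal.antidiagonal l, ∑ r ∈ Finset.HasAntidiagonal.antidiagonal p.2,
        ((p.1 : ℂ) * s p.1 * κ r.1) • (U (m + (p.1 + r.1 : ℕ)) * a r.2) := by
    rw [← smul_mul_assoc, ha.step, Finset.sum_mul, ← Finset.sum_add_distrib]
    refine Finset.sum_congr rfl fun p hp => ?_
    rw [Finset.HasAntidiagonal.mem_antidiagonal] at hp
    rcases Nat.eq_zero_or_pos p.1 with hp0 | hp0
    · simp [hp0]
    rw [smul_mul_assoc, mul_assoc, ih _ (by omega), Finset.mul_sum, Finset.smul_sum,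
      ← Finset.sum_add_distrib]
    refine Finset.sum_congr rfl fun r _ => ?_
    have h3 : h p.1 * U (m + r.1) = U (m + r.1) * h p.1 + s p.1 • U (m + (p.1 + r.1 : ℕ)) := by
      rw [← sub_eq_iff_eq_add', hU _ hp0.ne']
      push_cast
      rw [add_assoc, add_comm (r.1 : ℤ)]
    rw [mul_smul_comm, ← mul_assoc, h3, add_mul, smul_add, smul_add, smul_mul_assoc, smul_smul,
      smul_smul, smul_smul, mul_assoc (U _)]
    congr 2
    ring
  have e2 : ∑ p ∈ Finset.HasAntidiagonal.antidiagonal l, ∑ r ∈ Finset.HasAntidiagonal.antidiagonal p.2,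
        ((p.1 : ℂ) * κ r.1) • (U (m + r.1) * (h p.1 * a r.2))
      = ∑ p ∈ Finset.HasAntidiagonal.antidiagonal l, ((p.2 : ℂ) * κ p.1) • (U (m + p.1) * a p.2) := by
    have : ∀ p : ℕ × ℕ, ((p.2 : ℂ) * κ p.1) • (U (m + p.1) * a p.2)
        = ∑ r ∈ Finset.HasAntidiagonal.antidiagonal p.2,
          ((r.1 : ℂ) * κ p.1) • (U (m + p.1) * (h r.1 * a r.2)) := by
      intro p
      rw [mul_comm, mul_smul, ← mul_smul_comm, ha.step, Finset.mul_sum, Finset.smul_sum]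
      refine Finset.sum_congr rfl fun r _ => ?_
      rw [mul_smul_comm, smul_smul, mul_comm]
    simp only [this]
    rw [Finset.sum_sigma', Finset.sum_sigma']
    refine Finset.sum_nbij' (fun x => ⟨(x.2.1, x.1.1 + x.2.2), (x.1.1, x.2.2)⟩)
      (fun x => ⟨(x.2.1, x.1.1 + x.2.2), (x.1.1, x.2.2)⟩) ?_ ?_ ?_ ?_ ?_
    all_goals
      rintro ⟨⟨a1, a2⟩, ⟨b1, b2⟩⟩ hx
      simp only [Finset.mem_sigma, Finset.HasAntidiagonal.mem_antidiagonal] at hx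
      obtain ⟨hx1, rfl⟩ := hx
    · simp only [Finset.mem_sigma, Finset.HasAntidiagonal.mem_antidiagonal] at hx1 ⊢
      exact ⟨by omega, trivial⟩
    · simp only [Finset.mem_sigma, Finset.HasAntidiagonal.mem_antidiagonal] at hx1 ⊢
      exact ⟨by omega, trivial⟩
    · rfl
    · rfl
    · rfl
  have e3 : ∑ p ∈ Finset.HasAntidiagonal.antidiagonal l, ∑ r ∈ Finset.HasAntidiagonal.antidiagonal p.2,
        ((p.1 : ℂ) * s p.1 * κ r.1) • (U (m + (p.1 + r.1 : ℕ)) * a r.2)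
      = ∑ p ∈ Finset.HasAntidiagonal.antidiagonal l, ((p.1 : ℂ) * κ p.1) • (U (m + p.1) * a p.2) := by
    have : ∀ p : ℕ × ℕ, ((p.1 : ℂ) * κ p.1) • (U (m + p.1) * a p.2)
        = ∑ r ∈ Finset.HasAntidiagonal.antidiagonal p.1,
          ((r.1 : ℂ) * s r.1 * κ r.2) • (U (m + (r.1 + r.2 : ℕ)) * a p.2) := by
      intro p
      rw [← smul_eq_mul, hκ.step, Finset.sum_smul]
      refine Finset.sum_congr rfl fun r hr => ?_
      rw [Finset.HasAntidiagonal.mem_antidiagonal] at hr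
      rw [hr, smul_eq_mul, mul_assoc]
    simp only [this]
    rw [Finset.sum_sigma', Finset.sum_sigma']
    refine Finset.sum_nbij' (fun x => ⟨(x.1.1 + x.2.1, x.2.2), (x.1.1, x.2.1)⟩)
      (fun x => ⟨(x.2.1, x.2.2 + x.1.2), (x.2.2, x.1.2)⟩) ?_ ?_ ?_ ?_ ?_
    all_goals
      rintro ⟨⟨a1, a2⟩, ⟨b1, b2⟩⟩ hx
      simp only [Finset.mem_sigma, Finset.HasAntidiagonal.mem_antidiagonal] at hx
      obtain ⟨hx1, rfl⟩ := hx
    · simp only [Finset.mem_sigma, Finset.HasAntidiagonal.mem_antidiagonal] at hx1 ⊢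
      exact ⟨by omega, trivial⟩
    · simp only [Finset.mem_sigma, Finset.HasAntidiagonal.mem_antidiagonal] at hx1 ⊢
      exact ⟨by omega, trivial⟩
    · rfl
    · rfl
    · rfl
  rw [e1, e2, e3, ← Finset.sum_add_distrib, Finset.smul_sum]
  refine Finset.sum_congr rfl fun p hp => ?_
  rw [Finset.HasAntidiagonal.mem_antidiagonal] at hp
  rw [← add_smul, smul_smul, ← hp]
  push_cast
  congr 1
  ring

/-- The mirror image of `IsExp.mul_family`. -/
theorem IsExp.family_mul {h a : ℕ → A} (ha : IsExp h a) (hc : ∀ k l, Commute (h k) (h l))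
    {s κ : ℕ → ℂ} (hκ : IsExp s κ) {U : ℤ → A}
    (hU : ∀ k : ℕ, k ≠ 0 → ∀ m, U m * h k - h k * U m = s k • U (m - k)) (l : ℕ) (m : ℤ) :
    U m * a l = ∑ p ∈ Finset.HasAntidiagonal.antidiagonal l, κ p.1 • (a p.2 * U (m - p.1)) := by
  -- In the opposite algebra the claim is `IsExp.mul_family` for the family with negated index.
  have hop : IsExp (A := Aᵐᵒᵖ) (fun n => MulOpposite.op (h n)) fun n => MulOpposite.op (a n) :=
    { zero := by simp [ha.zero]
      step := fun n => by
        rw [← MulOpposite.op_smul, ha.step_right hc, Finset.op_sum]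
        simp only [MulOpposite.op_smul, MulOpposite.op_mul] }
  have key := hop.mul_family hκ (U := fun m => MulOpposite.op (U (-m))) (fun k hk m => by
    simp only [← MulOpposite.op_mul, ← MulOpposite.op_sub, hU k hk, ← MulOpposite.op_smul]
    congr 3
    ring) l (-m)
  apply MulOpposite.op_injective
  rw [MulOpposite.op_mul]
  simp only [neg_neg] at key
  rw [key, Finset.op_sum]
  refine Finset.sum_congr rfl fun p _ => ?_
  rw [MulOpposite.op_smul, MulOpposite.op_mul]
  congr 4
  ring

theorem IsExp.congr {h h' a : ℕ → A} (ha : IsExp h a) (hh : ∀ n, n ≠ 0 → h n = h' n) :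
    IsExp h' a where
  zero := ha.zero
  step n := by
    rw [ha.step]
    refine Finset.sum_congr rfl fun p _ => ?_
    rcases Nat.eq_zero_or_pos p.1 with hp0 | hp0
    · simp [hp0]
    · rw [hh _ hp0.ne']

/-- In degree n the equation reads n f_n = Σ t_k f_{n-k} with k > 0, so f_0 = 0 forces all
coefficients to vanish. -/
theorem eq_zero_of_euler_eq {f t : A⟦X⟧} (h0 : PowerSeries.coeff 0 f = 0)
    (ht : PowerSeries.coeff 0 t = 0) (h : euler f = t * f) : f = 0 := by
  ext n
  rw [map_zero]
  induction n using Nat.strong_induction_on with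
  | _ n ih =>
    rcases Nat.eq_zero_or_pos n with rfl | hn
    · exact h0
    · have h1 := congrArg (PowerSeries.coeff n) h
      have hn' : (n : ℂ) ≠ 0 := by exact_mod_cast hn.ne'
      rw [euler, PowerSeries.coeff_mk, PowerSeries.coeff_mul] at h1
      refine (smul_eq_zero_iff_right hn').1 (h1.trans (Finset.sum_eq_zero fun p hp => ?_))
      rw [Finset.HasAntidiagonal.mem_antidiagonal] at hp
      rcases Nat.eq_zero_or_pos p.1 with hp0 | hp0
      · rw [hp0, ht, zero_mul]
      · rw [ih _ (by omega), mul_zero]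

/-- The recursion is the differential equation x f' = (x h') f, read coefficientwise. -/
theorem isExp_iff_euler {h f : A⟦X⟧} :
    IsExp (fun n => PowerSeries.coeff n h) (fun n => PowerSeries.coeff n f) ↔
      PowerSeries.coeff 0 f = 1 ∧ euler f = euler h * f := by
  constructor
  · intro hf
    refine ⟨hf.zero, PowerSeries.ext fun n => ?_⟩
    rw [euler, PowerSeries.coeff_mk, hf.step, PowerSeries.coeff_mul]
    simp only [euler, PowerSeries.coeff_mk, smul_mul_assoc]
  · rintro ⟨h0, h1⟩
    refine ⟨h0, fun n => ?_⟩
    have h2 := congrArg (PowerSeries.coeff n) h1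
    rw [PowerSeries.coeff_mul] at h2
    simpa only [euler, PowerSeries.coeff_mk, smul_mul_assoc] using h2

/-- If `[b, h] = c x^K` with `c` scalar, then `[b, exp(h)] = c x^K exp(h)`. -/
theorem IsExp.lie {h a : ℕ → A} (ha : IsExp h a) {b : A} {c : ℂ} {K : ℕ} (hK : K ≠ 0)
    (hb : ∀ k, k ≠ 0 → b * h k - h k * b = (if k = K then c else 0) • (1 : A)) (n : ℕ) :
    b * a n - a n * b = if K ≤ n then c • a (n - K) else 0 := by
  set f : A⟦X⟧ := PowerSeries.mk a with hf
  -- The constant term of h does not enter the recursion and `hb` says nothing about it, so it is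
  -- set to 0.
  set H : A⟦X⟧ := PowerSeries.mk fun k => if k = 0 then 0 else h k with hH
  set t : A⟦X⟧ := c • PowerSeries.X ^ K with ht
  obtain ⟨hf0, hf1⟩ := (isExp_iff_euler (h := H) (f := f)).1 <| by
    simp only [hf, hH, PowerSeries.coeff_mk]
    exact ha.congr fun n hn => by rw [if_neg hn]
  have htc : ∀ y : A⟦X⟧, t * y = y * t := by
    intro y
    rw [ht, smul_mul_assoc, mul_smul_comm, (PowerSeries.commute_X_pow y K).eq]
  have hC : euler (PowerSeries.C b) = 0 := by
    ext n
    rw [euler, PowerSeries.coeff_mk, PowerSeries.coeff_C]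
    split_ifs with hn <;> simp [hn]
  have hsub : ∀ x y : A⟦X⟧, euler (x - y) = euler x - euler y := by
    intro x y
    ext n
    simp [euler, smul_sub]
  have hCH : PowerSeries.C b * H = H * PowerSeries.C b + t := by
    rw [← sub_eq_iff_eq_add']
    ext n
    rw [map_sub, PowerSeries.coeff_C_mul, PowerSeries.coeff_mul_C, ht, PowerSeries.coeff_smul,
      PowerSeries.coeff_X_pow, hH, PowerSeries.coeff_mk]
    rcases eq_or_ne n 0 with rfl | hn
    · simp [hK.symm]
    · rw [if_neg hn, hb n hn]
      split_ifs <;> simp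
  have hCH' : PowerSeries.C b * euler H = euler H * PowerSeries.C b + euler t := by
    have h1 := congrArg euler hCH
    have hadd : euler (H * PowerSeries.C b + t) = euler (H * PowerSeries.C b) + euler t := by
      ext n
      simp [euler, smul_add]
    rwa [hadd, euler_mul, euler_mul, hC, zero_mul, mul_zero, zero_add, add_zero] at h1
  -- The defect [b, f] - t f vanishes in degree 0 and solves the same first-order equation as f,
  -- because [b, x H'] = x t' and t is central.
  have key : PowerSeries.C b * f - f * PowerSeries.C b - t * f = 0 := by
    refine eq_zero_of_euler_eq (t := euler H) ?_ ?_ ?_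
    · have hf0' : PowerSeries.constantCoeff f = 1 := by simpa using hf0
      simp [hf0', ht, hK]
    · simp [euler]
    · rw [hsub, hsub, euler_mul, euler_mul, euler_mul, hC, zero_mul, mul_zero, zero_add, add_zero,
        hf1, ← mul_assoc, hCH', ← mul_assoc t, htc]
      noncomm_ring
  have h2 := congrArg (PowerSeries.coeff n) key
  rw [map_sub, map_sub, PowerSeries.coeff_C_mul, PowerSeries.coeff_mul_C, ht, smul_mul_assoc,
    PowerSeries.coeff_smul, PowerSeries.coeff_X_pow_mul', hf, map_zero, sub_eq_zero] at h2
  simp only [PowerSeries.coeff_mk] at h2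
  rw [h2]
  split_ifs <;> simp

end Exponential

/-! ## Scalar exponentials -/

theorem IsExp.mul_series {s s' : ℕ → ℂ} {f g : ℂ⟦X⟧} (hf : IsExp s fun n => PowerSeries.coeff n f)
    (hg : IsExp s' fun n => PowerSeries.coeff n g) :
    IsExp (fun n => s n + s' n) fun n => PowerSeries.coeff n (f * g) := by
  have e : ∀ s : ℕ → ℂ, s = fun n => PowerSeries.coeff n (PowerSeries.mk s) := fun s => by
    funext n
    rw [PowerSeries.coeff_mk]
  rw [e s] at hf
  rw [e s'] at hg
  rw [e fun n => s n + s' n]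
  obtain ⟨hf0, hf1⟩ := isExp_iff_euler.1 hf
  obtain ⟨hg0, hg1⟩ := isExp_iff_euler.1 hg
  refine isExp_iff_euler.2 ⟨by simp [PowerSeries.coeff_mul, hf0, hg0], ?_⟩
  have hadd : euler (PowerSeries.mk fun n => s n + s' n)
      = euler (PowerSeries.mk s) + euler (PowerSeries.mk s') := by
    ext n
    simp [euler, mul_add]
  rw [euler_mul, hf1, hg1, hadd]
  ring

/-- The geometric series `∑ a^n x^n`. -/
noncomputable def geom (a : ℂ) : ℂ⟦X⟧ := PowerSeries.mk fun n => a ^ n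

/-- The linear polynomial `1 - a x`. -/
noncomputable def oneSub (a : ℂ) : ℂ⟦X⟧ := 1 - PowerSeries.C a * PowerSeries.X

theorem oneSub_mul_geom (a : ℂ) : oneSub a * geom a = 1 := by
  have h := oneSub_mul_invOneSub (1 : ℂ) a
  simpa [oneSub, lin, invOneSub, geom] using h

/-- -log(1 - a x) = Σ a^n x^n / n. With `isExp_oneSub`, contractions can be read off from power sums
as products of factors (1 - a x)^{±1}. -/
theorem isExp_geom (a : ℂ) : IsExp (fun n => a ^ n / n) fun n => PowerSeries.coeff n (geom a) where
  zero := by simp [geom]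
  step n := by
    have : ∀ p ∈ Finset.HasAntidiagonal.antidiagonal n,
        (p.1 : ℂ) • (a ^ p.1 / p.1 * PowerSeries.coeff p.2 (geom a))
          = if p.1 = 0 then 0 else a ^ n := by
      intro p hp
      rw [Finset.HasAntidiagonal.mem_antidiagonal] at hp
      split_ifs with h
      · simp [h]
      · have h' : (p.1 : ℂ) ≠ 0 := by exact_mod_cast h
        rw [geom, PowerSeries.coeff_mk, ← hp, pow_add, smul_eq_mul]
        field_simp
    rw [Finset.sum_congr rfl this, Finset.Nat.sum_antidiagonal_eq_sum_range_succ_mk,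
      Finset.sum_range_succ']
    simp [geom]

theorem isExp_oneSub (a : ℂ) : IsExp (fun n => -(a ^ n / n))
    fun n => PowerSeries.coeff n (oneSub a) where
  zero := by simp [oneSub]
  step n := by
    unfold oneSub
    rcases n with _ | n
    · simp
    rw [Finset.Nat.sum_antidiagonal_eq_sum_range_succ_mk, Finset.sum_range_succ]
    rcases n with _ | n
    · simp [PowerSeries.coeff_X]
    rw [Finset.sum_range_succ]
    -- As 1 - a x lives in degrees 0 and 1, only the last two summands of the recursion survive.
    have h1 : ∀ k ∈ Finset.range (n + 1), (k : ℂ) • (-(a ^ k / k) *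
        PowerSeries.coeff (n + 1 + 1 - k) (1 - PowerSeries.C a * PowerSeries.X)) = 0 := by
      intro k hk
      rw [Finset.mem_range] at hk
      have : PowerSeries.coeff (n + 1 + 1 - k) (1 - PowerSeries.C a * PowerSeries.X) = 0 := by
        simp [PowerSeries.coeff_one, PowerSeries.coeff_X,
          show n + 1 + 1 - k ≠ 0 by omega, show n + 1 + 1 - k ≠ 1 by omega]
      rw [this, mul_zero, smul_zero]
    rw [Finset.sum_eq_zero h1]
    have e1 : n + 1 + 1 - (n + 1) = 1 := by omega
    have h2 : ((n : ℂ) + 1) ≠ 0 := by exact_mod_cast n.succ_ne_zero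
    have h3 : ((n : ℂ) + 1 + 1) ≠ 0 := by exact_mod_cast (n + 1).succ_ne_zero
    simp [e1, PowerSeries.coeff_one]
    field_simp
    ring

/-- The coefficients of a power series, extended by zero to negative degrees. -/
noncomputable def ext (f : ℂ⟦X⟧) (l : ℤ) : ℂ := if 0 ≤ l then PowerSeries.coeff l.toNat f else 0

theorem ext_natCast (f : ℂ⟦X⟧) (l : ℕ) : ext f l = PowerSeries.coeff l f := by
  simp [ext]

theorem ext_neg (f : ℂ⟦X⟧) {l : ℤ} (hl : l < 0) : ext f l = 0 := by
  simp [ext, hl]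

theorem ext_one (l : ℤ) : ext 1 l = if l = 0 then 1 else 0 := by
  rcases lt_or_ge l 0 with h | h
  · rw [ext_neg _ h, if_neg h.ne]
  · lift l to ℕ using h
    rw [ext_natCast, PowerSeries.coeff_one]
    simp

/-- Multiplication by `1 - a x`. -/
theorem ext_oneSub_mul (a : ℂ) (f : ℂ⟦X⟧) (l : ℤ) :
    ext (oneSub a * f) l = ext f l - a * ext f (l - 1) := by
  rcases lt_or_ge l 0 with h | h
  · rw [ext_neg _ h, ext_neg _ h, ext_neg _ (by omega), mul_zero, sub_zero]
  · lift l to ℕ using h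
    rw [ext_natCast, ext_natCast, oneSub, sub_mul, one_mul, map_sub, mul_assoc, PowerSeries.coeff_C_mul]
    rcases l with _ | l
    · simp [ext]
    · rw [PowerSeries.coeff_succ_X_mul, show ((l + 1 : ℕ) : ℤ) - 1 = (l : ℕ) by push_cast; ring,
        ext_natCast]

end QToroidal

namespace QToroidal

/-! ## Commutation relations on the Fock module -/

noncomputable section

/-- The scalar `[α_{i,k}, α_{j,-k}]` for `k ∈ ℤ`. -/
def alphaPair (q d : ℂ) (i j : Fin 2) (k : ℤ) : ℂ :=
  if i = j then (k : ℂ) * (1 + (q2 q) ^ (-|k|)) else -(k : ℂ) * ((q1 q d) ^ |k| + (q3 q d) ^ |k|)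

theorem alphaPair_symm (q d : ℂ) (i j : Fin 2) (k : ℤ) :
    alphaPair q d i j k = alphaPair q d j i k := by
  simp only [alphaPair, eq_comm]

theorem alphaPair_neg (q d : ℂ) (i j : Fin 2) (k : ℤ) :
    alphaPair q d i j (-k) = -alphaPair q d i j k := by
  simp only [alphaPair, abs_neg, Int.cast_neg]
  split_ifs <;> ring

theorem alpha_lie (q d : ℂ) (i j : Fin 2) (m n : ℤ) :
    alpha q d i m * alpha q d j n - alpha q d j n * alpha q d i m
      = (if m + n = 0 then alphaPair q d i j m else 0) • (1 : Module.End ℂ Fock) :=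
  alpha_commutator q d i j m n

theorem alpha_commute (q d : ℂ) (i j : Fin 2) {m n : ℤ} (h : m + n ≠ 0) :
    Commute (alpha q d i m) (alpha q d j n) := by
  have := alpha_lie q d i j m n
  rw [if_neg h, zero_smul, sub_eq_zero] at this
  exact this

/-- The coefficient of `z^{-m}` in `exp(∑_{n > 0} c_n α_{i,n} z^{-n})`. -/
def ann (q d : ℂ) (i : Fin 2) (c : ℤ → ℂ) (m : ℤ) : Module.End ℂ Fock :=
  if 0 ≤ m then PowerSeries.coeff m.toNat (expPos q d i c) else 0

/-- The coefficient of `z^m` in `exp(∑_{n > 0} c_{-n} α_{i,-n} z^n)`. -/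
def cre (q d : ℂ) (i : Fin 2) (c : ℤ → ℂ) (m : ℤ) : Module.End ℂ Fock :=
  if 0 ≤ m then PowerSeries.coeff m.toNat (expNeg q d i c) else 0

variable {q d : ℂ} {i : Fin 2} {c : ℤ → ℂ}

theorem ann_natCast (l : ℕ) : ann q d i c l = PowerSeries.coeff l (expPos q d i c) := by
  simp [ann]

theorem cre_natCast (l : ℕ) : cre q d i c l = PowerSeries.coeff l (expNeg q d i c) := by
  simp [cre]

theorem ann_neg {m : ℤ} (h : m < 0) : ann q d i c m = 0 := by simp [ann, h]

theorem cre_neg {m : ℤ} (h : m < 0) : cre q d i c m = 0 := by simp [cre, h]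

theorem commute_pos (c c' : ℤ → ℂ) (k l : ℕ) :
    Commute (c k • alpha q d i k) (c' l • alpha q d i l) := by
  rcases Nat.eq_zero_or_pos k with rfl | hk
  · rcases Nat.eq_zero_or_pos l with rfl | hl
    · exact ((Commute.refl _).smul_right _).smul_left _
    · exact ((alpha_commute q d i i (by push_cast; omega)).smul_right _).smul_left _
  · exact ((alpha_commute q d i i (by omega)).smul_right _).smul_left _

theorem commute_neg (c c' : ℤ → ℂ) (k l : ℕ) :
    Commute (c (-k) • alpha q d i (-k)) (c' (-l) • alpha q d i (-l)) := by
  rcases Nat.eq_zero_or_pos k with rfl | hk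
  · rcases Nat.eq_zero_or_pos l with rfl | hl
    · exact ((Commute.refl _).smul_right _).smul_left _
    · exact ((alpha_commute q d i i (by push_cast; omega)).smul_right _).smul_left _
  · exact ((alpha_commute q d i i (by omega)).smul_right _).smul_left _

theorem isExp_expPos : IsExp (fun n : ℕ => c n • alpha q d i n)
    fun n => PowerSeries.coeff n (expPos q d i c) := by
  refine (isExp_expSeries ?_ fun k l => ?_).congr fun n hn => ?_
  · simp
  · simp only [PowerSeries.coeff_mk]
    split_ifs
    · exact Commute.zero_left _
    · exact Commute.zero_left _
    · exact Commute.zero_right _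
    · exact commute_pos c c k l
  · simp [hn]

theorem isExp_expNeg : IsExp (fun n : ℕ => c (-n) • alpha q d i (-n))
    fun n => PowerSeries.coeff n (expNeg q d i c) := by
  refine (isExp_expSeries ?_ fun k l => ?_).congr fun n hn => ?_
  · simp
  · simp only [PowerSeries.coeff_mk]
    split_ifs
    · exact Commute.zero_left _
    · exact Commute.zero_left _
    · exact Commute.zero_right _
    · exact commute_neg c c k l
  · simp [hn]

theorem isExp_ann : IsExp (fun n : ℕ => c n • alpha q d i n) fun n : ℕ => ann q d i c n := by
  simpa only [ann_natCast] using isExp_expPos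

theorem isExp_cre : IsExp (fun n : ℕ => c (-n) • alpha q d i (-n))
    fun n : ℕ => cre q d i c n := by
  simpa only [cre_natCast] using isExp_expNeg

theorem ann_zero : ann q d i c 0 = 1 := isExp_ann.zero

theorem cre_zero : cre q d i c 0 = 1 := isExp_cre.zero

theorem commute_ann {b : Module.End ℂ Fock} (hb : ∀ k : ℤ, 0 < k → Commute b (alpha q d i k))
    (m : ℤ) : Commute b (ann q d i c m) := by
  rcases lt_or_ge m 0 with h | h
  · rw [ann_neg h]; exact Commute.zero_right _
  · lift m to ℕ using h
    exact isExp_ann.commute (fun k hk => (hb k (by omega)).smul_right _) m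

theorem commute_cre {b : Module.End ℂ Fock} (hb : ∀ k : ℤ, k < 0 → Commute b (alpha q d i k))
    (m : ℤ) : Commute b (cre q d i c m) := by
  rcases lt_or_ge m 0 with h | h
  · rw [cre_neg h]; exact Commute.zero_right _
  · lift m to ℕ using h
    exact isExp_cre.commute (fun k hk => (hb (-k) (by omega)).smul_right _) m

/-- The family `U` of coefficients of `U(z) = ∑ U_m z^{-m}` is primary with weights `s` if
`[α_{j,k}, U(z)] = s_{j,k} z^k U(z)` for all `k ≠ 0`. -/
def Primary (q d : ℂ) (s : Fin 2 → ℤ → ℂ) (U : ℤ → Module.End ℂ Fock) : Prop :=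
  ∀ j k, k ≠ 0 → ∀ m,
    alpha q d j k * U m - U m * alpha q d j k = s j k • U (m + k)

/-- Among the modes k ≠ 0, only creation operators can fail to commute with an exponential of
annihilation operators, and α_{j,-K} contracts with the single mode K of the exponent: the situation
of `IsExp.lie`. -/
theorem primary_ann : Primary q d
    (fun j k => if k < 0 then alphaPair q d j i k * c (-k) else 0) (ann q d i c) := by
  intro j k hk m
  rcases lt_or_gt_of_ne hk with h | h
  · obtain ⟨K, rfl⟩ : ∃ K : ℕ, k = -K := ⟨k.natAbs, by omega⟩
    dsimp only
    rw [if_pos h]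
    rcases lt_or_ge m 0 with hm | hm
    · rw [ann_neg hm, ann_neg (by omega)]; simp
    · lift m to ℕ using hm
      have key := isExp_ann (q := q) (d := d) (i := i) (c := c) |>.lie (b := alpha q d j (-K))
        (c := alphaPair q d j i (-K) * c K) (K := K) (by omega) (fun l hl => by
          rw [mul_smul_comm, smul_mul_assoc, ← smul_sub, alpha_lie, smul_smul]
          congr 1
          by_cases hlK : l = K
          · subst hlK
            rw [if_pos (by omega), if_pos rfl, mul_comm]
          · rw [if_neg (by omega), if_neg hlK, mul_zero]) m
      rw [key, neg_neg]
      split_ifs with hle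
      · congr 2
        omega
      · rw [ann_neg (by omega), smul_zero]
  · dsimp only
    rw [if_neg (by omega), zero_smul, sub_eq_zero]
    exact commute_ann (fun l hl => alpha_commute _ _ _ _ (by omega)) m

/-- The index is negated because `cre` is indexed by powers of z, while `Primary` reads coefficients
of z^{-m}. -/
theorem primary_cre : Primary q d
    (fun j k => if 0 < k then alphaPair q d j i k * c (-k) else 0)
    (fun m => cre q d i c (-m)) := by
  intro j k hk m
  rcases lt_or_gt_of_ne hk with h | h
  · dsimp only
    rw [if_neg (by omega), zero_smul, sub_eq_zero]
    exact commute_cre (fun l hl => alpha_commute _ _ _ _ (by omega)) _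
  · obtain ⟨K, rfl⟩ : ∃ K : ℕ, k = K := ⟨k.natAbs, by omega⟩
    dsimp only
    rw [if_pos h]
    obtain ⟨m, rfl⟩ : ∃ m', m = -m' := ⟨-m, by simp⟩
    rw [neg_neg]
    rcases lt_or_ge m 0 with hm | hm
    · rw [cre_neg hm, cre_neg (by omega)]; simp
    · lift m to ℕ using hm
      have key := isExp_cre (q := q) (d := d) (i := i) (c := c) |>.lie (b := alpha q d j K)
        (c := alphaPair q d j i K * c (-K)) (K := K) (by omega) (fun l hl => by
          rw [mul_smul_comm, smul_mul_assoc, ← smul_sub, alpha_lie, smul_smul]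
          congr 1
          by_cases hlK : l = K
          · subst hlK
            rw [if_pos (by omega), if_pos rfl, mul_comm]
          · rw [if_neg (by omega), if_neg hlK, mul_zero]) m
      rw [key]
      split_ifs with hle
      · congr 2
        omega
      · rw [cre_neg (by omega), smul_zero]

theorem finite_support_ann (v : Fock) :
    (Function.support fun l : ℤ => ann q d i c l v).Finite := by
  refine ((finite_support_expPos q d i c v).image (Nat.cast : ℕ → ℤ)).subset fun l hl => ?_
  rcases lt_or_ge l 0 with h | h
  · exact (hl (by simp [ann_neg h])).elim
  · lift l to ℕ using h
    exact ⟨l, by simpa [ann_natCast] using hl, rfl⟩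

theorem finite_support_cre_ann (m : ℤ) (v : Fock) :
    (Function.support fun l : ℤ => cre q d i c (l - m) (ann q d i c l v)).Finite :=
  (finite_support_ann (q := q) (d := d) (i := i) (c := c) v).subset fun l hl h => hl (by
    dsimp only at h ⊢
    rw [h, map_zero])

/-- Both factors vanish at negative indices, so the sum may run over all of ℤ, where its index can
be translated freely. -/
theorem normalExp_apply (m : ℤ) (v : Fock) :
    normalExp q d i c m v = ∑ᶠ l : ℤ, cre q d i c (l - m) (ann q d i c l v) := by
  have h1 : normalExp q d i c m v
      = ∑ᶠ l : ℕ, cre q d i c ((l : ℤ) - m) (ann q d i c (l : ℤ) v) := by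
    change ∑ᶠ l : ℕ, _ = _
    refine finsum_congr fun l => ?_
    dsimp only
    by_cases h : m ≤ l
    · rw [if_pos h, cre, if_pos (by omega), ann_natCast, Module.End.mul_apply]
    · rw [if_neg h, cre_neg (by omega)]
      rfl
  rw [h1, ← finsum_mem_range (g := (Nat.cast : ℕ → ℤ))
    (f := fun l : ℤ => cre q d i c (l - m) (ann q d i c l v)) Nat.cast_injective]
  refine finsum_congr fun l => ?_
  rcases lt_or_ge l 0 with h | h
  · rw [ann_neg h]; simp
  · lift l to ℕ using h
    simp

/-- α_{j,k} interacts with the creation half for k > 0 and with the annihilation half for k < 0, so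
the two one-sided weights merge into one formula. The sums are finite on each vector, which allows
working termwise. -/
theorem primary_normalExp : Primary q d
    (fun j k => alphaPair q d j i k * c (-k)) (normalExp q d i c) := by
  intro j k hk m
  refine LinearMap.ext fun v => ?_
  rw [LinearMap.sub_apply, Module.End.mul_apply, Module.End.mul_apply, normalExp_apply,
    normalExp_apply, LinearMap.smul_apply, normalExp_apply, sub_eq_iff_eq_add']
  have hfin := finite_support_cre_ann (q := q) (d := d) (i := i) (c := c)
  have hp := fun m v => LinearMap.congr_fun (primary_ann (q := q) (d := d) (i := i) (c := c) j k hk m) v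
  have hn := fun m v => LinearMap.congr_fun (primary_cre (q := q) (d := d) (i := i) (c := c) j k hk m) v
  simp only [LinearMap.sub_apply, Module.End.mul_apply, LinearMap.smul_apply,
    sub_eq_iff_eq_add'] at hp hn
  rw [map_finsum _ (hfin m v), smul_finsum]
  rcases lt_or_gt_of_ne hk with h | h
  · simp only [if_pos h, if_neg (show ¬ 0 < k by omega), zero_smul, add_zero] at hp hn
    -- For k < 0 the commutator moves the index of `ann` from l to l + k, so the summation index is
    -- translated; for k > 0 only the index of `cre` moves.
    rw [← finsum_comp_equiv (Equiv.addRight k) (f := fun l => (alphaPair q d j i k * c (-k)) •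
      cre q d i c (l - (m + k)) (ann q d i c l v)), ← finsum_add_distrib (hfin m _)]
    · refine finsum_congr fun l => ?_
      have := hn (m - l) (ann q d i c l v)
      rw [neg_sub] at this
      rw [this, hp, map_add, map_smul, Equiv.coe_addRight]
      dsimp only
      congr 4
      omega
    · refine (((finite_support_ann (q := q) (d := d) (i := i) (c := c) v)).preimage
        (Equiv.addRight k).injective.injOn).subset fun l hl h => hl ?_
      dsimp only at h ⊢
      rw [h, map_zero, smul_zero]
  · simp only [if_pos h, if_neg (show ¬ k < 0 by omega), zero_smul, add_zero] at hp hn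
    rw [← finsum_add_distrib (hfin m _)]
    · refine finsum_congr fun l => ?_
      have := hn (m - l) (ann q d i c l v)
      rw [neg_sub] at this
      rw [this, hp]
      congr 4
      omega
    · refine (finite_support_ann (q := q) (d := d) (i := i) (c := c) v).subset fun l hl h => hl ?_
      dsimp only at h ⊢
      rw [h, map_zero, smul_zero]

/-! ## Sectors, vacuum expectations -/

/-- The operator `p |n,u⟩ ↦ p |n+k,u⟩`. -/
def shift (k : ℤ) : Module.End ℂ Fock := ofSectors fun n => inj (n + k)

theorem shift_inj (k n : ℤ) (p : Poly) : shift k (inj n p) = inj (n + k) p := by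
  simp [shift, ofSectors_inj]

theorem alpha_commute_diag (q d : ℂ) (i : Fin 2) (k : ℤ) (f : ℤ → ℂ) :
    Commute (diag f) (alpha q d i k) := by
  rcases k with (_ | k) | k
  · exact diag_comm _ _
  · exact diag_annihilation _ _ _ _ _
  · exact diag_creation _ _ _

theorem alpha_commute_shift (q d : ℂ) (i : Fin 2) {k : ℤ} (hk : k ≠ 0) (t : ℤ) :
    Commute (shift t) (alpha q d i k) := by
  rcases k with (_ | k) | k
  · simp at hk
  · refine end_ext fun n p => ?_
    simp only [Module.End.mul_apply, alpha, annihilation_inj, shift_inj]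
  · refine end_ext fun n p => ?_
    simp only [Module.End.mul_apply, alpha, creation_inj, shift_inj]

/-- The coefficient of `|n,u⟩`. -/
def vac (n : ℤ) : Fock →ₗ[ℂ] ℂ :=
  (MvPolynomial.lcoeff ℂ 0 ∘ₗ Finsupp.lapply n) ∘ₗ Fock.of.symm.toLinearMap

theorem vac_inj (n m : ℤ) (p : Poly) :
    vac n (inj m p) = if m = n then MvPolynomial.coeff 0 p else 0 := by
  simp only [vac, inj, LinearMap.comp_apply, LinearEquiv.coe_coe, LinearEquiv.symm_apply_apply,
    Finsupp.lsingle_apply, Finsupp.lapply_apply, Finsupp.single_apply]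
  split_ifs <;> simp

theorem vac_ket (n m : ℤ) : vac n (ket m) = if m = n then 1 else 0 := by
  rw [ket, vac_inj]
  simp

theorem diag_ket (f : ℤ → ℂ) (n : ℤ) : diag f (ket n) = f n • ket n := by
  rw [ket, diag_inj, map_smul]

theorem vac_diag (f : ℤ → ℂ) (n : ℤ) (v : Fock) : vac n (diag f v) = f n * vac n v := by
  induction v using fock_induction with
  | h0 => simp
  | hadd v w hv hw => simp only [map_add, hv, hw, mul_add]
  | hinj m p =>
    rw [diag_inj, vac_inj, vac_inj]
    split_ifs with h
    · subst h; simp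
    · simp

theorem vac_shift (k n : ℤ) (v : Fock) : vac n (shift k v) = vac (n - k) v := by
  induction v using fock_induction with
  | h0 => simp
  | hadd v w hv hw => simp only [map_add, hv, hw]
  | hinj m p =>
    rw [shift_inj, vac_inj, vac_inj]
    congr 1
    rw [eq_sub_iff_add_eq]

theorem vac_alpha_neg (q d : ℂ) (i : Fin 2) (n : ℤ) {k : ℤ} (hk : k < 0) (v : Fock) :
    vac n (alpha q d i k v) = 0 := by
  obtain ⟨k, rfl⟩ := Int.eq_negSucc_of_lt_zero hk
  induction v using fock_induction with
  | h0 => simp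
  | hadd v w hv hw => rw [map_add, map_add, hv, hw, add_zero]
  | hinj m p =>
    rw [alpha, creation_inj, vac_inj]
    simp [MvPolynomial.coeff_X_mul']

theorem alpha_ket (q d : ℂ) (i : Fin 2) (n : ℤ) {k : ℤ} (hk : 0 < k) :
    alpha q d i k (ket n) = 0 := by
  obtain ⟨k, rfl⟩ := Int.eq_succ_of_zero_lt hk
  change annihilation q d i k (ket n) = 0
  rw [ket, annihilation_inj]
  simp

/-- Each term of nonzero weight in the recursion has a creation operator leftmost, and the vacuum
covector kills it. -/
theorem vac_cre (n r : ℤ) (v : Fock) :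
    vac n (cre q d i c r v) = if r = 0 then vac n v else 0 := by
  rcases lt_trichotomy r 0 with h | rfl | h
  · rw [cre_neg h, if_neg h.ne]; simp
  · simp [cre_zero]
  · rw [if_neg h.ne']
    lift r to ℕ using h.le
    have hr : (r : ℂ) ≠ 0 := by
      have : r ≠ 0 := by omega
      exact_mod_cast this
    have h1 := congrArg (fun T => vac n (T v)) (isExp_cre (q := q) (d := d) (i := i) (c := c).step r)
    simp only [LinearMap.smul_apply, map_smul, LinearMap.sum_apply, map_sum,
      Module.End.mul_apply] at h1
    refine (smul_eq_zero_iff_right hr).1 (h1.trans (Finset.sum_eq_zero fun p _ => ?_))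
    rcases Nat.eq_zero_or_pos p.1 with hp0 | hp0
    · simp [hp0]
    · rw [vac_alpha_neg _ _ _ _ (by omega), smul_zero, smul_zero]

theorem ann_ket (n l : ℤ) : ann q d i c l (ket n) = if l = 0 then ket n else 0 := by
  rcases lt_trichotomy l 0 with h | rfl | h
  · rw [ann_neg h, if_neg h.ne]; simp
  · simp [ann_zero]
  · rw [if_neg h.ne']
    lift l to ℕ using h.le
    have hl : (l : ℂ) ≠ 0 := by
      have : l ≠ 0 := by omega
      exact_mod_cast this
    -- The right-handed recursion lets an annihilation operator hit the vector first.
    have h1 := congrArg (fun T => T (ket n)) (isExp_ann (q := q) (d := d) (i := i)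
      (c := c) |>.step_right (commute_pos c c) l)
    simp only [LinearMap.smul_apply, LinearMap.sum_apply, Module.End.mul_apply] at h1
    refine (smul_eq_zero_iff_right hl).1 (h1.trans (Finset.sum_eq_zero fun p _ => ?_))
    rcases Nat.eq_zero_or_pos p.1 with hp0 | hp0
    · simp [hp0]
    · rw [alpha_ket _ _ _ _ (by omega)]; simp

/-- Normal ordering makes one half trivial: the annihilation half on |n,u⟩ here, the creation half
under the vacuum covector in `vac_normalExp`. -/
theorem normalExp_ket (m n : ℤ) : normalExp q d i c m (ket n) = cre q d i c (-m) (ket n) := by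
  rw [normalExp_apply, finsum_eq_single _ 0]
  · simp [ann_ket]
  · intro l hl
    rw [ann_ket, if_neg hl, map_zero]

theorem vac_normalExp (n m : ℤ) (v : Fock) :
    vac n (normalExp q d i c m v) = vac n (ann q d i c m v) := by
  rw [normalExp_apply, map_finsum _ (finite_support_cre_ann m v), finsum_eq_single _ m]
  · simp [cre_zero]
  · intro l hl
    rw [vac_cre, if_neg (by omega)]

end

end QToroidal

namespace QToroidal

noncomputable section

variable {q d : ℂ} {i : Fin 2} {c : ℤ → ℂ}

theorem eps_mul_self (i : Fin 2) : eps i * eps i = 1 := by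
  fin_cases i <;> simp [eps]

/-! ## Vanishing criterion -/

theorem annihilation_component (i : Fin 2) (k : ℕ) (v : Fock) (m : ℤ) :
    Fock.of.symm (annihilation q d i k v) m = ∑ j : Fin 2,
      pairing q d i j (k + 1) • MvPolynomial.pderiv (j, k) (Fock.of.symm v m) := by
  induction v using fock_induction with
  | h0 => simp
  | hadd v w hv hw => simp only [map_add, Finsupp.add_apply, hv, hw, smul_add,
      Finset.sum_add_distrib]
  | hinj n p =>
    rw [annihilation_inj]
    by_cases hnm : n = m
    · subst hnm
      simp [inj]
    · simp [inj, hnm]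

/-- In degree N the pairing matrix has equal diagonal entries and equal off-diagonal entries. Up to
a nonzero square its determinant is (q^{2N} - d^{2N})(q^{2N} d^{2N} - 1), and genericity excludes
both zeros. -/
theorem pairing_nondegenerate (hq : q ≠ 0) (hd : d ≠ 0)
    (hqd : ∀ n m : ℤ, n ≠ 0 ∨ m ≠ 0 → q ^ n * d ^ m ≠ 1) (k : ℕ) :
    pairing q d 0 0 (k + 1) ^ 2 - pairing q d 0 1 (k + 1) ^ 2 ≠ 0 := by
  have hn : ((k + 1 : ℕ) : ℂ) ≠ 0 := by exact_mod_cast k.succ_ne_zero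
  generalize hN : k + 1 = N at *
  have hqN : q ^ N ≠ 0 := pow_ne_zero _ hq
  have hdN : d ^ N ≠ 0 := pow_ne_zero _ hd
  have hN0 : (N : ℤ) ≠ 0 := by omega
  have h1 : q ^ N * d ^ N ≠ 1 := by
    have := hqd N N (Or.inl hN0)
    simpa only [zpow_natCast] using this
  have h2 : q ^ N * q ^ N * (d ^ N * d ^ N) ≠ 1 := by
    have := hqd (N + N) (N + N) (Or.inl (by omega))
    rwa [zpow_add₀ hq, zpow_add₀ hd, zpow_natCast, zpow_natCast] at this
  have h3 : q ^ N ≠ d ^ N := by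
    intro h
    have := hqd N (-N) (Or.inl hN0)
    rw [zpow_neg, zpow_natCast, zpow_natCast, h, mul_inv_cancel₀ hdN] at this
    exact this rfl
  have h4 : q ^ N * q ^ N ≠ d ^ N * d ^ N := by
    intro h
    have := hqd (N + N) (-(N + N)) (Or.inl (by omega))
    rw [zpow_neg, zpow_add₀ hq, zpow_add₀ hd, zpow_natCast, zpow_natCast, h,
      mul_inv_cancel₀ (mul_ne_zero hdN hdN)] at this
    exact this rfl
  have e : pairing q d 0 0 N ^ 2 - pairing q d 0 1 N ^ 2
      = ((N : ℂ) / (q ^ N * (q ^ N * d ^ N))) ^ 2 * ((q ^ N * q ^ N - d ^ N * d ^ N)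
        * (q ^ N * q ^ N * (d ^ N * d ^ N) - 1)) := by
    simp only [pairing, if_true, q1, q2, q3, mul_pow, inv_pow]
    rw [if_neg (by decide), ← pow_mul, mul_comm 2 N, pow_mul]
    field_simp
    ring
  rw [e]
  exact mul_ne_zero (pow_ne_zero _ (div_ne_zero hn (mul_ne_zero hqN (mul_ne_zero hqN hdN))))
    (mul_ne_zero (sub_ne_zero.2 h4) (sub_ne_zero.2 h2))

/-- A space of operators that is stable under commutators with the Heisenberg generators vanishes
as soon as all its vacuum expectations do. -/
theorem eq_zero_of_vac (hq : q ≠ 0) (hd : d ≠ 0)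
    (hqd : ∀ n m : ℤ, n ≠ 0 ∨ m ≠ 0 → q ^ n * d ^ m ≠ 1)
    (W : Submodule ℂ (Module.End ℂ Fock))
    (hW : ∀ T ∈ W, ∀ j k, k ≠ 0 → alpha q d j k * T - T * alpha q d j k ∈ W)
    (hv : ∀ T ∈ W, ∀ n n', vac n' (T (ket n)) = 0) : ∀ T ∈ W, T = 0 := by
  have step : ∀ T ∈ W, ∀ j k, k ≠ 0 → ∃ T' ∈ W, ∀ y,
      alpha q d j k (T y) = T (alpha q d j k y) + T' y := by
    intro T hT j k hk
    refine ⟨_, hW T hT j k hk, fun y => ?_⟩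
    simp
  -- Basis vectors are built by creation operators α, and T α = α T - [α, T]: the vacuum covector
  -- kills α T, and [α, T] lies in W again.
  have h1 : ∀ p : Poly, ∀ T ∈ W, ∀ n n', vac n' (T (inj n p)) = 0 := by
    intro p
    induction p using MvPolynomial.induction_on with
    | C a =>
      intro T hT n n'
      have : inj n (MvPolynomial.C a) = a • ket n := by
        rw [ket, ← map_smul, MvPolynomial.smul_eq_C_mul, mul_one]
      rw [this, map_smul, map_smul, hv T hT, smul_zero]
    | add p p' hp hp' =>
      intro T hT n n'
      rw [map_add, map_add, map_add, hp T hT, hp' T hT, add_zero]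
    | mul_X p a hp =>
      intro T hT n n'
      obtain ⟨j, k⟩ := a
      have e : inj n (p * MvPolynomial.X (j, k)) = alpha q d j (Int.negSucc k) (inj n p) := by
        rw [alpha, creation_inj, mul_comm]
      obtain ⟨T', hT', h⟩ := step T hT j (Int.negSucc k) (by simp)
      rw [e, eq_sub_of_add_eq (h _).symm, map_sub, vac_alpha_neg _ _ _ _ (Int.negSucc_lt_zero k),
        hp T' hT', sub_zero]
  have h2 : ∀ T ∈ W, ∀ y n', vac n' (T y) = 0 := by
    intro T hT y n'
    induction y using fock_induction with
    | h0 => simp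
    | hadd v w hv hw => rw [map_add, map_add, hv, hw, add_zero]
    | hinj n p => exact h1 p T hT n n'
  -- Dually, the higher coefficients of T y are reached by annihilation operators α: in α T y = T α
  -- y + T' y both terms on the right come from W, so by induction on the degree the coefficients of
  -- the corresponding combination of partial derivatives vanish.
  have h3 : ∀ (N : ℕ) (e : Fin 2 × ℕ →₀ ℕ), e.degree = N → ∀ T ∈ W, ∀ y n',
      MvPolynomial.coeff e (Fock.of.symm (T y) n') = 0 := by
    intro N
    induction N with
    | zero =>
      intro e he T hT y n'
      rw [Finsupp.degree_eq_zero_iff] at he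
      subst he
      exact h2 T hT y n'
    | succ N ih =>
      intro e he T hT y n'
      obtain ⟨a, ha⟩ : ∃ a, e a ≠ 0 := by
        by_contra! h0
        have : e = 0 := Finsupp.ext h0
        simp [this] at he
      obtain ⟨e', rfl⟩ : ∃ e', e = e' + Finsupp.single a 1 := by
        refine ⟨e - Finsupp.single a 1, (tsub_add_cancel_of_le ?_).symm⟩
        exact Finsupp.single_le_iff.2 (Nat.one_le_iff_ne_zero.2 ha)
      have he' : e'.degree = N := by
        rw [map_add, Finsupp.degree_single] at he
        omega
      obtain ⟨b, k⟩ := a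
      have h4 : ∀ j, ∑ l : Fin 2, pairing q d j l (k + 1) *
          MvPolynomial.coeff e' (MvPolynomial.pderiv (l, k) (Fock.of.symm (T y) n')) = 0 := by
        intro j
        obtain ⟨T', hT', h⟩ := step T hT j (Int.ofNat (k + 1)) (by simp; omega)
        have h5 := congrArg (fun v => MvPolynomial.coeff e' (Fock.of.symm v n')) (h y)
        simp only [map_add, Finsupp.add_apply, MvPolynomial.coeff_add] at h5
        rw [ih e' he' T hT, ih e' he' T' hT', add_zero, alpha, annihilation_component] at h5
        simpa [MvPolynomial.coeff_sum] using h5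
      have h50 := h4 0
      have h51 := h4 1
      rw [Fin.sum_univ_two] at h50 h51
      have hp11 : pairing q d 1 1 (k + 1) = pairing q d 0 0 (k + 1) := by simp [pairing]
      have hp10 : pairing q d 1 0 (k + 1) = pairing q d 0 1 (k + 1) := by simp [pairing]
      rw [hp11, hp10] at h51
      -- The two annihilation operators of mode k + 1 give two equations for the two partial
      -- derivatives; Cramer's rule separates them.
      have hdet := pairing_nondegenerate hq hd hqd k
      have h6 : ∀ l, MvPolynomial.coeff e' (MvPolynomial.pderiv (l, k)
          (Fock.of.symm (T y) n')) = 0 := by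
        refine Fin.forall_fin_two.2 ⟨(mul_eq_zero.1 ?_).resolve_left hdet,
          (mul_eq_zero.1 ?_).resolve_left hdet⟩
        · linear_combination (pairing q d 0 0 (k + 1)) * h50 - (pairing q d 0 1 (k + 1)) * h51
        · linear_combination (pairing q d 0 0 (k + 1)) * h51 - (pairing q d 0 1 (k + 1)) * h50
      -- Differentiation multiplies the sought coefficient by an exponent plus one, which is nonzero
      -- in ℂ.
      have h7 := h6 b
      rw [MvPolynomial.coeff_pderiv] at h7
      refine (mul_eq_zero.1 h7).resolve_right ?_
      exact_mod_cast (e' (b, k)).succ_ne_zero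
  intro T hT
  refine LinearMap.ext fun y => ?_
  refine Finsupp.ext fun n' => MvPolynomial.ext _ _ fun e => ?_
  exact h3 _ e rfl T hT y n'

/-- Double families `Φ(z,w)` with `[α_{j,k}, Φ(z,w)] = (s_{j,k} z^k + s'_{j,k} w^k) Φ(z,w)`. -/
def primaryPairs (q d : ℂ) (s s' : Fin 2 → ℤ → ℂ) :
    Submodule ℂ (ℤ → ℤ → Module.End ℂ Fock) where
  carrier := {Φ | ∀ j k, k ≠ 0 → ∀ m n, alpha q d j k * Φ m n - Φ m n * alpha q d j k
    = s j k • Φ (m + k) n + s' j k • Φ m (n + k)}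
  zero_mem' := by intro j k _ m n; simp
  add_mem' := by
    intro a b ha hb j k hk m n
    have h1 := ha j k hk m n
    have h2 := hb j k hk m n
    simp only [Pi.add_apply, smul_add, mul_add, add_mul]
    rw [add_sub_add_comm, h1, h2]
    abel
  smul_mem' := by
    intro r a ha j k hk m n
    have h1 := ha j k hk m n
    simp only [Pi.smul_apply, mul_smul_comm, smul_mul_assoc]
    rw [← smul_sub, h1, smul_add, smul_comm r, smul_comm r]

/-- The weights act by multiplication with powers of z and w, which commutes with multiplication by
z. Hence relations may be multiplied by structure functions without leaving the space. -/
theorem primaryPairs_mulZ {s s' : Fin 2 → ℤ → ℂ} {Φ : ℤ → ℤ → Module.End ℂ Fock}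
    (h : Φ ∈ primaryPairs q d s s') : mulZ _ Φ ∈ primaryPairs q d s s' := by
  intro j k hk m n
  refine (h j k hk (m + 1) n).trans ?_
  rw [add_right_comm]
  rfl

theorem primaryPairs_mulW {s s' : Fin 2 → ℤ → ℂ} {Φ : ℤ → ℤ → Module.End ℂ Fock}
    (h : Φ ∈ primaryPairs q d s s') : mulW _ Φ ∈ primaryPairs q d s s' := by
  intro j k hk m n
  refine (h j k hk m (n + 1)).trans ?_
  rw [add_right_comm n]
  rfl

theorem primaryPairs_g {s s' : Fin 2 → ℤ → ℂ} (i j : Fin 2)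
    {X Y : Module.End ℂ (ℤ → ℤ → Module.End ℂ Fock)}
    (hX : ∀ Φ ∈ primaryPairs q d s s', X Φ ∈ primaryPairs q d s s')
    (hY : ∀ Φ ∈ primaryPairs q d s s', Y Φ ∈ primaryPairs q d s s')
    {Φ : ℤ → ℤ → Module.End ℂ Fock} (h : Φ ∈ primaryPairs q d s s') :
    g q d i j X Y Φ ∈ primaryPairs q d s s' := by
  have aux : ∀ (a : ℂ) (Φ), Φ ∈ primaryPairs q d s s' →
      (X - a • Y) Φ ∈ primaryPairs q d s s' := fun a Φ h =>
    Submodule.sub_mem _ (hX _ h) (Submodule.smul_mem _ _ (hY _ h))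
  unfold g
  split_ifs
  · exact aux _ _ h
  · rw [Module.End.mul_apply]
    exact aux _ _ (aux _ _ h)

theorem lie_mul (a b c : Module.End ℂ Fock) :
    a * (b * c) - b * c * a = (a * b - b * a) * c + b * (a * c - c * a) := by noncomm_ring

theorem Primary.prodZW {s s' : Fin 2 → ℤ → ℂ} {U V : ℤ → Module.End ℂ Fock}
    (hU : Primary q d s U) (hV : Primary q d s' V) :
    prodZW U V ∈ primaryPairs q d s s' := by
  intro j k hk m n
  simp only [QToroidal.prodZW]
  rw [lie_mul, hU j k hk, hV j k hk, smul_mul_assoc, mul_smul_comm]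

theorem Primary.prodWZ {s s' : Fin 2 → ℤ → ℂ} {U V : ℤ → Module.End ℂ Fock}
    (hU : Primary q d s U) (hV : Primary q d s' V) :
    prodWZ U V ∈ primaryPairs q d s s' := by
  intro j k hk m n
  simp only [QToroidal.prodWZ]
  rw [lie_mul, hU j k hk, hV j k hk, smul_mul_assoc, mul_smul_comm, add_comm]

/-- Commutators of α_{j,k} with coefficients of Φ are again combinations of coefficients of Φ, so
their span is a space to which `eq_zero_of_vac` applies. -/
theorem primaryPairs_eq_zero (hq : q ≠ 0) (hd : d ≠ 0)
    (hqd : ∀ n m : ℤ, n ≠ 0 ∨ m ≠ 0 → q ^ n * d ^ m ≠ 1)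
    {s s' : Fin 2 → ℤ → ℂ} {Φ : ℤ → ℤ → Module.End ℂ Fock} (h : Φ ∈ primaryPairs q d s s')
    (hv : ∀ m n k k', vac k' (Φ m n (ket k)) = 0) (m n : ℤ) : Φ m n = 0 := by
  refine eq_zero_of_vac hq hd hqd (Submodule.span ℂ (Set.range fun x : ℤ × ℤ => Φ x.1 x.2))
    ?_ ?_ _ (Submodule.subset_span ⟨(m, n), rfl⟩)
  · intro T hT j k hk
    induction hT using Submodule.span_induction with
    | mem x hx =>
      obtain ⟨⟨m, n⟩, rfl⟩ := hx
      dsimp only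
      rw [h j k hk]
      exact Submodule.add_mem _ (Submodule.smul_mem _ _ (Submodule.subset_span ⟨(m + k, n), rfl⟩))
        (Submodule.smul_mem _ _ (Submodule.subset_span ⟨(m, n + k), rfl⟩))
    | zero => simp
    | add x y _ _ hx hy =>
      rw [mul_add, add_mul, add_sub_add_comm]
      exact Submodule.add_mem _ hx hy
    | smul a x _ hx =>
      rw [mul_smul_comm, smul_mul_assoc, ← smul_sub]
      exact Submodule.smul_mem _ _ hx
  · intro T hT k k'
    induction hT using Submodule.span_induction with
    | mem x hx =>
      obtain ⟨⟨m, n⟩, rfl⟩ := hx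
      exact hv m n k k'
    | zero => simp
    | add x y _ _ hx hy => rw [LinearMap.add_apply, map_add, hx, hy, add_zero]
    | smul a x _ hx => rw [LinearMap.smul_apply, map_smul, hx, smul_zero]

end

end QToroidal

namespace QToroidal

noncomputable section

variable {q d : ℂ} {i : Fin 2} {c : ℤ → ℂ}

/-! ## Dressed vertex operators -/

/-- The coefficients of `:exp(∑ c_n α_{i,n} z^{-n}): e^{t χ_i} z^{t α_{i,0} + 1} q₁^{t 𝖺₀}`. -/
def vertex (q d u L : ℂ) (i : Fin 2) (t : ℤ) (c : ℤ → ℂ) : ℤ → Module.End ℂ Fock :=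
  dressed u L i t (normalExp q d i c)

/-- The commutation weights of a vertex operator with the Heisenberg generators. -/
def weight (q d : ℂ) (i : Fin 2) (c : ℤ → ℂ) (j : Fin 2) (k : ℤ) : ℂ :=
  alphaPair q d j i k * c (-k)

variable {u L : ℂ} {t : ℤ}

theorem vertex_inj (m n : ℤ) (p : Poly) : vertex q d u L i t c m (inj n p)
    = Complex.exp (t * u * L) • normalExp q d i c (m + (t * (eps i * n) + 1))
        (inj (n + 2 * t * eps i) p) := by
  rw [vertex, dressed, ofSectors_inj, LinearMap.comp_apply, Module.End.mul_apply,
    Module.End.mul_apply, q1PowA0, Module.algebraMap_end_apply, map_smul, map_smul, expChi_inj]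

/-- The projection to the summand `𝓕(n,u)`. -/
def proj (n : ℤ) : Module.End ℂ Fock := diag (Pi.single n 1)

theorem proj_inj (n m : ℤ) (p : Poly) : proj n (inj m p) = if m = n then inj m p else 0 := by
  rw [proj, diag_inj]
  split_ifs with h
  · subst h; simp
  · simp [h]

/-- The exponent of z^{tα_{i,0}+1} depends on the sector. On one sector the operator is a scalar
times a fixed coefficient of the normally ordered exponential, preceded by a shift. -/
theorem vertex_proj (m n : ℤ) (y : Fock) : vertex q d u L i t c m (proj n y)
    = Complex.exp (t * u * L) • normalExp q d i c (m + (t * (eps i * n) + 1))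
        (shift (2 * t * eps i) (proj n y)) := by
  induction y using fock_induction with
  | h0 => simp
  | hadd v w hv hw => simp only [map_add, hv, hw, smul_add]
  | hinj n' p =>
    rw [proj_inj]
    split_ifs with h
    · subst h
      rw [vertex_inj, shift_inj]
    · simp

/-- Shifts and sector projections commute with α_{j,k} for k ≠ 0, so the weights are those of the
normally ordered exponential. -/
theorem primary_vertex : Primary q d (weight q d i c) (vertex q d u L i t c) := by
  intro j k hk m
  refine end_ext fun n p => ?_
  have e1 : inj n p = proj n (inj n p) := by rw [proj_inj, if_pos rfl]
  have e2 : alpha q d j k (inj n p) = proj n (alpha q d j k (inj n p)) := by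
    have := LinearMap.congr_fun (alpha_commute_diag q d j k (Pi.single n 1)).eq (inj n p)
    simp only [Module.End.mul_apply] at this
    rw [proj, this, ← proj, ← e1]
  have e3 := LinearMap.congr_fun (alpha_commute_shift q d j hk (2 * t * eps i)).eq (inj n p)
  have e4 := LinearMap.congr_fun (primary_normalExp (q := q) (d := d) (i := i) (c := c) j k hk
    (m + (t * (eps i * n) + 1))) (shift (2 * t * eps i) (inj n p))
  simp only [LinearMap.sub_apply, Module.End.mul_apply, LinearMap.smul_apply] at e3 e4 ⊢
  rw [e2, vertex_proj, ← e2, e3, e1, vertex_proj, vertex_proj, ← e1, map_smul, ← smul_sub, e4,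
    smul_comm, weight, add_right_comm]

theorem vertex_ket (m n : ℤ) : vertex q d u L i t c m (ket n)
    = Complex.exp (t * u * L) • cre q d i c (-(m + t * eps i * n + 1)) (ket (n + 2 * t * eps i)) := by
  rw [ket, vertex_inj, ← ket, normalExp_ket]
  congr 4
  ring

theorem vac_ann_inj_of_ne {n n' : ℤ} (h : n ≠ n') (l : ℤ) (p : Poly) :
    vac n' (ann q d i c l (inj n p)) = 0 := by
  have e1 : inj n p = proj n (inj n p) := by rw [proj_inj, if_pos rfl]
  have := LinearMap.congr_fun (commute_ann (c := c)
    (fun k _ => alpha_commute_diag q d i k (Pi.single n 1)) l).eq (inj n p)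
  simp only [Module.End.mul_apply] at this
  rw [e1, proj, ← this, vac_diag]
  simp [h.symm]

/-- What reaches sector n comes from sector n - 2t eps_i; evaluating z^{tα_{i,0}+1} there produces
the correction -2t², as eps_i² = 1. -/
theorem vac_vertex (m n : ℤ) (y : Fock) : vac n (vertex q d u L i t c m y)
    = Complex.exp (t * u * L) * vac (n - 2 * t * eps i)
        (ann q d i c (m + t * eps i * n - 2 * t ^ 2 + 1) y) := by
  induction y using fock_induction with
  | h0 => simp
  | hadd v w hv hw => simp only [map_add, hv, hw, mul_add]
  | hinj n' p =>
    rw [vertex_inj, map_smul, vac_normalExp, smul_eq_mul]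
    by_cases h : n' = n - 2 * t * eps i
    · subst h
      have e := LinearMap.congr_fun (commute_ann (c := c) (fun k hk =>
        alpha_commute_shift q d i hk.ne' (2 * t * eps i))
        (m + (t * (eps i * (n - 2 * t * eps i)) + 1))).eq (inj (n - 2 * t * eps i) p)
      simp only [Module.End.mul_apply, shift_inj] at e
      rw [← e, vac_shift]
      congr 4
      linear_combination (-2 * t ^ 2) * eps_mul_self i
    · rw [vac_ann_inj_of_ne h, vac_ann_inj_of_ne (fun h' => h (by rw [← h']; ring))]

/-! ## Moving creation and annihilation operators -/

theorem ann_primary {s : Fin 2 → ℤ → ℂ} {U : ℤ → Module.End ℂ Fock} (hU : Primary q d s U)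
    {κ : ℂ⟦X⟧} (hκ : IsExp (fun k : ℕ => c k * s i k) fun n => PowerSeries.coeff n κ)
    (l : ℕ) (m : ℤ) (y : Fock) : ann q d i c l (U m y)
      = ∑ p ∈ Finset.HasAntidiagonal.antidiagonal l,
          PowerSeries.coeff p.1 κ • U (m + p.1) (ann q d i c p.2 y) := by
  have := isExp_ann (q := q) (d := d) (i := i) (c := c) |>.mul_family hκ (U := U)
    (fun k hk m => by
      rw [smul_mul_assoc, mul_smul_comm, ← smul_sub, hU i k (by omega), smul_smul]) l m
  have h := LinearMap.congr_fun this y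
  simpa only [Module.End.mul_apply, LinearMap.sum_apply, LinearMap.smul_apply] using h

theorem primary_cre_mul {s : Fin 2 → ℤ → ℂ} {U : ℤ → Module.End ℂ Fock} (hU : Primary q d s U)
    {κ : ℂ⟦X⟧} (hκ : IsExp (fun k : ℕ => -(c (-k) * s i (-k))) fun n => PowerSeries.coeff n κ)
    (l : ℕ) (m : ℤ) (y : Fock) : U m (cre q d i c l y)
      = ∑ p ∈ Finset.HasAntidiagonal.antidiagonal l,
          PowerSeries.coeff p.1 κ • cre q d i c p.2 (U (m - p.1) y) := by
  have := isExp_cre (q := q) (d := d) (i := i) (c := c) |>.family_mul (commute_neg c c) hκ (U := U)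
    (fun k hk m => by
      rw [smul_mul_assoc, mul_smul_comm, ← smul_sub, ← neg_sub (alpha q d i (-k) * U m),
        hU i (-k) (by omega), neg_smul, smul_neg, smul_smul, sub_eq_add_neg m]) l m
  have h := LinearMap.congr_fun this y
  simpa only [Module.End.mul_apply, LinearMap.sum_apply, LinearMap.smul_apply] using h

/-- Any annihilation operator that passes U dies on |n,u⟩, so only the fully contracted term
survives. `vac_primary_cre` is the mirror image. -/
theorem ann_primary_ket {s : Fin 2 → ℤ → ℂ} {U : ℤ → Module.End ℂ Fock} (hU : Primary q d s U)
    {κ : ℂ⟦X⟧} (hκ : IsExp (fun k : ℕ => c k * s i k) fun n => PowerSeries.coeff n κ)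
    (l m n : ℤ) : ann q d i c l (U m (ket n)) = ext κ l • U (m + l) (ket n) := by
  rcases lt_or_ge l 0 with h | h
  · rw [ann_neg h, ext_neg _ h]; simp
  · lift l to ℕ using h
    rw [ann_primary hU hκ, Finset.sum_eq_single (l, 0)]
    · simp [ext_natCast, ann_zero]
    · intro p hp hne
      rw [Finset.HasAntidiagonal.mem_antidiagonal] at hp
      rw [ann_ket, if_neg, map_zero, smul_zero]
      intro h0
      exact hne (Prod.ext (by dsimp only; omega) (by dsimp only; omega))
    · intro h
      exact (h (by simp)).elim

theorem vac_primary_cre {s : Fin 2 → ℤ → ℂ} {U : ℤ → Module.End ℂ Fock} (hU : Primary q d s U)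
    {κ : ℂ⟦X⟧} (hκ : IsExp (fun k : ℕ => -(c (-k) * s i (-k))) fun n => PowerSeries.coeff n κ)
    (r m n : ℤ) (y : Fock) :
    vac n (U m (cre q d i c r y)) = ext κ r * vac n (U (m - r) y) := by
  rcases lt_or_ge r 0 with h | h
  · rw [cre_neg h, ext_neg _ h]; simp
  · lift r to ℕ using h
    rw [primary_cre_mul hU hκ, map_sum, Finset.sum_eq_single (r, 0)]
    · simp [ext_natCast, cre_zero]
    · intro p hp hne
      rw [Finset.HasAntidiagonal.mem_antidiagonal] at hp
      rw [map_smul, vac_cre, if_neg, smul_zero]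
      intro h0
      exact hne (Prod.ext (by dsimp only; omega) (by dsimp only; omega))
    · intro h
      exact (h (by simp)).elim

/-! ## Two-point functions -/

/-- The series `κ` is the contraction of the exponentials given by `c` and `c'`:
`exp(∑ c_k α_{i,k} z^{-k}) exp(∑ c'_{-k} α_{j,-k} w^k)` is `κ(w/z)` times the normally ordered
product. -/
def IsContraction (q d : ℂ) (i : Fin 2) (c : ℤ → ℂ) (j : Fin 2) (c' : ℤ → ℂ) (κ : ℂ⟦X⟧) : Prop :=
  IsExp (fun k : ℕ => c k * (alphaPair q d i j k * c' (-k))) fun n => PowerSeries.coeff n κ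

variable {j : Fin 2} {c' : ℤ → ℂ} {t' : ℤ} {κ : ℂ⟦X⟧}

theorem IsContraction.left (h : IsContraction q d i c j c' κ) :
    IsExp (fun k : ℕ => c k * weight q d j c' i k) fun n => PowerSeries.coeff n κ := h

/-- Moving a creation exponential to the left produces the same series as moving an annihilation
exponential to the right: `alphaPair` is odd in the mode, which absorbs the sign. -/
theorem IsContraction.right (h : IsContraction q d i c j c' κ) :
    IsExp (fun k : ℕ => -(c' (-k) * weight q d i c j (-k))) fun n => PowerSeries.coeff n κ := by
  refine IsExp.congr h fun n _ => ?_
  rw [weight, neg_neg, alphaPair_neg, alphaPair_symm q d j i]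
  ring

theorem vac_ann_cre (h : IsContraction q d i c j c' κ) (l r n n' : ℤ) :
    vac n' (ann q d i c l (cre q d j c' r (ket n)))
      = if n = n' ∧ l = r then ext κ l else 0 := by
  have h1 := ann_primary_ket (i := i) (c := c) (primary_cre (q := q) (d := d) (i := j) (c := c'))
    (κ := κ) (IsExp.congr h fun k hk => by rw [if_pos (by omega)]) l (-r) n
  rw [neg_neg] at h1
  rw [h1, map_smul, vac_cre, vac_ket, smul_eq_mul]
  by_cases hn : n = n'
  · by_cases hl : l = r
    · subst hl; simp [hn]
    · rw [if_neg (by omega), if_neg (by tauto), mul_zero]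
  · rw [if_neg hn, if_neg (fun h : n = n' ∧ l = r => hn h.1), ite_self, mul_zero]

/-- The left operator contributes only its annihilation half, the right one only its creation half.
The two conditions express conservation of charge and of degree. -/
theorem vac_vertex_vertex (h : IsContraction q d i c j c' κ) (m n k k' : ℤ) :
    vac k' (vertex q d u L i t c m (vertex q d u L j t' c' n (ket k)))
      = Complex.exp (t * u * L) * Complex.exp (t' * u * L) *
        if k + 2 * t' * eps j + 2 * t * eps i = k' ∧
            m + t * eps i * (k + 2 * t' * eps j) + 1 = -(n + t' * eps j * k + 1)
        then ext κ (-(n + t' * eps j * k + 1)) else 0 := by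
  rw [vertex_ket, map_smul, map_smul, vac_vertex, vac_ann_cre h, smul_eq_mul, ← mul_assoc,
    mul_comm (Complex.exp (t' * u * L))]
  congr 1
  by_cases hk : k + 2 * t' * eps j + 2 * t * eps i = k'
  · subst hk
    have e : m + t * eps i * (k + 2 * t' * eps j + 2 * t * eps i) - 2 * t ^ 2 + 1
        = m + t * eps i * (k + 2 * t' * eps j) + 1 := by
      linear_combination 2 * t ^ 2 * eps_mul_self i
    rw [e]
    have e2 : k + 2 * t' * eps j = k + 2 * t' * eps j + 2 * t * eps i - 2 * t * eps i := by ring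
    by_cases hm : m + t * eps i * (k + 2 * t' * eps j) + 1 = -(n + t' * eps j * k + 1)
    · rw [if_pos ⟨e2, hm⟩, if_pos ⟨rfl, hm⟩, hm]
    · rw [if_neg (fun h => hm h.2), if_neg (fun h => hm h.2)]
  · rw [if_neg (fun h => hk (by rw [h.1]; ring)), if_neg (fun h => hk h.1)]

end

end QToroidal

namespace QToroidal

noncomputable section

variable {q d : ℂ} {i j : Fin 2} {c c' : ℤ → ℂ}

/-! ## Contractions -/

/-- The coefficients of an odd function `c` on the nonzero integers, with `c_k = γ_k / k`. -/
def OddCoeffs (c : ℤ → ℂ) (γ : ℕ → ℂ) : Prop :=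
  ∀ k : ℕ, k ≠ 0 → c k = γ k / k ∧ c (-k) = -(γ k / k)

/-- The coefficients in the exponent of `η_i(z)`. -/
def etaCoeff (n : ℤ) : ℂ := -(1 / (n : ℂ))

/-- The coefficients in the exponent of `ξ_i(z)`. -/
def xiCoeff (q : ℂ) (n : ℤ) : ℂ := q ^ |n| / (n : ℂ)

/-- The coefficients in the exponents of `φ_i^±(q^{-1/2} r^{∓1} z)`. -/
def phiCoeff (q r : ℂ) (n : ℤ) : ℂ := -((1 - (q2 q) ^ |n|) / (n : ℂ) * r ^ |n|)

theorem oddCoeffs_eta : OddCoeffs etaCoeff fun _ => -1 := by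
  intro k _
  constructor <;> simp [etaCoeff] <;> ring

theorem oddCoeffs_xi : OddCoeffs (xiCoeff q) fun k => q ^ k := by
  intro k _
  constructor <;> simp [xiCoeff]
  ring

theorem oddCoeffs_phi (r : ℂ) : OddCoeffs (phiCoeff q r) fun k => -((1 - (q2 q) ^ k) * r ^ k) := by
  intro k _
  constructor <;> simp [phiCoeff] <;> ring

variable {γ γ' : ℕ → ℂ} {κ : ℂ⟦X⟧}

/-- Splitting the exponent given in `hs` into terms ±a^n/n displays the contraction as a product of
`geom a` and `oneSub a`; the explicit series below are found this way. -/
theorem isContraction_same (hc : OddCoeffs c γ) (hc' : OddCoeffs c' γ') {s : ℕ → ℂ}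
    (hκ : IsExp s fun n => PowerSeries.coeff n κ)
    (hs : ∀ n : ℕ, n ≠ 0 → s n = -(γ n * γ' n * (1 + ((q2 q) ^ n)⁻¹) / n)) :
    IsContraction q d i c i c' κ := by
  refine IsExp.congr hκ fun n hn => ?_
  have hn' : (n : ℂ) ≠ 0 := by exact_mod_cast hn
  rw [hs n hn, (hc n hn).1, (hc' n hn).2, alphaPair, if_pos rfl, Nat.abs_cast, zpow_neg,
    zpow_natCast, Int.cast_natCast]
  field_simp

theorem isContraction_ne (hij : i ≠ j) (hc : OddCoeffs c γ) (hc' : OddCoeffs c' γ') {s : ℕ → ℂ}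
    (hκ : IsExp s fun n => PowerSeries.coeff n κ)
    (hs : ∀ n : ℕ, n ≠ 0 → s n = γ n * γ' n * ((q1 q d) ^ n + (q3 q d) ^ n) / n) :
    IsContraction q d i c j c' κ := by
  refine IsExp.congr hκ fun n hn => ?_
  have hn' : (n : ℂ) ≠ 0 := by exact_mod_cast hn
  rw [hs n hn, (hc n hn).1, (hc' n hn).2, alphaPair, if_neg hij, Nat.abs_cast,
    zpow_natCast, zpow_natCast, Int.cast_natCast]
  field_simp

theorem contraction_eta_eta : IsContraction q d i etaCoeff i etaCoeff
    (oneSub 1 * oneSub (q2 q)⁻¹) :=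
  isContraction_same oddCoeffs_eta oddCoeffs_eta
    ((isExp_oneSub 1).mul_series (isExp_oneSub _)) fun n _ => by
      rw [one_pow, inv_pow]; ring

theorem contraction_eta_eta_ne (hij : i ≠ j) : IsContraction q d i etaCoeff j etaCoeff
    (geom (q1 q d) * geom (q3 q d)) :=
  isContraction_ne hij oddCoeffs_eta oddCoeffs_eta
    ((isExp_geom _).mul_series (isExp_geom _)) fun n _ => by ring

theorem contraction_xi_xi (hq : q ≠ 0) : IsContraction q d i (xiCoeff q) i (xiCoeff q)
    (oneSub 1 * oneSub (q2 q)) :=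
  isContraction_same oddCoeffs_xi oddCoeffs_xi
    ((isExp_oneSub 1).mul_series (isExp_oneSub _)) fun n _ => by
      have : q ^ n ≠ 0 := pow_ne_zero _ hq
      rw [one_pow, q2, ← pow_mul, mul_comm 2 n, pow_mul]
      field_simp
      ring

theorem contraction_xi_xi_ne (hq : q ≠ 0) (hd : d ≠ 0) (hij : i ≠ j) :
    IsContraction q d i (xiCoeff q) j (xiCoeff q)
    (geom (q1 q d)⁻¹ * geom (q3 q d)⁻¹) :=
  isContraction_ne hij oddCoeffs_xi oddCoeffs_xi
    ((isExp_geom _).mul_series (isExp_geom _)) fun n _ => by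
      have : q ^ n ≠ 0 := pow_ne_zero _ hq
      have : d ^ n ≠ 0 := pow_ne_zero _ hd
      simp only [q1, q3, mul_inv, mul_pow, inv_pow, inv_inv]
      field_simp
      ring

/-- For odd coefficients c_n c'_{-n} = c'_n c_{-n}, so both orders have the same contraction series.
-/
theorem IsContraction.symm (h : IsContraction q d i c j c' κ) (hc : OddCoeffs c γ)
    (hc' : OddCoeffs c' γ') : IsContraction q d j c' i c κ := by
  refine IsExp.congr h fun n hn => ?_
  rw [(hc n hn).1, (hc n hn).2, (hc' n hn).1, (hc' n hn).2, alphaPair_symm]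
  ring

theorem contraction_eta_xi (hq : q ≠ 0) :
    IsContraction q d i etaCoeff i (xiCoeff q) (geom q * geom q⁻¹) :=
  isContraction_same oddCoeffs_eta oddCoeffs_xi
    ((isExp_geom _).mul_series (isExp_geom _)) fun n _ => by
      have : q ^ n ≠ 0 := pow_ne_zero _ hq
      rw [q2, ← pow_mul, mul_comm 2 n, pow_mul, inv_pow]
      field_simp

theorem contraction_eta_xi_ne (hij : i ≠ j) :
    IsContraction q d i etaCoeff j (xiCoeff q) (oneSub (q * q1 q d) * oneSub (q * q3 q d)) :=
  isContraction_ne hij oddCoeffs_eta oddCoeffs_xi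
    ((isExp_oneSub _).mul_series (isExp_oneSub _)) fun n _ => by
      rw [mul_pow, mul_pow]
      ring

theorem contraction_phi_eta (hq : q ≠ 0) :
    IsContraction q d i (phiCoeff q 1) i etaCoeff (oneSub (q2 q)⁻¹ * geom (q2 q)) :=
  isContraction_same (oddCoeffs_phi 1) oddCoeffs_eta
    ((isExp_oneSub _).mul_series (isExp_geom _)) fun n _ => by
      have : q2 q ^ n ≠ 0 := pow_ne_zero _ (pow_ne_zero _ hq)
      rw [inv_pow, one_pow]
      field_simp
      ring

theorem contraction_phi_eta_ne (hq : q ≠ 0) (hd : d ≠ 0) (hij : i ≠ j) :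
    IsContraction q d i (phiCoeff q 1) j etaCoeff
      (oneSub (q1 q d)⁻¹ * oneSub (q3 q d)⁻¹ * (geom (q1 q d) * geom (q3 q d))) :=
  isContraction_ne hij (oddCoeffs_phi 1) oddCoeffs_eta
    (((isExp_oneSub _).mul_series (isExp_oneSub _)).mul_series
      ((isExp_geom _).mul_series (isExp_geom _))) fun n _ => by
      have : q ^ n ≠ 0 := pow_ne_zero _ hq
      have : d ^ n ≠ 0 := pow_ne_zero _ hd
      simp only [q1, q2, q3, mul_inv, mul_pow, inv_pow, inv_inv, one_pow]
      rw [← pow_mul, mul_comm 2 n, pow_mul]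
      field_simp
      ring

theorem contraction_phi_xi (hq : q ≠ 0) :
    IsContraction q d i (phiCoeff q q⁻¹) i (xiCoeff q) (oneSub (q2 q) * geom (q2 q)⁻¹) :=
  isContraction_same (oddCoeffs_phi _) oddCoeffs_xi
    ((isExp_oneSub _).mul_series (isExp_geom _)) fun n _ => by
      have : q ^ n ≠ 0 := pow_ne_zero _ hq
      have : q2 q ^ n ≠ 0 := pow_ne_zero _ (pow_ne_zero _ hq)
      rw [inv_pow, inv_pow]
      field_simp
      ring

theorem contraction_phi_xi_ne (hq : q ≠ 0) (hd : d ≠ 0) (hij : i ≠ j) :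
    IsContraction q d i (phiCoeff q q⁻¹) j (xiCoeff q)
      (oneSub (q1 q d) * oneSub (q3 q d) * (geom (q1 q d)⁻¹ * geom (q3 q d)⁻¹)) :=
  isContraction_ne hij (oddCoeffs_phi _) oddCoeffs_xi
    (((isExp_oneSub _).mul_series (isExp_oneSub _)).mul_series
      ((isExp_geom _).mul_series (isExp_geom _))) fun n _ => by
      have : q ^ n ≠ 0 := pow_ne_zero _ hq
      have : d ^ n ≠ 0 := pow_ne_zero _ hd
      simp only [q1, q2, q3, mul_inv, mul_pow, inv_pow, inv_inv]
      rw [← pow_mul, mul_comm 2 n, pow_mul]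
      field_simp
      ring

/-- (1 - q^{2n})² q^{-n} (1 + q^{-2n}) = q^{3n} + q^{-3n} - q^n - q^{-n}, whence the four factors.
-/
theorem contraction_phi_phi (hq : q ≠ 0) :
    IsContraction q d i (phiCoeff q 1) i (phiCoeff q q⁻¹)
      (oneSub (q ^ 3)⁻¹ * oneSub (q ^ 3) * (geom q⁻¹ * geom q)) :=
  isContraction_same (oddCoeffs_phi _) (oddCoeffs_phi _)
    (((isExp_oneSub _).mul_series (isExp_oneSub _)).mul_series
      ((isExp_geom _).mul_series (isExp_geom _))) fun n _ => by
      have : q ^ n ≠ 0 := pow_ne_zero _ hq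
      simp only [q2, inv_pow, one_pow, pow_right_comm q _ n]
      field_simp
      ring

/-- (1 - q^{2n})² q^{-2n} (d^n + d^{-n}) = (q^{2n} - 2 + q^{-2n})(d^n + d^{-n}); the -2 is the
source of the repeated numerator. -/
theorem contraction_phi_phi_ne (hq : q ≠ 0) (hd : d ≠ 0) (hij : i ≠ j) :
    IsContraction q d i (phiCoeff q 1) j (phiCoeff q q⁻¹)
      (oneSub d * oneSub d⁻¹ * (oneSub d * oneSub d⁻¹) *
        (geom (q ^ 2 * d) * geom (q ^ 2 * d⁻¹) *
          (geom ((q ^ 2)⁻¹ * d) * geom ((q ^ 2)⁻¹ * d⁻¹)))) :=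
  isContraction_ne hij (oddCoeffs_phi _) (oddCoeffs_phi _)
    ((((isExp_oneSub _).mul_series (isExp_oneSub _)).mul_series
      ((isExp_oneSub _).mul_series (isExp_oneSub _))).mul_series
      (((isExp_geom _).mul_series (isExp_geom _)).mul_series
      ((isExp_geom _).mul_series (isExp_geom _)))) fun n _ => by
      have : q ^ n ≠ 0 := pow_ne_zero _ hq
      have : d ^ n ≠ 0 := pow_ne_zero _ hd
      simp only [q1, q2, q3, mul_pow, inv_pow, one_pow]
      rw [← pow_mul, mul_comm 2 n, pow_mul]
      field_simp
      ring

/-! ## Coefficient identities -/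

theorem ext_one_neg (l : ℤ) : ext 1 (-l) = ext 1 l := by
  simp only [ext_one, neg_eq_zero]

theorem ext_oneSub_oneSub_mul (a b : ℂ) (f : ℂ⟦X⟧) (l : ℤ) : ext (oneSub a * oneSub b * f) l
    = ext f l - (a + b) * ext f (l - 1) + a * b * ext f (l - 2) := by
  rw [mul_assoc, ext_oneSub_mul, ext_oneSub_mul, ext_oneSub_mul, show l - 2 = l - 1 - 1 by ring]
  ring

theorem ext_oneSub_oneSub (a b : ℂ) (l : ℤ) : ext (oneSub a * oneSub b) l
    = ext 1 l - (a + b) * ext 1 (l - 1) + a * b * ext 1 (l - 2) := by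
  rw [← mul_one (oneSub a * oneSub b), ext_oneSub_oneSub_mul]

theorem ext_oneSub_geom (a b : ℂ) (l : ℤ) : ext (oneSub a * geom b) l
    - b * ext (oneSub a * geom b) (l - 1) = ext 1 l - a * ext 1 (l - 1) := by
  rw [← ext_oneSub_mul, ← ext_oneSub_mul, mul_left_comm, oneSub_mul_geom]

theorem ext_geom_geom (a b : ℂ) (l : ℤ) : ext (geom a * geom b) l
    - (a + b) * ext (geom a * geom b) (l - 1) + a * b * ext (geom a * geom b) (l - 2)
      = ext 1 l := by
  rw [← ext_oneSub_oneSub_mul, mul_mul_mul_comm, oneSub_mul_geom, oneSub_mul_geom, one_mul]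

theorem ext_oneSub_geom_two (a b a' b' : ℂ) (l : ℤ) :
    ext (oneSub a * oneSub b * (geom a' * geom b')) l
    - (a' + b') * ext (oneSub a * oneSub b * (geom a' * geom b')) (l - 1)
    + a' * b' * ext (oneSub a * oneSub b * (geom a' * geom b')) (l - 2)
      = ext 1 l - (a + b) * ext 1 (l - 1) + a * b * ext 1 (l - 2) := by
  rw [← ext_oneSub_oneSub_mul, ← ext_oneSub_oneSub, mul_left_comm,
    mul_mul_mul_comm (oneSub a') (oneSub b'), oneSub_mul_geom, oneSub_mul_geom, mul_one, mul_one]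

end

end QToroidal

namespace QToroidal

noncomputable section

variable {q d u L : ℂ} {i j : Fin 2} {c c' : ℤ → ℂ} {t t' : ℤ} {κ : ℂ⟦X⟧}

/-! ## Quadratic relations -/

/-- Matrix coefficients of a homogeneous double series live on one line m + n = -N, so
multiplication by z - q₂w becomes a first-order difference operator in m; `vac_g_ne` gives a
second-order one. -/
theorem vac_g_same {Φ : ℤ → ℤ → Module.End ℂ Fock} {k k' N : ℤ} {a : ℤ → ℂ}
    (h : ∀ m n, vac k' (Φ m n (ket k)) = if m + n + N = 0 then a m else 0) (m n : ℤ) :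
    vac k' (g q d i i (mulZ _) (mulW _) Φ m n (ket k))
        = (if m + n + 1 + N = 0 then a (m + 1) - q2 q * a m else 0) ∧
    vac k' (g q d i i (mulW _) (mulZ _) Φ m n (ket k))
        = if m + n + 1 + N = 0 then a m - q2 q * a (m + 1) else 0 := by
  have e1 : ∀ m n, m + 1 + n + N = 0 ↔ m + n + 1 + N = 0 := fun m n => by omega
  have e2 : ∀ m n, m + (n + 1) + N = 0 ↔ m + n + 1 + N = 0 := fun m n => by omega
  unfold g
  rw [if_pos rfl, if_pos rfl]
  constructor
  · change vac k' ((Φ (m + 1) n - q2 q • Φ m (n + 1)) (ket k)) = _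
    rw [LinearMap.sub_apply, LinearMap.smul_apply, map_sub, map_smul, h, h]
    simp only [e1, e2]
    split_ifs <;> simp
  · change vac k' ((Φ m (n + 1) - q2 q • Φ (m + 1) n) (ket k)) = _
    rw [LinearMap.sub_apply, LinearMap.smul_apply, map_sub, map_smul, h, h]
    simp only [e1, e2]
    split_ifs <;> simp

theorem vac_g_ne (hij : i ≠ j) {Φ : ℤ → ℤ → Module.End ℂ Fock} {k k' N : ℤ} {a : ℤ → ℂ}
    (h : ∀ m n, vac k' (Φ m n (ket k)) = if m + n + N = 0 then a m else 0) (m n : ℤ) :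
    vac k' (g q d i j (mulZ _) (mulW _) Φ m n (ket k))
        = (if m + n + 2 + N = 0 then a (m + 2) - (q1 q d + q3 q d) * a (m + 1)
            + q1 q d * q3 q d * a m else 0) ∧
    vac k' (g q d i j (mulW _) (mulZ _) Φ m n (ket k))
        = if m + n + 2 + N = 0 then a m - (q1 q d + q3 q d) * a (m + 1)
            + q1 q d * q3 q d * a (m + 2) else 0 := by
  have e1 : ∀ m n, m + 2 + n + N = 0 ↔ m + n + 2 + N = 0 := fun m n => by omega
  have e2 : ∀ m n, m + 1 + (n + 1) + N = 0 ↔ m + n + 2 + N = 0 := fun m n => by omega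
  have e3 : ∀ m n, m + (n + 1 + 1) + N = 0 ↔ m + n + 2 + N = 0 := fun m n => by omega
  have e4 : m + 1 + 1 = m + 2 := by ring
  unfold g
  rw [if_neg hij, if_neg hij]
  constructor
  · change vac k' (((Φ (m + 1 + 1) n - q3 q d • Φ (m + 1) (n + 1)) -
      q1 q d • (Φ (m + 1) (n + 1) - q3 q d • Φ m (n + 1 + 1))) (ket k)) = _
    simp only [LinearMap.sub_apply, LinearMap.smul_apply, map_sub, map_smul, h, e1, e2, e3, e4]
    split_ifs
    · simp only [smul_eq_mul]; ring
    · simp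
  · change vac k' (((Φ m (n + 1 + 1) - q3 q d • Φ (m + 1) (n + 1)) -
      q1 q d • (Φ (m + 1) (n + 1) - q3 q d • Φ (m + 1 + 1) n)) (ket k)) = _
    simp only [LinearMap.sub_apply, LinearMap.smul_apply, map_sub, map_smul, h, e1, e2, e3, e4]
    split_ifs
    · simp only [smul_eq_mul]; ring
    · simp

/-- The coefficient form of `d_{i,j} g_{i,j}(z,w) a + g_{j,i}(w,z) b = 0` for series `a`, `b` that
depend on `z/w` only, up to a power of `w`. -/
def ScalarRelation (q d : ℂ) (i j : Fin 2) (a b : ℤ → ℂ) : Prop :=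
  (i = j → ∀ m, a (m + 1) - q2 q * a m + (b m - q2 q * b (m + 1)) = 0) ∧
  (i ≠ j → ∀ m, a (m + 2) - (q1 q d + q3 q d) * a (m + 1) + q1 q d * q3 q d * a m
    = b m - (q1 q d + q3 q d) * b (m + 1) + q1 q d * q3 q d * b (m + 2))

/-- The vanishing criterion leaves only matrix coefficients to check, and these depend on one index.
-/
theorem quadratic_relation (hq : q ≠ 0) (hd : d ≠ 0)
    (hqd : ∀ n m : ℤ, n ≠ 0 ∨ m ≠ 0 → q ^ n * d ^ m ≠ 1)
    {s s' : Fin 2 → ℤ → ℂ} {Φ Ψ : ℤ → ℤ → Module.End ℂ Fock}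
    (hΦ : Φ ∈ primaryPairs q d s s') (hΨ : Ψ ∈ primaryPairs q d s s')
    (h : ∀ k k', ∃ (N : ℤ) (a b : ℤ → ℂ),
      (∀ m n, vac k' (Φ m n (ket k)) = if m + n + N = 0 then a m else 0) ∧
      (∀ m n, vac k' (Ψ m n (ket k)) = if m + n + N = 0 then b m else 0) ∧
      ScalarRelation q d i j a b) (m n : ℤ) :
    (dsign i j • g q d i j (mulZ _) (mulW _) Φ + g q d j i (mulW _) (mulZ _) Ψ) m n = 0 := by
  refine primaryPairs_eq_zero hq hd hqd (s := s) (s' := s') (Submodule.add_mem _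
    (Submodule.smul_mem _ _ (primaryPairs_g _ _ (fun _ => primaryPairs_mulZ)
      (fun _ => primaryPairs_mulW) hΦ))
    (primaryPairs_g _ _ (fun _ => primaryPairs_mulW) (fun _ => primaryPairs_mulZ) hΨ)) ?_ m n
  intro m n k k'
  obtain ⟨N, a, b, ha, hb, hs, hn⟩ := h k k'
  change vac k' ((dsign i j • g q d i j (mulZ _) (mulW _) Φ m n
    + g q d j i (mulW _) (mulZ _) Ψ m n) (ket k)) = 0
  rw [LinearMap.add_apply, LinearMap.smul_apply, map_add, map_smul]
  by_cases hij : i = j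
  · subst hij
    rw [(vac_g_same ha m n).1, (vac_g_same hb m n).2, dsign, if_pos rfl, one_smul]
    split_ifs
    · exact hs rfl m
    · exact add_zero 0
  · rw [(vac_g_ne hij ha m n).1, (vac_g_ne (Ne.symm hij) hb m n).2, dsign, if_neg hij]
    split_ifs
    · rw [hn hij m, neg_smul, one_smul, neg_add_cancel]
    · simp

/-- Relations of the F type are those of the E type with the two products exchanged, up to the
overall sign d_{i,j} = ±1. -/
theorem quadratic_relation_swap (hq : q ≠ 0) (hd : d ≠ 0)
    (hqd : ∀ n m : ℤ, n ≠ 0 ∨ m ≠ 0 → q ^ n * d ^ m ≠ 1)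
    {s s' : Fin 2 → ℤ → ℂ} {Φ Ψ : ℤ → ℤ → Module.End ℂ Fock}
    (hΦ : Φ ∈ primaryPairs q d s s') (hΨ : Ψ ∈ primaryPairs q d s s')
    (h : ∀ k k', ∃ (N : ℤ) (a b : ℤ → ℂ),
      (∀ m n, vac k' (Φ m n (ket k)) = if m + n + N = 0 then a m else 0) ∧
      (∀ m n, vac k' (Ψ m n (ket k)) = if m + n + N = 0 then b m else 0) ∧
      ScalarRelation q d i j b a) (m n : ℤ) :
    (dsign j i • g q d j i (mulW _) (mulZ _) Φ + g q d i j (mulZ _) (mulW _) Ψ) m n = 0 := by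
  have h1 := quadratic_relation (i := i) (j := j) hq hd hqd hΨ hΦ (fun k k' => by
    obtain ⟨N, a, b, ha, hb, hs⟩ := h k k'
    exact ⟨N, b, a, hb, ha, hs⟩) m n
  have h2 : dsign j i * dsign j i = 1 := by unfold dsign; split_ifs <;> simp
  have h3 : dsign i j = dsign j i := by simp only [dsign, eq_comm]
  have h4 := congrArg (fun T => dsign j i • T) h1
  simp only [Pi.add_apply, Pi.smul_apply, smul_add, h3, smul_smul, h2, one_smul, smul_zero] at h4
  rw [add_comm] at h4
  exact h4

/-- The operators `exp(∑_{n>0} c_n α_{i,n} z^{-n}) q^{α_{i,0}}`. -/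
def kPlus (q d : ℂ) (i : Fin 2) (c : ℤ → ℂ) (m : ℤ) : Module.End ℂ Fock :=
  ann q d i c m * diag fun n => q ^ (eps i * n)

/-- The operators `exp(∑_{n>0} c_{-n} α_{i,-n} z^n) q^{-α_{i,0}}`. -/
def kMinus (q d : ℂ) (i : Fin 2) (c : ℤ → ℂ) (m : ℤ) : Module.End ℂ Fock :=
  cre q d i c (-m) * diag fun n => q ^ (-(eps i * n))

theorem Primary.mul_diag {s : Fin 2 → ℤ → ℂ} {U : ℤ → Module.End ℂ Fock} (hU : Primary q d s U)
    (f : ℤ → ℂ) : Primary q d s fun m => U m * diag f := by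
  intro j k hk m
  dsimp only
  rw [mul_assoc, (alpha_commute_diag q d j k f).eq, ← mul_assoc, ← mul_assoc, ← sub_mul, hU j k hk,
    smul_mul_assoc]

theorem primary_kPlus : Primary q d
    (fun j k => if k < 0 then weight q d i c j k else 0) (kPlus q d i c) :=
  primary_ann.mul_diag _

theorem primary_kMinus : Primary q d
    (fun j k => if 0 < k then weight q d i c j k else 0) (kMinus q d i c) :=
  primary_cre.mul_diag _

/-- Here q^{α_{i,0}} acts after the charge has changed, hence on k + 2t' eps_j. In the opposite
order, `vac_vertex_kPlus`, it sees k, and the annihilation exponential acts trivially, so that the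
contraction is replaced by 1. -/
theorem vac_kPlus_vertex (h : IsContraction q d i c j c' κ) (m n k k' : ℤ) :
    vac k' (kPlus q d i c m (vertex q d u L j t' c' n (ket k)))
      = if m + n + (t' * eps j * k + 1) = 0 then if k + 2 * t' * eps j = k' then
          Complex.exp (t' * u * L) * q ^ (eps i * (k + 2 * t' * eps j)) * ext κ m else 0 else 0 := by
  have e : diag (fun n => q ^ (eps i * n)) (vertex q d u L j t' c' n (ket k))
      = (Complex.exp (t' * u * L) * q ^ (eps i * (k + 2 * t' * eps j))) •
        cre q d j c' (-(n + t' * eps j * k + 1)) (ket (k + 2 * t' * eps j)) := by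
    have := LinearMap.congr_fun (commute_cre (c := c') (fun l _ => alpha_commute_diag q d j l
      fun n => q ^ (eps i * n)) (-(n + t' * eps j * k + 1))).eq (ket (k + 2 * t' * eps j))
    simp only [Module.End.mul_apply] at this
    rw [vertex_ket, map_smul, this, diag_ket, map_smul, smul_smul]
  rw [kPlus, Module.End.mul_apply, e, map_smul, map_smul, vac_ann_cre h, smul_eq_mul]
  have e2 : m = -(n + t' * eps j * k + 1) ↔ m + n + (t' * eps j * k + 1) = 0 := by
    constructor <;> intro h <;> linarith
  simp only [← e2]
  by_cases h1 : m = -(n + t' * eps j * k + 1)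
  · by_cases h2 : k + 2 * t' * eps j = k'
    · rw [if_pos ⟨h2, h1⟩, if_pos h1, if_pos h2]
    · rw [if_neg (fun h => h2 h.1), if_pos h1, if_neg h2, mul_zero]
  · rw [if_neg (fun h => h1 h.2), if_neg h1, mul_zero]

theorem vac_vertex_kPlus (m n k k' : ℤ) :
    vac k' (vertex q d u L j t' c' n (kPlus q d i c m (ket k)))
      = if m + n + (t' * eps j * k + 1) = 0 then if k + 2 * t' * eps j = k' then
          Complex.exp (t' * u * L) * q ^ (eps i * k) * ext 1 m else 0 else 0 := by
  rw [kPlus, Module.End.mul_apply, diag_ket, map_smul, ann_ket, ext_one]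
  by_cases hm : m = 0
  · subst hm
    rw [if_pos rfl, if_pos rfl, map_smul, map_smul, vertex_ket, map_smul, vac_cre, vac_ket]
    have e : -(n + t' * eps j * k + 1) = 0 ↔ 0 + n + (t' * eps j * k + 1) = 0 := by
      constructor <;> intro h <;> linarith
    simp only [e, smul_eq_mul]
    split_ifs <;> ring
  · rw [if_neg hm, if_neg hm]
    simp

theorem vac_kMinus_vertex (m n k k' : ℤ) :
    vac k' (kMinus q d i c m (vertex q d u L j t' c' n (ket k)))
      = if m + n + (t' * eps j * k + 1) = 0 then if k + 2 * t' * eps j = k' then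
          Complex.exp (t' * u * L) * q ^ (-(eps i * (k + 2 * t' * eps j))) * ext 1 m
          else 0 else 0 := by
  rw [kMinus, Module.End.mul_apply, vac_cre, vac_diag, vertex_ket, map_smul, vac_cre, vac_ket,
    ext_one]
  have e : -(n + t' * eps j * k + 1) = 0 ↔ 0 + n + (t' * eps j * k + 1) = 0 := by
    constructor <;> intro h <;> linarith
  simp only [e, smul_eq_mul, neg_eq_zero]
  by_cases hm : m = 0
  · subst hm
    simp only [if_true]
    split_ifs with h1 h2
    · rw [h2]; ring
    · ring
    · ring
  · simp [hm]

theorem vac_vertex_kMinus (h : IsContraction q d j c' i c κ) (m n k k' : ℤ) :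
    vac k' (vertex q d u L j t' c' n (kMinus q d i c m (ket k)))
      = if m + n + (t' * eps j * k + 1) = 0 then if k + 2 * t' * eps j = k' then
          Complex.exp (t' * u * L) * q ^ (-(eps i * k)) * ext κ (-m) else 0 else 0 := by
  rw [kMinus, Module.End.mul_apply, diag_ket, map_smul, map_smul, map_smul, vac_vertex,
    vac_ann_cre h]
  by_cases h2 : k + 2 * t' * eps j = k'
  · subst h2
    have e1 : k = k + 2 * t' * eps j - 2 * t' * eps j := by ring
    have e2 : n + t' * eps j * (k + 2 * t' * eps j) - 2 * t' ^ 2 + 1 = -m ↔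
        m + n + (t' * eps j * k + 1) = 0 := by
      have e3 : n + t' * eps j * (k + 2 * t' * eps j) - 2 * t' ^ 2 + 1
          = n + t' * eps j * k + 1 := by linear_combination 2 * t' ^ 2 * eps_mul_self j
      rw [e3]
      constructor <;> intro h <;> linarith
    rw [if_pos (rfl : k + 2 * t' * eps j = k + 2 * t' * eps j)]
    simp only [← e2]
    by_cases h1 : n + t' * eps j * (k + 2 * t' * eps j) - 2 * t' ^ 2 + 1 = -m
    · rw [if_pos ⟨e1, h1⟩, if_pos h1, h1, smul_eq_mul]
      ring
    · rw [if_neg (fun h => h1 h.2), if_neg h1]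
      simp
  · rw [if_neg (fun h => h2 (by rw [h.1]; ring)), if_neg h2]
    simp

end

end QToroidal

/-! ### Quadratic relations EE, FF, KE and KF -/

namespace QToroidal

noncomputable section

variable {q d u L : ℂ} {i j : Fin 2} {c c' : ℤ → ℂ} {t t' : ℤ} {κ κ' : ℂ⟦X⟧}

theorem ScalarRelation.smul {a b : ℤ → ℂ} (h : ScalarRelation q d i j a b) (r : ℂ) :
    ScalarRelation q d i j (fun m => r * a m) fun m => r * b m :=
  ⟨fun e m => by linear_combination r * h.1 e m, fun e m => by linear_combination r * h.2 e m⟩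

theorem ScalarRelation.zero : ScalarRelation q d i j (fun _ => 0) fun _ => 0 :=
  ⟨fun _ _ => by simp, fun _ _ => by simp⟩

/-- The shift 2(t eps_i)(t' eps_j) is the power of z gained when z^{tα_{i,0}} passes e^{t'χ_j}. -/
theorem vac_vertex_vertex_left (h : IsContraction q d i c j c' κ) (m n k k' : ℤ) :
    vac k' ((prodZW (vertex q d u L i t c) (vertex q d u L j t' c') m n) (ket k))
      = if m + n + (t * eps i * k + t' * eps j * k + 2 * (t * eps i * (t' * eps j)) + 2) = 0 then
          (if k + 2 * t' * eps j + 2 * t * eps i = k' then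
            Complex.exp (t * u * L) * Complex.exp (t' * u * L) else 0) *
          ext κ (m + (t * eps i * k + 1) + 2 * (t * eps i * (t' * eps j))) else 0 := by
  rw [prodZW, Module.End.mul_apply, vac_vertex_vertex h]
  by_cases h1 : k + 2 * t' * eps j + 2 * t * eps i = k'
  · rw [if_pos h1]
    by_cases h2 : m + n + (t * eps i * k + t' * eps j * k + 2 * (t * eps i * (t' * eps j)) + 2) = 0
    · rw [if_pos h2, if_pos ⟨h1, by linear_combination h2⟩]
      congr 2
      linear_combination -h2
    · rw [if_neg h2, if_neg (fun h => h2 (by linear_combination h.2)), mul_zero]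
  · rw [if_neg (fun h => h1 h.1), if_neg h1]
    simp

theorem vac_vertex_vertex_right (h : IsContraction q d j c' i c κ) (m n k k' : ℤ) :
    vac k' ((prodWZ (vertex q d u L i t c) (vertex q d u L j t' c') m n) (ket k))
      = if m + n + (t * eps i * k + t' * eps j * k + 2 * (t * eps i * (t' * eps j)) + 2) = 0 then
          (if k + 2 * t' * eps j + 2 * t * eps i = k' then
            Complex.exp (t * u * L) * Complex.exp (t' * u * L) else 0) *
          ext κ (-(m + (t * eps i * k + 1))) else 0 := by
  rw [prodWZ, Module.End.mul_apply, vac_vertex_vertex h, add_right_comm k]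
  by_cases h1 : k + 2 * t' * eps j + 2 * t * eps i = k'
  · rw [if_pos h1]
    by_cases h2 : m + n + (t * eps i * k + t' * eps j * k + 2 * (t * eps i * (t' * eps j)) + 2) = 0
    · rw [if_pos h2, if_pos ⟨h1, by linear_combination h2⟩, mul_comm (Complex.exp (t' * u * L)),
        add_assoc m]
    · rw [if_neg h2, if_neg (fun h => h2 (by linear_combination h.2)), mul_zero]
  · rw [if_neg (fun h => h1 h.1), if_neg h1]
    simp

theorem eps_mul_eps_ne (h : i ≠ j) : eps i * eps j = -1 := by
  fin_cases i <;> fin_cases j <;> simp_all [eps]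

theorem vertex_relation (hq : q ≠ 0) (hd : d ≠ 0)
    (hqd : ∀ n m : ℤ, n ≠ 0 ∨ m ≠ 0 → q ^ n * d ^ m ≠ 1)
    (h : IsContraction q d i c j c' κ) (h' : IsContraction q d j c' i c κ')
    (hS : ∀ x, ScalarRelation q d i j (fun m => ext κ (m + x + 2 * (t * eps i * (t' * eps j))))
      fun m => ext κ' (-(m + x))) (m n : ℤ) :
    (dsign i j • g q d i j (mulZ _) (mulW _)
        (prodZW (vertex q d u L i t c) (vertex q d u L j t' c'))
      + g q d j i (mulW _) (mulZ _)
        (prodWZ (vertex q d u L i t c) (vertex q d u L j t' c'))) m n = 0 :=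
  quadratic_relation hq hd hqd (primary_vertex.prodZW primary_vertex)
    (primary_vertex.prodWZ primary_vertex) (fun k k' => ⟨_, _, _,
      fun m n => vac_vertex_vertex_left h m n k k', fun m n => vac_vertex_vertex_right h' m n k k',
      (hS _).smul _⟩) m n

theorem vertex_relation_swap (hq : q ≠ 0) (hd : d ≠ 0)
    (hqd : ∀ n m : ℤ, n ≠ 0 ∨ m ≠ 0 → q ^ n * d ^ m ≠ 1)
    (h : IsContraction q d i c j c' κ) (h' : IsContraction q d j c' i c κ')
    (hS : ∀ x, ScalarRelation q d i j (fun m => ext κ' (-(m + x)))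
      fun m => ext κ (m + x + 2 * (t * eps i * (t' * eps j)))) (m n : ℤ) :
    (dsign j i • g q d j i (mulW _) (mulZ _)
        (prodZW (vertex q d u L i t c) (vertex q d u L j t' c'))
      + g q d i j (mulZ _) (mulW _)
        (prodWZ (vertex q d u L i t c) (vertex q d u L j t' c'))) m n = 0 :=
  quadratic_relation_swap hq hd hqd (primary_vertex.prodZW primary_vertex)
    (primary_vertex.prodWZ primary_vertex) (fun k k' => ⟨_, _, _,
      fun m n => vac_vertex_vertex_left h m n k k', fun m n => vac_vertex_vertex_right h' m n k k',
      (hS _).smul _⟩) m n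

theorem ext_one_congr {a b : ℤ} (h : a = b ∨ a = -b) : ext 1 a = ext 1 b := by
  rcases h with rfl | rfl
  · rfl
  · exact ext_one_neg b

theorem exp_mul_exp_neg (z : ℂ) : Complex.exp z * Complex.exp (-z) = 1 := by
  rw [← Complex.exp_add, add_neg_cancel, Complex.exp_zero]

theorem scalar_same (p : ℂ) (y : ℤ) : ext (oneSub 1 * oneSub p) (y + 3)
    = ext 1 (y + 3) - (1 + p) * ext 1 (y + 2) + p * ext 1 (y + 1) ∧
    ext (oneSub 1 * oneSub p) (-y)
    = ext 1 y - (1 + p) * ext 1 (y + 1) + p * ext 1 (y + 2) := by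
  rw [ext_oneSub_oneSub, ext_oneSub_oneSub, ext_one_neg,
    ext_one_congr (a := -y - 1) (b := y + 1) (by omega),
    ext_one_congr (a := -y - 2) (b := y + 2) (by omega), one_mul,
    show y + 3 - 1 = y + 2 by ring, show y + 3 - 2 = y + 1 by ring]
  exact ⟨rfl, rfl⟩

/-- (z - q₂w)(z - w)(z - q₂⁻¹w) is antisymmetric: the first and last factors have a symmetric
product. -/
theorem scalarRelation_eta_same (hq : q ≠ 0) (x : ℤ) :
    ScalarRelation q d i i (fun m => ext (oneSub 1 * oneSub (q2 q)⁻¹) (m + x + 2))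
      fun m => ext (oneSub 1 * oneSub (q2 q)⁻¹) (-(m + x)) := by
  refine ⟨fun _ m => ?_, fun h => absurd rfl h⟩
  have h2 : q2 q * (q2 q)⁻¹ = 1 := mul_inv_cancel₀ (pow_ne_zero 2 hq)
  have h3 := (scalar_same (q2 q)⁻¹ (m + x)).1
  have h4 := (scalar_same (q2 q)⁻¹ (m + x - 1)).1
  have h5 := (scalar_same (q2 q)⁻¹ (m + x)).2
  have h6 := (scalar_same (q2 q)⁻¹ (m + x + 1)).2
  dsimp only
  rw [show m + 1 + x + 2 = m + x + 3 by ring, show m + x + 2 = m + x - 1 + 3 by ring,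
    show m + 1 + x = m + x + 1 by ring, h3, h4, h5, h6]
  rw [show m + x - 1 + 3 = m + x + 2 by ring, show m + x - 1 + 2 = m + x + 1 by ring,
    show m + x - 1 + 1 = m + x by ring, show m + x + 1 + 2 = m + x + 3 by ring,
    show m + x + 1 + 1 = m + x + 2 by ring]
  linear_combination (-ext 1 (m + x) + ext 1 (m + x + 1) + ext 1 (m + x + 2)
    - ext 1 (m + x + 3)) * h2

theorem scalarRelation_xi_same (x : ℤ) :
    ScalarRelation q d i i (fun m => ext (oneSub 1 * oneSub (q2 q)) (-(m + x)))
      fun m => ext (oneSub 1 * oneSub (q2 q)) (m + x + 2) := by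
  refine ⟨fun _ m => ?_, fun h => absurd rfl h⟩
  have h3 := (scalar_same (q2 q) (m + x)).1
  have h4 := (scalar_same (q2 q) (m + x - 1)).1
  have h5 := (scalar_same (q2 q) (m + x)).2
  have h6 := (scalar_same (q2 q) (m + x + 1)).2
  dsimp only
  rw [show m + 1 + x + 2 = m + x + 3 by ring, show m + x + 2 = m + x - 1 + 3 by ring,
    show m + 1 + x = m + x + 1 by ring, h3, h4, h5, h6]
  rw [show m + x - 1 + 3 = m + x + 2 by ring, show m + x - 1 + 2 = m + x + 1 by ring,
    show m + x - 1 + 1 = m + x by ring, show m + x + 1 + 2 = m + x + 3 by ring,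
    show m + x + 1 + 1 = m + x + 2 by ring]
  ring

/-- Clearing the denominator (1 - ax)(1 - bx) leaves the series 1 for either direction of expansion,
and its coefficients are invariant under y ↦ -y. -/
theorem geom_symmetry (a b : ℂ) (y : ℤ) : ext (geom a * geom b) y
    - (a + b) * ext (geom a * geom b) (y - 1) + a * b * ext (geom a * geom b) (y - 2)
    = ext (geom a * geom b) (-y) - (a + b) * ext (geom a * geom b) (-(y + 1))
      + a * b * ext (geom a * geom b) (-(y + 2)) := by
  rw [ext_geom_geom, show -(y + 1) = -y - 1 by ring, show -(y + 2) = -y - 2 by ring,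
    ext_geom_geom, ext_one_neg]

theorem scalarRelation_eta_ne (hij : i ≠ j) (x : ℤ) :
    ScalarRelation q d i j (fun m => ext (geom (q1 q d) * geom (q3 q d)) (m + x + 2 * (-1)))
      fun m => ext (geom (q1 q d) * geom (q3 q d)) (-(m + x)) := by
  refine ⟨fun h => absurd h hij, fun _ m => ?_⟩
  have h := geom_symmetry (q1 q d) (q3 q d) (m + x)
  dsimp only
  rw [show m + 2 + x + 2 * (-1) = m + x by ring, show m + 1 + x + 2 * (-1) = m + x - 1 by ring,
    show m + x + 2 * (-1) = m + x - 2 by ring, show m + 1 + x = m + x + 1 by ring,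
    show m + 2 + x = m + x + 2 by ring]
  exact h

theorem q1_ne_zero (hq : q ≠ 0) (hd : d ≠ 0) : q1 q d ≠ 0 := mul_ne_zero (inv_ne_zero hq) hd

theorem q3_ne_zero (hq : q ≠ 0) (hd : d ≠ 0) : q3 q d ≠ 0 :=
  mul_ne_zero (inv_ne_zero hq) (inv_ne_zero hd)

theorem q2_mul_q1_mul_q3 (hq : q ≠ 0) (hd : d ≠ 0) : q2 q * (q1 q d * q3 q d) = 1 := by
  unfold q1 q2 q3
  field_simp

theorem scalarRelation_xi_ne (hq : q ≠ 0) (hd : d ≠ 0) (hij : i ≠ j) (x : ℤ) :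
    ScalarRelation q d i j (fun m => ext (geom (q1 q d)⁻¹ * geom (q3 q d)⁻¹) (-(m + x)))
      fun m => ext (geom (q1 q d)⁻¹ * geom (q3 q d)⁻¹) (m + x + 2 * (-1)) := by
  refine ⟨fun h => absurd h hij, fun _ m => ?_⟩
  have h := geom_symmetry (q1 q d)⁻¹ (q3 q d)⁻¹ (m + x)
  have h1 := mul_inv_cancel₀ (q1_ne_zero hq hd)
  have h3 := mul_inv_cancel₀ (q3_ne_zero hq hd)
  dsimp only
  rw [show m + 2 + x + 2 * (-1) = m + x by ring, show m + 1 + x + 2 * (-1) = m + x - 1 by ring,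
    show m + x + 2 * (-1) = m + x - 2 by ring, show m + 1 + x = m + x + 1 by ring,
    show m + 2 + x = m + x + 2 by ring]
  generalize ext (geom (q1 q d)⁻¹ * geom (q3 q d)⁻¹) = f at *
  generalize (q1 q d)⁻¹ = a at *
  generalize (q3 q d)⁻¹ = b at *
  linear_combination -(q1 q d * q3 q d) * h + (f (m + x - 2) * b * q3 q d
    - f (m + x - 1) * q3 q d + f (-(m + x + 1)) * q3 q d - f (-(m + x + 2)) * b * q3 q d) * h1
    + (f (m + x - 2) - f (m + x - 1) * q1 q d + f (-(m + x + 1)) * q1 q d - f (-(m + x + 2))) * h3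

theorem rhoE_eq : rhoE q d u L i = vertex q d u L i 1 etaCoeff := rfl

theorem rhoF_eq : rhoF q d u L i = vertex q d u L i (-1) (xiCoeff q) := rfl

theorem rhoE_rhoE (hq : q ≠ 0) (hd : d ≠ 0)
    (hqd : ∀ n m : ℤ, n ≠ 0 ∨ m ≠ 0 → q ^ n * d ^ m ≠ 1) (m n : ℤ) :
    (dsign i j • g q d i j (mulZ _) (mulW _) (prodZW (rhoE q d u L i) (rhoE q d u L j))
      + g q d j i (mulW _) (mulZ _) (prodWZ (rhoE q d u L i) (rhoE q d u L j))) m n = 0 := by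
  rw [rhoE_eq, rhoE_eq]
  by_cases hij : i = j
  · subst hij
    refine vertex_relation hq hd hqd contraction_eta_eta contraction_eta_eta (fun x => ?_) m n
    rw [one_mul, eps_mul_self]
    exact scalarRelation_eta_same hq x
  · refine vertex_relation hq hd hqd (contraction_eta_eta_ne hij)
      (contraction_eta_eta_ne (Ne.symm hij)) (fun x => ?_) m n
    rw [one_mul, one_mul, eps_mul_eps_ne hij]
    exact scalarRelation_eta_ne hij x

theorem rhoF_rhoF (hq : q ≠ 0) (hd : d ≠ 0)
    (hqd : ∀ n m : ℤ, n ≠ 0 ∨ m ≠ 0 → q ^ n * d ^ m ≠ 1) (m n : ℤ) :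
    (dsign j i • g q d j i (mulW _) (mulZ _) (prodZW (rhoF q d u L i) (rhoF q d u L j))
      + g q d i j (mulZ _) (mulW _) (prodWZ (rhoF q d u L i) (rhoF q d u L j))) m n = 0 := by
  rw [rhoF_eq, rhoF_eq]
  by_cases hij : i = j
  · subst hij
    refine vertex_relation_swap hq hd hqd (contraction_xi_xi hq) (contraction_xi_xi hq)
      (fun x => ?_) m n
    rw [neg_one_mul, neg_mul_neg, eps_mul_self]
    exact scalarRelation_xi_same x
  · refine vertex_relation_swap hq hd hqd (contraction_xi_xi_ne hq hd hij)
      (contraction_xi_xi_ne hq hd (Ne.symm hij)) (fun x => ?_) m n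
    rw [neg_one_mul, neg_one_mul, neg_mul_neg, eps_mul_eps_ne hij]
    exact scalarRelation_xi_ne hq hd hij x

theorem ScalarRelation.of_ite {p : Prop} [Decidable p] {a b : ℤ → ℂ}
    (h : ScalarRelation q d i j a b) :
    ScalarRelation q d i j (fun m => if p then a m else 0) fun m => if p then b m else 0 := by
  split_ifs
  · exact h
  · exact ScalarRelation.zero

theorem ScalarRelation.congr {a b a' b' : ℤ → ℂ} (h : ScalarRelation q d i j a b)
    (ha : ∀ m, a' m = a m) (hb : ∀ m, b' m = b m) : ScalarRelation q d i j a' b' := by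
  rwa [funext ha, funext hb]

theorem zpow_add_two_mul (hq : q ≠ 0) (k : ℤ) :
    q ^ (eps i * (k + 2 * t' * eps j)) = q ^ (2 * t' * (eps i * eps j)) * q ^ (eps i * k) := by
  rw [← zpow_add₀ hq]
  congr 1
  ring

/-- `hS` says that the contraction, times the power of q from moving q^{α_{i,0}} past e^{t'χ_j}, is
the exchange factor prescribed by the structure functions. -/
theorem kPlus_relation (hq : q ≠ 0) (hd : d ≠ 0)
    (hqd : ∀ n m : ℤ, n ≠ 0 ∨ m ≠ 0 → q ^ n * d ^ m ≠ 1) (h : IsContraction q d i c j c' κ)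
    (hS : ScalarRelation q d i j (fun m => q ^ (2 * t' * (eps i * eps j)) * ext κ m)
      fun m => ext 1 m) (m n : ℤ) :
    (dsign i j • g q d i j (mulZ _) (mulW _)
        (prodZW (kPlus q d i c) (vertex q d u L j t' c'))
      + g q d j i (mulW _) (mulZ _)
        (prodWZ (kPlus q d i c) (vertex q d u L j t' c'))) m n = 0 := by
  refine quadratic_relation hq hd hqd (primary_kPlus.prodZW primary_vertex)
    (primary_kPlus.prodWZ primary_vertex) (fun k k' => ⟨t' * eps j * k + 1,
      fun m => if k + 2 * t' * eps j = k' then Complex.exp (t' * u * L) * q ^ (eps i * (k + 2 * t' * eps j)) * ext κ m else 0,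
      fun m => if k + 2 * t' * eps j = k' then Complex.exp (t' * u * L) * q ^ (eps i * k) * ext 1 m else 0,
      fun m n => by
        rw [prodZW, Module.End.mul_apply]; exact vac_kPlus_vertex h m n k k', fun m n => by
        rw [prodWZ, Module.End.mul_apply]; exact vac_vertex_kPlus m n k k', ScalarRelation.of_ite ?_⟩) m n
  refine (hS.smul (Complex.exp (t' * u * L) * q ^ (eps i * k))).congr (fun m => ?_) fun m => ?_
  · simp only [zpow_add_two_mul hq]
    ring
  · rfl

theorem kPlus_relation_swap (hq : q ≠ 0) (hd : d ≠ 0)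
    (hqd : ∀ n m : ℤ, n ≠ 0 ∨ m ≠ 0 → q ^ n * d ^ m ≠ 1) (h : IsContraction q d i c j c' κ)
    (hS : ScalarRelation q d i j (fun m => ext 1 m)
      fun m => q ^ (2 * t' * (eps i * eps j)) * ext κ m) (m n : ℤ) :
    (dsign j i • g q d j i (mulW _) (mulZ _)
        (prodZW (kPlus q d i c) (vertex q d u L j t' c'))
      + g q d i j (mulZ _) (mulW _)
        (prodWZ (kPlus q d i c) (vertex q d u L j t' c'))) m n = 0 := by
  refine quadratic_relation_swap hq hd hqd (primary_kPlus.prodZW primary_vertex)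
    (primary_kPlus.prodWZ primary_vertex) (fun k k' => ⟨t' * eps j * k + 1,
      fun m => if k + 2 * t' * eps j = k' then Complex.exp (t' * u * L) * q ^ (eps i * (k + 2 * t' * eps j)) * ext κ m else 0,
      fun m => if k + 2 * t' * eps j = k' then Complex.exp (t' * u * L) * q ^ (eps i * k) * ext 1 m else 0,
      fun m n => by
        rw [prodZW, Module.End.mul_apply]; exact vac_kPlus_vertex h m n k k', fun m n => by
        rw [prodWZ, Module.End.mul_apply]; exact vac_vertex_kPlus m n k k', ScalarRelation.of_ite ?_⟩) m n
  refine (hS.smul (Complex.exp (t' * u * L) * q ^ (eps i * k))).congr (fun m => ?_) fun m => ?_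
  · rfl
  · simp only [zpow_add_two_mul hq]
    ring

theorem kMinus_relation (hq : q ≠ 0) (hd : d ≠ 0)
    (hqd : ∀ n m : ℤ, n ≠ 0 ∨ m ≠ 0 → q ^ n * d ^ m ≠ 1) (h : IsContraction q d j c' i c κ)
    (hS : ScalarRelation q d i j (fun m => (q ^ (2 * t' * (eps i * eps j)))⁻¹ * ext 1 m)
      fun m => ext κ (-m)) (m n : ℤ) :
    (dsign i j • g q d i j (mulZ _) (mulW _)
        (prodZW (kMinus q d i c) (vertex q d u L j t' c'))
      + g q d j i (mulW _) (mulZ _)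
        (prodWZ (kMinus q d i c) (vertex q d u L j t' c'))) m n = 0 := by
  refine quadratic_relation hq hd hqd (primary_kMinus.prodZW primary_vertex)
    (primary_kMinus.prodWZ primary_vertex) (fun k k' => ⟨t' * eps j * k + 1,
      fun m => if k + 2 * t' * eps j = k' then Complex.exp (t' * u * L) * q ^ (-(eps i * (k + 2 * t' * eps j))) *
        ext 1 m else 0,
      fun m => if k + 2 * t' * eps j = k' then Complex.exp (t' * u * L) * q ^ (-(eps i * k)) * ext κ (-m) else 0,
      fun m n => by
        rw [prodZW, Module.End.mul_apply]; exact vac_kMinus_vertex m n k k', fun m n => by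
        rw [prodWZ, Module.End.mul_apply]; exact vac_vertex_kMinus h m n k k', ScalarRelation.of_ite ?_⟩) m n
  refine (hS.smul (Complex.exp (t' * u * L) * q ^ (-(eps i * k)))).congr (fun m => ?_) fun m => ?_
  · simp only [zpow_neg, zpow_add_two_mul hq, mul_inv]
    ring
  · rfl

theorem kMinus_relation_swap (hq : q ≠ 0) (hd : d ≠ 0)
    (hqd : ∀ n m : ℤ, n ≠ 0 ∨ m ≠ 0 → q ^ n * d ^ m ≠ 1) (h : IsContraction q d j c' i c κ)
    (hS : ScalarRelation q d i j (fun m => ext κ (-m))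
      fun m => (q ^ (2 * t' * (eps i * eps j)))⁻¹ * ext 1 m) (m n : ℤ) :
    (dsign j i • g q d j i (mulW _) (mulZ _)
        (prodZW (kMinus q d i c) (vertex q d u L j t' c'))
      + g q d i j (mulZ _) (mulW _)
        (prodWZ (kMinus q d i c) (vertex q d u L j t' c'))) m n = 0 := by
  refine quadratic_relation_swap hq hd hqd (primary_kMinus.prodZW primary_vertex)
    (primary_kMinus.prodWZ primary_vertex) (fun k k' => ⟨t' * eps j * k + 1,
      fun m => if k + 2 * t' * eps j = k' then Complex.exp (t' * u * L) * q ^ (-(eps i * (k + 2 * t' * eps j))) *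
        ext 1 m else 0,
      fun m => if k + 2 * t' * eps j = k' then Complex.exp (t' * u * L) * q ^ (-(eps i * k)) * ext κ (-m) else 0,
      fun m n => by
        rw [prodZW, Module.End.mul_apply]; exact vac_kMinus_vertex m n k k', fun m n => by
        rw [prodWZ, Module.End.mul_apply]; exact vac_vertex_kMinus h m n k k', ScalarRelation.of_ite ?_⟩) m n
  refine (hS.smul (Complex.exp (t' * u * L) * q ^ (-(eps i * k)))).congr (fun m => ?_) fun m => ?_
  · rfl
  · simp only [zpow_neg, zpow_add_two_mul hq, mul_inv]
    ring

theorem ext_oneSub_geom_succ (a b : ℂ) (m : ℤ) : ext (oneSub a * geom b) (m + 1)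
    - b * ext (oneSub a * geom b) m = ext 1 (m + 1) - a * ext 1 m := by
  simpa only [add_sub_cancel_right] using ext_oneSub_geom a b (m + 1)

theorem ext_oneSub_geom_neg (a b : ℂ) (m : ℤ) : ext (oneSub a * geom b) (-m)
    - b * ext (oneSub a * geom b) (-(m + 1)) = ext 1 m - a * ext 1 (m + 1) := by
  have h := ext_oneSub_geom a b (-m)
  rwa [show -m - 1 = -(m + 1) by ring, ext_one_neg, ext_one_neg] at h

theorem ext_oneSub_geom_two_succ (a b a' b' : ℂ) (m : ℤ) :
    ext (oneSub a * oneSub b * (geom a' * geom b')) (m + 2)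
    - (a' + b') * ext (oneSub a * oneSub b * (geom a' * geom b')) (m + 1)
    + a' * b' * ext (oneSub a * oneSub b * (geom a' * geom b')) m
      = ext 1 (m + 2) - (a + b) * ext 1 (m + 1) + a * b * ext 1 m := by
  have h := ext_oneSub_geom_two a b a' b' (m + 2)
  rwa [show m + 2 - 1 = m + 1 by ring, show m + 2 - 2 = m by ring] at h

theorem ext_oneSub_geom_two_neg (a b a' b' : ℂ) (m : ℤ) :
    ext (oneSub a * oneSub b * (geom a' * geom b')) (-m)
    - (a' + b') * ext (oneSub a * oneSub b * (geom a' * geom b')) (-(m + 1))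
    + a' * b' * ext (oneSub a * oneSub b * (geom a' * geom b')) (-(m + 2))
      = ext 1 m - (a + b) * ext 1 (m + 1) + a * b * ext 1 (m + 2) := by
  have h := ext_oneSub_geom_two a b a' b' (-m)
  rwa [show -m - 1 = -(m + 1) by ring, show -m - 2 = -(m + 2) by ring, ext_one_neg, ext_one_neg,
    ext_one_neg] at h

/-- In `phiCoeff` the parameter is 1 for K^+(z) and q⁻¹ for K^-(z); replacing z by q^c z exchanges
the two values. This accounts for the parameters in this and the next three relations. -/
theorem kPlus_rhoE (hq : q ≠ 0) (hd : d ≠ 0)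
    (hqd : ∀ n m : ℤ, n ≠ 0 ∨ m ≠ 0 → q ^ n * d ^ m ≠ 1) (m n : ℤ) :
    (dsign i j • g q d i j (mulZ _) (mulW _)
        (prodZW (kPlus q d i (phiCoeff q 1)) (rhoE q d u L j))
      + g q d j i (mulW _) (mulZ _)
        (prodWZ (kPlus q d i (phiCoeff q 1)) (rhoE q d u L j))) m n = 0 := by
  have h2 := mul_inv_cancel₀ (pow_ne_zero 2 hq)
  rw [rhoE_eq]
  by_cases hij : i = j
  · subst hij
    refine kPlus_relation hq hd hqd (contraction_phi_eta hq) ⟨fun _ m => ?_, fun h => absurd rfl h⟩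
      m n
    have h := ext_oneSub_geom_succ (q2 q)⁻¹ (q2 q) m
    simp only [eps_mul_self, mul_one]
    rw [show q ^ (2 : ℤ) = q2 q from zpow_natCast q 2]
    change q2 q * (q2 q)⁻¹ = 1 at h2
    linear_combination q2 q * h - ext 1 m * h2
  · refine kPlus_relation hq hd hqd (contraction_phi_eta_ne hq hd hij)
      ⟨fun h => absurd h hij, fun _ m => ?_⟩ m n
    have h := ext_oneSub_geom_two_succ (q1 q d)⁻¹ (q3 q d)⁻¹ (q1 q d) (q3 q d) m
    have h1 := mul_inv_cancel₀ (q1_ne_zero hq hd)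
    have h3 := mul_inv_cancel₀ (q3_ne_zero hq hd)
    -- The charge factor q^{-2} equals q₁q₃ and turns (1 - q₁⁻¹x)(1 - q₃⁻¹x) into (x - q₁)(x - q₃),
    -- the numerator coming from g_{j,i}(w,z).
    have h0 : q ^ (2 * 1 * -1 : ℤ) = q1 q d * q3 q d := by
      rw [show (2 * 1 * -1 : ℤ) = -(2 : ℕ) by norm_num, zpow_neg, zpow_natCast]
      exact inv_eq_of_mul_eq_one_right (q2_mul_q1_mul_q3 hq hd)
    simp only [eps_mul_eps_ne hij, h0]
    generalize (q1 q d)⁻¹ = a at *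
    generalize (q3 q d)⁻¹ = b at *
    linear_combination q1 q d * q3 q d * h + (ext 1 m * b * q3 q d - ext 1 (m + 1) * q3 q d) * h1
      + (ext 1 m - ext 1 (m + 1) * q1 q d) * h3

theorem kMinus_rhoE (hq : q ≠ 0) (hd : d ≠ 0)
    (hqd : ∀ n m : ℤ, n ≠ 0 ∨ m ≠ 0 → q ^ n * d ^ m ≠ 1) (m n : ℤ) :
    (dsign i j • g q d i j (mulZ _) (mulW _)
        (prodZW (kMinus q d i (phiCoeff q 1)) (rhoE q d u L j))
      + g q d j i (mulW _) (mulZ _)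
        (prodWZ (kMinus q d i (phiCoeff q 1)) (rhoE q d u L j))) m n = 0 := by
  have h2 := mul_inv_cancel₀ (pow_ne_zero 2 hq)
  rw [rhoE_eq]
  by_cases hij : i = j
  · subst hij
    refine kMinus_relation hq hd hqd ((contraction_phi_eta hq).symm (oddCoeffs_phi 1) oddCoeffs_eta)
      ⟨fun _ m => ?_, fun h => absurd rfl h⟩ m n
    have h := ext_oneSub_geom_neg (q2 q)⁻¹ (q2 q) m
    simp only [eps_mul_self, mul_one]
    rw [show q ^ (2 : ℤ) = q2 q from zpow_natCast q 2]
    change q2 q * (q2 q)⁻¹ = 1 at h2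
    linear_combination h - ext 1 m * h2
  · refine kMinus_relation hq hd hqd
      ((contraction_phi_eta_ne hq hd hij).symm (oddCoeffs_phi 1) oddCoeffs_eta)
      ⟨fun h => absurd h hij, fun _ m => ?_⟩ m n
    have h := ext_oneSub_geom_two_neg (q1 q d)⁻¹ (q3 q d)⁻¹ (q1 q d) (q3 q d) m
    have h1 := mul_inv_cancel₀ (q1_ne_zero hq hd)
    have h3 := mul_inv_cancel₀ (q3_ne_zero hq hd)
    have h0 : (q ^ (2 * 1 * -1 : ℤ))⁻¹ = (q1 q d)⁻¹ * (q3 q d)⁻¹ := by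
      rw [← mul_inv]
      congr 1
      rw [show (2 * 1 * -1 : ℤ) = -(2 : ℕ) by norm_num, zpow_neg, zpow_natCast]
      exact inv_eq_of_mul_eq_one_right (q2_mul_q1_mul_q3 hq hd)
    simp only [eps_mul_eps_ne hij, h0]
    generalize (q1 q d)⁻¹ = a at *
    generalize (q3 q d)⁻¹ = b at *
    linear_combination -h + (-ext 1 (m + 1) * b + ext 1 m * b * q3 q d) * h1
      + (-ext 1 (m + 1) * a + ext 1 m) * h3

theorem kPlus_rhoF (hq : q ≠ 0) (hd : d ≠ 0)
    (hqd : ∀ n m : ℤ, n ≠ 0 ∨ m ≠ 0 → q ^ n * d ^ m ≠ 1) (m n : ℤ) :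
    (dsign j i • g q d j i (mulW _) (mulZ _)
        (prodZW (kPlus q d i (phiCoeff q q⁻¹)) (rhoF q d u L j))
      + g q d i j (mulZ _) (mulW _)
        (prodWZ (kPlus q d i (phiCoeff q q⁻¹)) (rhoF q d u L j))) m n = 0 := by
  have h2 := mul_inv_cancel₀ (pow_ne_zero 2 hq)
  rw [rhoF_eq]
  by_cases hij : i = j
  · subst hij
    refine kPlus_relation_swap hq hd hqd (contraction_phi_xi hq)
      ⟨fun _ m => ?_, fun h => absurd rfl h⟩ m n
    have h := ext_oneSub_geom_succ (q2 q) (q2 q)⁻¹ m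
    have h0 : q ^ (2 * -1 : ℤ) = (q2 q)⁻¹ := by
      rw [show (2 * -1 : ℤ) = -(2 : ℕ) by norm_num, zpow_neg, zpow_natCast, q2]
    simp only [eps_mul_self, mul_one, h0]
    change q2 q * (q2 q)⁻¹ = 1 at h2
    generalize ext (oneSub (q2 q) * geom (q2 q)⁻¹) = f at *
    linear_combination -h - f (m + 1) * h2
  · refine kPlus_relation_swap hq hd hqd (contraction_phi_xi_ne hq hd hij)
      ⟨fun h => absurd h hij, fun _ m => ?_⟩ m n
    have h := ext_oneSub_geom_two_succ (q1 q d) (q3 q d) (q1 q d)⁻¹ (q3 q d)⁻¹ m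
    have h1 := mul_inv_cancel₀ (q1_ne_zero hq hd)
    have h3 := mul_inv_cancel₀ (q3_ne_zero hq hd)
    have h0 : q ^ (2 * -1 * -1 : ℤ) = (q1 q d)⁻¹ * (q3 q d)⁻¹ := by
      rw [show (2 * -1 * -1 : ℤ) = (2 : ℕ) by norm_num, zpow_natCast, ← mul_inv]
      exact eq_inv_of_mul_eq_one_left (q2_mul_q1_mul_q3 hq hd)
    simp only [eps_mul_eps_ne hij, h0]
    generalize ext (oneSub (q1 q d) * oneSub (q3 q d) * (geom (q1 q d)⁻¹ * geom (q3 q d)⁻¹)) = f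
      at *
    generalize (q1 q d)⁻¹ = a at *
    generalize (q3 q d)⁻¹ = b at *
    linear_combination -h - (-f (m + 1) * b + f (m + 2) * b * q3 q d) * h1
      - (-f (m + 1) * a + f (m + 2)) * h3

theorem kMinus_rhoF (hq : q ≠ 0) (hd : d ≠ 0)
    (hqd : ∀ n m : ℤ, n ≠ 0 ∨ m ≠ 0 → q ^ n * d ^ m ≠ 1) (m n : ℤ) :
    (dsign j i • g q d j i (mulW _) (mulZ _)
        (prodZW (kMinus q d i (phiCoeff q q⁻¹)) (rhoF q d u L j))
      + g q d i j (mulZ _) (mulW _)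
        (prodWZ (kMinus q d i (phiCoeff q q⁻¹)) (rhoF q d u L j))) m n = 0 := by
  have h2 := mul_inv_cancel₀ (pow_ne_zero 2 hq)
  rw [rhoF_eq]
  by_cases hij : i = j
  · subst hij
    refine kMinus_relation_swap hq hd hqd
      ((contraction_phi_xi hq).symm (oddCoeffs_phi _) oddCoeffs_xi)
      ⟨fun _ m => ?_, fun h => absurd rfl h⟩ m n
    have h := ext_oneSub_geom_neg (q2 q) (q2 q)⁻¹ m
    have h0 : (q ^ (2 * -1 : ℤ))⁻¹ = q2 q := by
      rw [show (2 * -1 : ℤ) = -(2 : ℕ) by norm_num, zpow_neg, zpow_natCast, q2, inv_inv]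
    simp only [eps_mul_self, mul_one, h0]
    change q2 q * (q2 q)⁻¹ = 1 at h2
    generalize ext (oneSub (q2 q) * geom (q2 q)⁻¹) = f at *
    linear_combination -q2 q * h - f (-(m + 1)) * h2
  · refine kMinus_relation_swap hq hd hqd
      ((contraction_phi_xi_ne hq hd hij).symm (oddCoeffs_phi _) oddCoeffs_xi)
      ⟨fun h => absurd h hij, fun _ m => ?_⟩ m n
    have h := ext_oneSub_geom_two_neg (q1 q d) (q3 q d) (q1 q d)⁻¹ (q3 q d)⁻¹ m
    have h1 := mul_inv_cancel₀ (q1_ne_zero hq hd)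
    have h3 := mul_inv_cancel₀ (q3_ne_zero hq hd)
    have h0 : (q ^ (2 * -1 * -1 : ℤ))⁻¹ = q1 q d * q3 q d := by
      rw [show (2 * -1 * -1 : ℤ) = (2 : ℕ) by norm_num, zpow_natCast]
      exact inv_eq_of_mul_eq_one_right (q2_mul_q1_mul_q3 hq hd)
    simp only [eps_mul_eps_ne hij, h0]
    generalize ext (oneSub (q1 q d) * oneSub (q3 q d) * (geom (q1 q d)⁻¹ * geom (q3 q d)⁻¹)) = f
      at *
    generalize (q1 q d)⁻¹ = a at *
    generalize (q3 q d)⁻¹ = b at *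
    linear_combination q1 q d * q3 q d * h + (f (-(m + 1)) * q3 q d
      - f (-(m + 2)) * b * q3 q d) * h1 + (f (-(m + 1)) * q1 q d - f (-(m + 2))) * h3

end

end QToroidal

namespace QToroidal

noncomputable section

variable {q d u L : ℂ} {i j : Fin 2} {c c' : ℤ → ℂ} {t t' : ℤ} {κ κ' : ℂ⟦X⟧}

/-! ## Commutators of `E` and `F` -/

/-- Reversing the coefficients of (1 - ax)(1 - bx) exchanges 1 and ab. -/
theorem ext_oneSub_oneSub_palindromic {a b : ℂ} (hab : a * b = 1) (y : ℤ) :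
    ext (oneSub a * oneSub b) (y + 2) = ext (oneSub a * oneSub b) (-y) := by
  rw [ext_oneSub_oneSub, ext_oneSub_oneSub, ext_one_neg,
    ext_one_congr (a := -y - 1) (b := y + 1) (by omega),
    ext_one_congr (a := -y - 2) (b := y + 2) (by omega), hab,
    show y + 2 - 1 = y + 1 by ring, show y + 2 - 2 = y by ring]
  ring

/-- The contraction is (1 - dx)(1 - d⁻¹x), since q q₁ = d and q q₃ = d⁻¹. The zero modes shift its
degree by exactly 2, so by palindromicity both orders have the same two-point function. -/
theorem rhoE_rhoF_of_ne (hq : q ≠ 0) (hd : d ≠ 0)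
    (hqd : ∀ n m : ℤ, n ≠ 0 ∨ m ≠ 0 → q ^ n * d ^ m ≠ 1) (hij : i ≠ j) (m n : ℤ) :
    rhoE q d u L i m * rhoF q d u L j n - rhoF q d u L j n * rhoE q d u L i m = 0 := by
  rw [rhoE_eq, rhoF_eq]
  refine primaryPairs_eq_zero hq hd hqd (s := weight q d i etaCoeff) (s' := weight q d j (xiCoeff q))
    (Φ := prodZW (vertex q d u L i 1 etaCoeff) (vertex q d u L j (-1) (xiCoeff q))
      - prodWZ (vertex q d u L i 1 etaCoeff) (vertex q d u L j (-1) (xiCoeff q)))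
    (Submodule.sub_mem _ (primary_vertex.prodZW primary_vertex)
      (primary_vertex.prodWZ primary_vertex)) (fun m n k k' => ?_) m n
  rw [Pi.sub_apply, Pi.sub_apply, LinearMap.sub_apply, map_sub,
    vac_vertex_vertex_left (contraction_eta_xi_ne hij),
    vac_vertex_vertex_right ((contraction_eta_xi_ne hij).symm oddCoeffs_eta oddCoeffs_xi)]
  have h : (1 * eps i * (-1 * eps j)) = 1 := by
    rw [one_mul, mul_left_comm, eps_mul_eps_ne hij]; rfl
  rw [h, mul_one, ext_oneSub_oneSub_palindromic, sub_self]
  unfold q1 q3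
  field_simp

theorem sub_inv_ne_zero (hq : q ≠ 0) (hq2 : q ^ 2 ≠ 1) : q - q⁻¹ ≠ 0 := by
  intro h
  apply hq2
  have := congrArg (· * q) h
  simp only [sub_mul, zero_mul, inv_mul_cancel₀ hq] at this
  linear_combination this

/-- The coefficient is the complete homogeneous polynomial in a and b; keeping the factor a - b
avoids division. -/
theorem ext_geom_geom_closed (a b : ℂ) (l : ℕ) :
    (a - b) * ext (geom a * geom b) ((l : ℤ) - 1) = a ^ l - b ^ l := by
  induction l using Nat.strong_induction_on with
  | _ l ih =>
    match l, ih with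
    | 0, _ => rw [ext_neg _ (by simp)]; simp
    | 1, _ =>
      have h := ext_geom_geom a b 0
      rw [ext_neg (l := 0 - 1) _ (by norm_num), ext_neg (l := 0 - 2) _ (by norm_num), ext_one,
        if_pos rfl] at h
      simp only [Nat.cast_one, sub_self, pow_one]
      linear_combination (a - b) * h
    | l + 2, ih =>
      have h := ext_geom_geom a b ((l : ℤ) + 1)
      have h0 := ih l (by omega)
      have h1 := ih (l + 1) (by omega)
      rw [ext_one, if_neg (by omega)] at h
      push_cast at h0 h1 ⊢
      rw [show (l : ℤ) + 1 - 1 = l by ring] at h h1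
      rw [show (l : ℤ) + 1 - 2 = l - 1 by ring] at h
      rw [show (l : ℤ) + 2 - 1 = l + 1 by ring]
      linear_combination (a - b) * h + (a + b) * h1 - a * b * h0

/-- The two opposite expansions of one rational function differ by delta functions at its poles,
seen here as the sequences q^y and q^{-y}. -/
theorem ext_geom_geom_inv_sub (y : ℤ) :
    (q - q⁻¹) * (ext (geom q * geom q⁻¹) (y - 1) - ext (geom q * geom q⁻¹) (-y - 1))
      = q ^ y - q ^ (-y) := by
  have key : ∀ l : ℕ, (q - q⁻¹) * (ext (geom q * geom q⁻¹) ((l : ℤ) - 1)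
      - ext (geom q * geom q⁻¹) (-(l : ℤ) - 1)) = q ^ (l : ℤ) - q ^ (-(l : ℤ)) := by
    intro l
    rw [ext_neg (l := -(l : ℤ) - 1) _ (by omega), sub_zero, ext_geom_geom_closed, zpow_neg,
      zpow_natCast, inv_pow]
  rcases Int.eq_nat_or_neg y with ⟨l, rfl | rfl⟩
  · exact key l
  · have := key l
    rw [neg_neg]
    linear_combination -this

/-- On the support of δ(q w/z) one has w = q⁻¹z, so the weight s z^k + s' w^k becomes (s + q^{-k}
s') z^k. `scaled_kMinus_mem` treats z = q⁻¹w. -/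
theorem scaled_kPlus_mem (w : Fin 2 → ℤ → ℂ) (hq : q ≠ 0) {s s' : Fin 2 → ℤ → ℂ}
    {U : ℤ → Module.End ℂ Fock} (hU : Primary q d w U)
    (h : ∀ j k, k ≠ 0 → w j k = s j k + q ^ (-k) * s' j k) :
    (fun m n => q ^ (-n) • U (m + n)) ∈ primaryPairs q d s s' := by
  intro j k hk m n
  dsimp only
  rw [mul_smul_comm, smul_mul_assoc, ← smul_sub, hU j k hk, h j k hk, add_right_comm m k n,
    ← add_assoc m n k, neg_add, zpow_add₀ hq]
  module

theorem scaled_kMinus_mem (w : Fin 2 → ℤ → ℂ) (hq : q ≠ 0) {s s' : Fin 2 → ℤ → ℂ}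
    {U : ℤ → Module.End ℂ Fock} (hU : Primary q d w U)
    (h : ∀ j k, k ≠ 0 → w j k = q ^ (-k) * s j k + s' j k) :
    (fun m n => q ^ (-m) • U (m + n)) ∈ primaryPairs q d s s' := by
  intro j k hk m n
  dsimp only
  rw [mul_smul_comm, smul_mul_assoc, ← smul_sub, hU j k hk, h j k hk, add_right_comm m k n,
    ← add_assoc m n k, neg_add, zpow_add₀ hq]
  module

/-- At w = q⁻¹z the creation halves (k > 0) of η and ξ cancel, and the annihilation halves combine
to φ^+. In `weight_phi_neg` the halves exchange roles. -/
theorem weight_phi_pos (hq : q ≠ 0) (j : Fin 2) {k : ℤ} (hk : k ≠ 0) :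
    (if k < 0 then weight q d i (phiCoeff q 1) j k else 0)
      = weight q d i etaCoeff j k + q ^ (-k) * weight q d i (xiCoeff q) j k := by
  have hk' : (k : ℂ) ≠ 0 := by exact_mod_cast hk
  simp only [weight, phiCoeff, etaCoeff, xiCoeff, abs_neg, Int.cast_neg, one_zpow, mul_one]
  split_ifs with h
  · rw [abs_of_neg h, q2, ← zpow_natCast q 2, ← zpow_mul, mul_comm ((2 : ℕ) : ℤ) (-k), zpow_mul]
    simp only [zpow_natCast]
    field_simp
    ring
  · rw [abs_of_nonneg (not_lt.1 h), zpow_neg]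
    have := zpow_ne_zero k hq
    field_simp
    ring

theorem weight_phi_neg (hq : q ≠ 0) (j : Fin 2) {k : ℤ} (hk : k ≠ 0) :
    (if 0 < k then weight q d i (phiCoeff q q⁻¹) j k else 0)
      = q ^ (-k) * weight q d i etaCoeff j k + weight q d i (xiCoeff q) j k := by
  have hk' : (k : ℂ) ≠ 0 := by exact_mod_cast hk
  have hz := zpow_ne_zero k hq
  simp only [weight, phiCoeff, etaCoeff, xiCoeff, abs_neg, Int.cast_neg]
  split_ifs with h
  · rw [abs_of_pos h, q2, ← zpow_natCast q 2, ← zpow_mul, mul_comm ((2 : ℕ) : ℤ) k, zpow_mul,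
      inv_zpow, zpow_neg]
    simp only [zpow_natCast]
    field_simp
    ring
  · rw [abs_of_nonpos (not_lt.1 h), zpow_neg]
    field_simp
    ring

theorem vac_kPlus_ket (m k k' : ℤ) : vac k' (kPlus q d i c m (ket k))
    = if m = 0 then if k = k' then q ^ (eps i * k) else 0 else 0 := by
  rw [kPlus, Module.End.mul_apply, diag_ket, map_smul, ann_ket]
  split_ifs with h1 h2 <;> simp [vac_ket, *]

theorem vac_kMinus_ket (m k k' : ℤ) : vac k' (kMinus q d i c m (ket k))
    = if m = 0 then if k = k' then q ^ (-(eps i * k)) else 0 else 0 := by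
  rw [kMinus, Module.End.mul_apply, diag_ket, map_smul, map_smul, vac_cre, vac_ket]
  split_ifs with h1 h2 h3 <;> simp_all

/-- Both sides have the same weights. On |k,u⟩ the two orders of the product differ by (q^y -
q^{-y})/(q - q⁻¹) with y = m + eps_i k, and the two terms are the contributions of K^+ and K^-. -/
theorem rhoE_rhoF_same (hq : q ≠ 0) (hd : d ≠ 0)
    (hqd : ∀ n m : ℤ, n ≠ 0 ∨ m ≠ 0 → q ^ n * d ^ m ≠ 1) (m n : ℤ) :
    rhoE q d u L i m * rhoF q d u L i n - rhoF q d u L i n * rhoE q d u L i m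
      = (q - q⁻¹)⁻¹ • (q ^ (-n) • kPlus q d i (phiCoeff q 1) (m + n)
        - q ^ (-m) • kMinus q d i (phiCoeff q q⁻¹) (m + n)) := by
  have hq2 : q - q⁻¹ ≠ 0 := sub_inv_ne_zero hq (by simpa using hqd 2 0 (Or.inl two_ne_zero))
  rw [rhoE_eq, rhoF_eq, ← sub_eq_zero]
  refine primaryPairs_eq_zero hq hd hqd (s := weight q d i etaCoeff) (s' := weight q d i (xiCoeff q))
    (Φ := prodZW (vertex q d u L i 1 etaCoeff) (vertex q d u L i (-1) (xiCoeff q))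
      - prodWZ (vertex q d u L i 1 etaCoeff) (vertex q d u L i (-1) (xiCoeff q))
      - (q - q⁻¹)⁻¹ • ((fun m n => q ^ (-n) • kPlus q d i (phiCoeff q 1) (m + n))
        - fun m n => q ^ (-m) • kMinus q d i (phiCoeff q q⁻¹) (m + n)))
    (Submodule.sub_mem _ (Submodule.sub_mem _ (primary_vertex.prodZW primary_vertex)
      (primary_vertex.prodWZ primary_vertex)) (Submodule.smul_mem _ _ (Submodule.sub_mem _
        (scaled_kPlus_mem _ hq primary_kPlus fun j k hk => weight_phi_pos hq j hk)
        (scaled_kMinus_mem _ hq primary_kMinus fun j k hk => weight_phi_neg hq j hk))))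
    (fun m n k k' => ?_) m n
  simp only [Pi.sub_apply, Pi.smul_apply, LinearMap.sub_apply, LinearMap.smul_apply, map_sub,
    map_smul, smul_eq_mul]
  rw [vac_vertex_vertex_left (contraction_eta_xi hq),
    vac_vertex_vertex_right ((contraction_eta_xi hq).symm oddCoeffs_eta oddCoeffs_xi),
    vac_kPlus_ket, vac_kMinus_ket]
  have h1 : (1 * eps i * (-1 * eps i)) = -1 := by
    rw [one_mul, mul_left_comm, eps_mul_self]; rfl
  have h2 : m + n + (1 * eps i * k + -1 * eps i * k + 2 * -1 + 2) = m + n := by ring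
  have h3 : k + 2 * -1 * eps i + 2 * 1 * eps i = k := by ring
  rw [h1, h2, h3]
  by_cases hmn : m + n = 0
  · obtain rfl : n = -m := by omega
    by_cases hk : k = k'
    · have h := ext_geom_geom_inv_sub (q := q) (m + eps i * k)
      -- The factors q₁^{±𝖺₀} of E and F cancel.
      have hA := exp_mul_exp_neg (u * L)
      rw [if_pos hmn, if_pos hmn, if_pos hmn, if_pos hmn, if_pos hk, if_pos hk, if_pos hk,
        show m + (1 * eps i * k + 1) + 2 * -1 = m + eps i * k - 1 by ring,
        show -(m + (1 * eps i * k + 1)) = -(m + eps i * k) - 1 by ring, neg_neg,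
        ← zpow_add₀ hq, ← zpow_add₀ hq, ← neg_add, ← h]
      push_cast
      rw [one_mul, neg_one_mul, neg_mul, hA, one_mul, one_mul, inv_mul_cancel_left₀ hq2, sub_self]
    · simp [hk]
  · simp [hmn]

/-! ## Relations between the Cartan currents -/

theorem diag_commute_ann (f : ℤ → ℂ) (m : ℤ) : Commute (diag f) (ann q d i c m) :=
  commute_ann (fun k _ => alpha_commute_diag q d i k f) m

theorem diag_commute_cre (f : ℤ → ℂ) (m : ℤ) : Commute (diag f) (cre q d i c m) :=
  commute_cre (fun k _ => alpha_commute_diag q d i k f) m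

theorem kPlus_commute (m n : ℤ) : Commute (kPlus q d i c m) (kPlus q d j c' n) := by
  have h : Commute (ann q d i c m) (ann q d j c' n) := commute_ann (fun k hk =>
    (commute_ann (fun l hl => alpha_commute q d j i (by omega)) m).symm) n
  exact (h.mul_right (diag_commute_ann _ m).symm).mul_left
    ((diag_commute_ann _ n).mul_right (diag_comm _ _))

theorem kMinus_commute (m n : ℤ) : Commute (kMinus q d i c m) (kMinus q d j c' n) := by
  have h : Commute (cre q d i c (-m)) (cre q d j c' (-n)) := commute_cre (fun k hk =>
    (commute_cre (fun l hl => alpha_commute q d j i (by omega)) _).symm) _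
  exact (h.mul_right (diag_commute_cre _ _).symm).mul_left
    ((diag_commute_cre _ _).mul_right (diag_comm _ _))

/-- Full operator identity; the sum stops at min(a, b) because exponentials have no negative
degrees. -/
theorem ann_cre (h : IsContraction q d j c i c' κ) (a b : ℕ) :
    ann q d j c b * cre q d i c' a = ∑ l ∈ Finset.range (min a b + 1),
      PowerSeries.coeff l κ • (cre q d i c' (a - l) * ann q d j c (b - l)) := by
  refine LinearMap.ext fun y => ?_
  have h1 := ann_primary (i := j) (c := c) (primary_cre (q := q) (d := d) (i := i) (c := c'))
    (κ := κ) (IsExp.congr h fun k hk => by rw [if_pos (by omega)]) b (-a) y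
  rw [neg_neg] at h1
  rw [Module.End.mul_apply, h1, Finset.Nat.sum_antidiagonal_eq_sum_range_succ_mk,
    LinearMap.sum_apply]
  symm
  refine (Finset.sum_subset (Finset.range_mono (by omega : min a b + 1 ≤ b + 1))
    fun l hl hl' => ?_).trans (Finset.sum_congr rfl fun l hl => ?_)
  · rw [Finset.mem_range] at hl hl'
    rw [cre_neg (by omega), zero_mul, smul_zero, LinearMap.zero_apply]
  · rw [Finset.mem_range] at hl
    rw [LinearMap.smul_apply, Module.End.mul_apply, Nat.cast_sub (by omega)]
    congr 4
    ring

theorem kPlus_kMinus (h : IsContraction q d j c i c' κ) (a b : ℕ) :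
    kPlus q d j c b * kMinus q d i c' (-a) = ∑ l ∈ Finset.range (min a b + 1),
      PowerSeries.coeff l κ • (kMinus q d i c' (-(a - l)) * kPlus q d j c (b - l)) := by
  have hc : ∀ (A B : Module.End ℂ Fock) (f f' : ℤ → ℂ), Commute (diag f) B →
      A * diag f * (B * diag f') = A * B * (diag f * diag f') := fun A B f f' h => by
    rw [mul_assoc, ← mul_assoc (diag f), h.eq, mul_assoc, mul_assoc]
  simp only [kPlus, kMinus, neg_neg]
  rw [hc _ _ _ _ (diag_commute_cre _ _), ann_cre h, Finset.sum_mul]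
  refine Finset.sum_congr rfl fun l _ => ?_
  rw [hc _ _ _ _ (diag_commute_ann _ _), smul_mul_assoc, diag_comm]

/-- Reordering the right-hand products convolves `mu` with κ, and `mu * κ` is `lam`. -/
theorem mixed_relation {κ lam mu : ℂ⟦X⟧} (hlam : lam = mu * κ) (h : IsContraction q d j c i c' κ)
    (a b : ℕ) :
    ∑ k ∈ Finset.range (min a b + 1), PowerSeries.coeff k lam •
        (kMinus q d i c' (-(a - k)) * kPlus q d j c (b - k))
      = ∑ k ∈ Finset.range (min a b + 1), PowerSeries.coeff k mu •
        (kPlus q d j c (b - k) * kMinus q d i c' (-(a - k))) := by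
  have e : ∀ k ∈ Finset.range (min a b + 1), PowerSeries.coeff k mu •
        (kPlus q d j c (b - k) * kMinus q d i c' (-(a - k)))
      = ∑ l ∈ Finset.range (min a b + 1 - k),
        (PowerSeries.coeff k mu * PowerSeries.coeff l κ) •
          (kMinus q d i c' (-(a - ((k + l : ℕ) : ℤ))) *
            kPlus q d j c (b - ((k + l : ℕ) : ℤ))) := by
    intro k hk
    rw [Finset.mem_range] at hk
    rw [← Nat.cast_sub (by omega), ← Nat.cast_sub (by omega), kPlus_kMinus h, Finset.smul_sum,
      show min (a - k) (b - k) + 1 = min a b + 1 - k by omega]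
    refine Finset.sum_congr rfl fun l hl => ?_
    rw [smul_smul, Nat.cast_sub (by omega), Nat.cast_sub (by omega), Nat.cast_add, sub_sub,
      sub_sub]
  rw [Finset.sum_congr rfl e, ← Finset.sum_range_diag_flip (min a b + 1) fun k l =>
    (PowerSeries.coeff k mu * PowerSeries.coeff l κ) •
          (kMinus q d i c' (-(a - ((k + l : ℕ) : ℤ))) *
            kPlus q d j c (b - ((k + l : ℕ) : ℤ)))]
  refine Finset.sum_congr rfl fun m _ => ?_
  rw [hlam, PowerSeries.coeff_mul, Finset.Nat.sum_antidiagonal_eq_sum_range_succ_mk,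
    Finset.sum_smul]
  refine Finset.sum_congr rfl fun k hk => ?_
  rw [Finset.mem_range] at hk
  rw [show k + (m - k) = m by omega]

end

end QToroidal

namespace QToroidal

noncomputable section

/-! ## The scalar identity behind the Serre relations -/

section Identity

/-- The sum of the values of `f` at the six orderings of the three indices. -/
def symSum {M : Type} [AddCommMonoid M] (f : Fin 3 → Fin 3 → Fin 3 → M) : M :=
  f 0 1 2 + f 0 2 1 + f 1 0 2 + f 1 2 0 + f 2 0 1 + f 2 1 0

theorem sum_perm_fin_three {M : Type} [AddCommMonoid M] (f : Fin 3 → Fin 3 → Fin 3 → M) :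
    ∑ σ : Equiv.Perm (Fin 3), f (σ 0) (σ 1) (σ 2) = symSum f := by
  rw [← Equiv.sum_comp Equiv.Perm.decomposeFin.symm, Fintype.sum_prod_type, Fin.sum_univ_three]
  have h : ∀ g : Equiv.Perm (Fin 2) → M, ∑ σ, g σ = g 1 + g (Equiv.swap 0 1) := by
    intro g
    rw [show (Finset.univ : Finset (Equiv.Perm (Fin 2))) = {1, Equiv.swap 0 1} by decide,
      Finset.sum_pair (by decide)]
  rw [h, h, h, symSum]
  have e : ∀ (p : Fin 3) (σ : Equiv.Perm (Fin 2)) (a b c : Fin 3),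
      (Equiv.Perm.decomposeFin.symm (p, σ) 0 = a ∧ Equiv.Perm.decomposeFin.symm (p, σ) 1 = b ∧
        Equiv.Perm.decomposeFin.symm (p, σ) 2 = c) →
      f (Equiv.Perm.decomposeFin.symm (p, σ) 0) (Equiv.Perm.decomposeFin.symm (p, σ) 1)
        (Equiv.Perm.decomposeFin.symm (p, σ) 2) = f a b c := by
    rintro p σ a b c ⟨rfl, rfl, rfl⟩
    rfl
  rw [e 0 1 0 1 2 (by decide), e 0 (Equiv.swap 0 1) 0 2 1 (by decide), e 1 1 1 0 2 (by decide),
    e 1 (Equiv.swap 0 1) 1 2 0 (by decide), e 2 1 2 1 0 (by decide),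
    e 2 (Equiv.swap 0 1) 2 0 1 (by decide)]
  abel

variable {R : Type} [CommRing R]

/-- `∏ (x_i - x_j)(x_i - t x_j)`, over the pairs `i < j`. -/
def pairPoly (t x y z : R) : R :=
  (x - y) * (x - t * y) * ((x - z) * (x - t * z)) * ((y - z) * (y - t * z))

/-- `1 - s x + t x²`. -/
def befPoly (s t x : R) : R := 1 - s * x + t * x ^ 2

/-- `x² - s x + t`. -/
def aftPoly (s t x : R) : R := x ^ 2 - s * x + t

/-- `∏ (x_i - t x_j)`, over the pairs `i < j`. -/
def halfPairPoly (t x y z : R) : R := (x - t * y) * (x - t * z) * (y - t * z)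

/-- The alternating sum over the orderings of `x`, `y`, `z`. -/
def altSum (f : R → R → R → R) (x y z : R) : R :=
  f x y z - f x z y - f y x z + f y z x + f z x y - f z y x

theorem serre_identity_alternating (s t x y z : R) :
    t * altSum (fun x y z => halfPairPoly t x y z * (befPoly s t x * befPoly s t y * befPoly s t z
        - aftPoly s t x * aftPoly s t y * aftPoly s t z)) x y z
    + (t ^ 2 + t + 1) * altSum (fun x y z => halfPairPoly t x y z *
        (befPoly s t x * aftPoly s t y * aftPoly s t z
          - befPoly s t x * befPoly s t y * aftPoly s t z)) x y z = 0 := by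
  simp only [altSum, halfPairPoly, befPoly, aftPoly]
  ring

/-- `pairPoly` is the Vandermonde product times `halfPairPoly`, and the former changes sign under
transpositions. Factoring it out turns the symmetric sum into the alternating sums of the preceding
unconditional identity, whose coefficient t² + t + 1 is t c. -/
theorem serre_identity {s t c : R} (hc : t * c = t ^ 2 + t + 1) (x : Fin 3 → R) :
    t * symSum (fun i j k => pairPoly t (x i) (x j) (x k) *
      (befPoly s t (x i) * befPoly s t (x j) * befPoly s t (x k)
        - c * (befPoly s t (x i) * befPoly s t (x j) * aftPoly s t (x k))
        + c * (befPoly s t (x i) * aftPoly s t (x j) * aftPoly s t (x k))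
        - aftPoly s t (x i) * aftPoly s t (x j) * aftPoly s t (x k))) = 0 := by
  have h := serre_identity_alternating s t (x 0) (x 1) (x 2)
  have hp : ∀ x y z : R, pairPoly t x y z
      = (x - y) * (x - z) * (y - z) * halfPairPoly t x y z := fun x y z => by
    unfold pairPoly halfPairPoly
    ring
  rw [← hc] at h
  simp only [symSum, altSum, hp] at h ⊢
  generalize halfPairPoly t = H at *
  generalize befPoly s t = B at *
  generalize aftPoly s t = A at *
  linear_combination ((x 0 - x 1) * (x 0 - x 2) * (x 1 - x 2)) * h

end Identity

/-! ## Symmetrised continuation of the two-point functions -/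

/-- A symmetric function of `x` that the difference operator `1 - (a+b) Z + a b Z²` sends to the
expansion of `1 / ((1 - a x)(1 - b x))`. -/
def theta (a b : ℂ) (x : ℤ) : ℂ :=
  a / ((a - b) * (1 - a ^ 2) * (1 - a * b)) * a ^ x.natAbs
    + b / ((b - a) * (1 - b ^ 2) * (1 - a * b)) * b ^ x.natAbs

theorem theta_neg (a b : ℂ) (x : ℤ) : theta a b (-x) = theta a b x := by
  rw [theta, Int.natAbs_neg, theta]

/-- For x ≥ 0 the operator multiplies a^x by (1 - a²)(1 - ab), and for x ≤ -2 it kills a^{|x|};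
likewise for b. The denominators in `theta` cancel these factors, leaving the closed form of the
coefficients. -/
theorem theta_recurrence {a b : ℂ} (hab : a ≠ b) (ha : a ^ 2 ≠ 1) (hb : b ^ 2 ≠ 1)
    (h1 : a * b ≠ 1) (x : ℤ) :
    theta a b x - (a + b) * theta a b (x + 1) + a * b * theta a b (x + 2)
      = ext (geom a * geom b) x := by
  have hab' : a - b ≠ 0 := sub_ne_zero.2 hab
  have hba' : b - a ≠ 0 := sub_ne_zero.2 hab.symm
  have ha' : 1 - a ^ 2 ≠ 0 := sub_ne_zero.2 ha.symm
  have hb' : 1 - b ^ 2 ≠ 0 := sub_ne_zero.2 hb.symm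
  have h1' : 1 - a * b ≠ 0 := sub_ne_zero.2 h1.symm
  have key : ∀ f : ℂ, (a - b) * (theta a b x - (a + b) * theta a b (x + 1)
      + a * b * theta a b (x + 2)) = (a - b) * f →
      theta a b x - (a + b) * theta a b (x + 1) + a * b * theta a b (x + 2) = f :=
    fun f h => mul_left_cancel₀ hab' h
  apply key
  have hB : b / ((b - a) * (1 - b ^ 2) * (1 - a * b))
      = -(b / ((a - b) * (1 - b ^ 2) * (1 - a * b))) := by
    rw [← neg_sub a b, neg_mul, neg_mul, div_neg]
  unfold theta
  rw [hB]
  rcases lt_trichotomy x (-1) with h | rfl | h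
  · obtain ⟨n, rfl⟩ : ∃ n : ℕ, x = -(n + 2 : ℕ) := ⟨(-x - 2).toNat, by omega⟩
    rw [ext_neg _ (by omega), show (-((n + 2 : ℕ) : ℤ)).natAbs = n + 2 by omega,
      show (-((n + 2 : ℕ) : ℤ) + 1).natAbs = n + 1 by omega,
      show (-((n + 2 : ℕ) : ℤ) + 2).natAbs = n by omega]
    ring
  -- At x = -1 the window -1, 0, 1 straddles the kink of |x|; the value vanishes only because the
  -- a-term and the b-term of `theta` cancel.
  · rw [ext_neg _ (by omega)]
    simp only [Int.reduceNeg, Int.natAbs_neg, Int.natAbs_one, pow_one, Int.reduceAdd, Int.natAbs_zero,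
      pow_zero]
    field_simp
    ring
  · obtain ⟨n, rfl⟩ : ∃ n : ℕ, x = n := ⟨x.toNat, by omega⟩
    have h2 := ext_geom_geom_closed a b (n + 1)
    rw [Nat.cast_succ, add_sub_cancel_right] at h2
    rw [h2, show (n : ℤ).natAbs = n by omega, show ((n : ℤ) + 1).natAbs = n + 1 by omega,
      show ((n : ℤ) + 2).natAbs = n + 2 by omega]
    field_simp
    ring

end

end QToroidal

namespace QToroidal

noncomputable section

variable {q d u L : ℂ} {i j : Fin 2} {c : ℤ → ℂ} {t : ℤ} {κ κs κf : ℂ⟦X⟧}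

/-! ## Vacuum expectations of words of length four -/

/-- The contraction is a polynomial of degree at most 2, so the exchange sum has three terms,
uniformly for all l ∈ ℤ. -/
theorem ann_primary_poly {s : Fin 2 → ℤ → ℂ} {U : ℤ → Module.End ℂ Fock} (hU : Primary q d s U)
    (hκ : IsExp (fun k : ℕ => c k * s i k) fun n => PowerSeries.coeff n κ)
    (h3 : ∀ n, 3 ≤ n → PowerSeries.coeff n κ = 0) (l m : ℤ) (y : Fock) :
    ann q d i c l (U m y)
      = ∑ a ∈ Finset.range 3, PowerSeries.coeff a κ • U (m + a) (ann q d i c (l - a) y) := by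
  rcases lt_or_ge l 0 with h | h
  · rw [ann_neg h, LinearMap.zero_apply, Finset.sum_eq_zero]
    intro a _
    rw [ann_neg (by omega), LinearMap.zero_apply, map_zero, smul_zero]
  · lift l to ℕ using h
    rw [ann_primary hU hκ, Finset.Nat.sum_antidiagonal_eq_sum_range_succ_mk]
    have e1 : ∑ a ∈ Finset.range (l + 1),
          PowerSeries.coeff a κ • U (m + a) (ann q d i c ((l - a : ℕ) : ℤ) y)
        = ∑ a ∈ Finset.range (l + 1),
          PowerSeries.coeff a κ • U (m + a) (ann q d i c (l - a) y) := by
      refine Finset.sum_congr rfl fun a ha => ?_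
      rw [Finset.mem_range] at ha
      rw [Nat.cast_sub (by omega)]
    refine e1.trans ?_
    rw [Finset.sum_subset (Finset.range_mono (le_max_left (l + 1) 3)),
      ← Finset.sum_subset (Finset.range_mono (le_max_right (l + 1) 3))]
    · intro a _ ha
      rw [h3 a (by simpa using ha), zero_smul]
    · intro a _ ha
      rw [Finset.mem_range] at ha
      rw [ann_neg (by omega), LinearMap.zero_apply, map_zero, smul_zero]

theorem primary_cre_poly {s : Fin 2 → ℤ → ℂ} {U : ℤ → Module.End ℂ Fock} (hU : Primary q d s U)
    (hκ : IsExp (fun k : ℕ => -(c (-k) * s i (-k))) fun n => PowerSeries.coeff n κ)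
    (h3 : ∀ n, 3 ≤ n → PowerSeries.coeff n κ = 0) (r m : ℤ) (y : Fock) :
    U m (cre q d i c r y)
      = ∑ a ∈ Finset.range 3, PowerSeries.coeff a κ • cre q d i c (r - a) (U (m - a) y) := by
  rcases lt_or_ge r 0 with h | h
  · rw [cre_neg h, LinearMap.zero_apply, map_zero, Finset.sum_eq_zero]
    intro a _
    rw [cre_neg (by omega), LinearMap.zero_apply, smul_zero]
  · lift r to ℕ using h
    rw [primary_cre_mul hU hκ, Finset.Nat.sum_antidiagonal_eq_sum_range_succ_mk]
    have e1 : ∑ a ∈ Finset.range (r + 1),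
          PowerSeries.coeff a κ • cre q d i c ((r - a : ℕ) : ℤ) (U (m - a) y)
        = ∑ a ∈ Finset.range (r + 1),
          PowerSeries.coeff a κ • cre q d i c (r - a) (U (m - a) y) := by
      refine Finset.sum_congr rfl fun a ha => ?_
      rw [Finset.mem_range] at ha
      rw [Nat.cast_sub (by omega)]
    refine e1.trans ?_
    rw [Finset.sum_subset (Finset.range_mono (le_max_left (r + 1) 3)),
      ← Finset.sum_subset (Finset.range_mono (le_max_right (r + 1) 3))]
    · intro a _ ha
      rw [h3 a (by simpa using ha), zero_smul]
    · intro a _ ha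
      rw [Finset.mem_range] at ha
      rw [cre_neg (by omega), LinearMap.zero_apply, smul_zero]

/-- If `ann l y` is a finite sum of vectors of known degrees, so is `ann l (U m y)`. -/
theorem ann_primary_of {ι : Type} {s : Fin 2 → ℤ → ℂ} {U : ℤ → Module.End ℂ Fock}
    (hU : Primary q d s U)
    (hκ : IsExp (fun k : ℕ => c k * s i k) fun n => PowerSeries.coeff n κ)
    {y : Fock} {S : Finset ι} {w : ι → ℕ} {Y : ι → Fock}
    (hy : ∀ l : ℤ, ann q d i c l y = ∑ b ∈ S, if l = w b then Y b else 0) (l m : ℤ) :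
    ann q d i c l (U m y) = ∑ b ∈ S, ext κ (l - w b) • U (m + (l - w b)) (Y b) := by
  rcases lt_or_ge l 0 with h | h
  · rw [ann_neg h, LinearMap.zero_apply, Finset.sum_eq_zero]
    intro b _
    rw [ext_neg _ (by omega), zero_smul]
  · lift l to ℕ using h
    rw [ann_primary hU hκ]
    simp only [hy, map_sum, Finset.smul_sum]
    rw [Finset.sum_comm]
    refine Finset.sum_congr rfl fun b _ => ?_
    rcases lt_or_ge l (w b) with hb | hb
    · rw [ext_neg _ (by omega), zero_smul, Finset.sum_eq_zero]
      intro p hp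
      rw [Finset.HasAntidiagonal.mem_antidiagonal] at hp
      rw [if_neg (by omega), map_zero, smul_zero]
    · rw [Finset.sum_eq_single (l - w b, w b)]
      · rw [if_pos rfl, ← Nat.cast_sub hb, ext_natCast]
      · intro p hp hne
        rw [Finset.HasAntidiagonal.mem_antidiagonal] at hp
        rw [if_neg, map_zero, smul_zero]
        intro h
        apply hne
        ext <;> dsimp only <;> omega
      · intro hp
        exact absurd (by rw [Finset.HasAntidiagonal.mem_antidiagonal]; omega) hp

/-- The hypotheses on the exponents of two vertex operators of opposite charges under which the
expectations of words are computed. -/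
structure SerrePair (q d : ℂ) (i j : Fin 2) (c : ℤ → ℂ) (t : ℤ) (κs κf : ℂ⟦X⟧) : Prop where
  ne : i ≠ j
  sq : t ^ 2 = 1
  same : IsContraction q d i c i c κs
  left : IsContraction q d i c j c κf
  right : IsContraction q d j c i c κf
  poly : ∀ n, 3 ≤ n → PowerSeries.coeff n κs = 0

local notation "U" => vertex q d u L i t c
local notation "D" => vertex q d u L j t c
local notation "X" => Complex.exp (t * u * L)

theorem vac_vertex_sq (ht : t ^ 2 = 1) (m k' : ℤ) (y : Fock) : vac k' (vertex q d u L i t c m y)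
    = X * vac (k' - 2 * t * eps i) (ann q d i c (m + t * eps i * k' - 1) y) := by
  rw [vac_vertex, ht]
  congr 3
  ring_nf


theorem ann_opposite_ket (h : SerrePair q d i j c t κs κf) (l n k : ℤ) :
    ann q d i c l (D n (ket k)) = ext κf l • D (n + l) (ket k) :=
  ann_primary_ket primary_vertex h.left.left l n k

theorem ann_same_ket (h : SerrePair q d i j c t κs κf) (l m k : ℤ) :
    ann q d i c l (U m (ket k)) = ∑ a ∈ Finset.range 3,
      if l = a then PowerSeries.coeff a κs • U (m + a) (ket k) else 0 := by
  rw [ann_primary_poly primary_vertex h.same.left h.poly]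
  refine Finset.sum_congr rfl fun a _ => ?_
  rw [ann_ket]
  simp only [sub_eq_zero]
  split_ifs <;> simp

theorem ann_same (h : SerrePair q d i j c t κs κf) (l m : ℤ) (y : Fock) : ann q d i c l (U m y)
    = ∑ a ∈ Finset.range 3, PowerSeries.coeff a κs • U (m + a) (ann q d i c (l - a) y) :=
  ann_primary_poly primary_vertex h.same.left h.poly l m y

theorem ann_same_same_ket (h : SerrePair q d i j c t κs κf) (l m m' k : ℤ) :
    ann q d i c l (U m (U m' (ket k))) = ∑ p ∈ Finset.range 3 ×ˢ Finset.range 3,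
      if l = (p.1 + p.2 : ℕ) then
        (PowerSeries.coeff p.1 κs * PowerSeries.coeff p.2 κs) • U (m + p.1) (U (m' + p.2) (ket k))
      else 0 := by
  rw [ann_same h, Finset.sum_product]
  refine Finset.sum_congr rfl fun a _ => ?_
  rw [ann_same_ket h, map_sum, Finset.smul_sum]
  refine Finset.sum_congr rfl fun b _ => ?_
  dsimp only
  by_cases hl : l = ((a + b : ℕ) : ℤ)
  · rw [if_pos hl, if_pos (by push_cast at hl; omega), map_smul, smul_smul]
  · rw [if_neg hl, if_neg (by push_cast at hl; omega), map_zero, smul_zero]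

/-- The expectation of a word in the operators of one kind around one operator of the other kind. -/
theorem vac_opposite_ket (n k k' : ℤ) : vac k' (D n (ket k))
    = if k + 2 * t * eps j = k' ∧ n + t * eps j * k + 1 = 0 then X else 0 := by
  rw [vertex_ket, map_smul, vac_cre, vac_ket, smul_eq_mul]
  have e : -(n + t * eps j * k + 1) = 0 ↔ n + t * eps j * k + 1 = 0 := neg_eq_zero
  simp only [e]
  split_ifs <;> simp_all

/-- In this and the following reductions a leftmost U is removed through its annihilation half,
which moves right. If D is leftmost, the rightmost U is removed through its creation half, which
moves left. -/
theorem vac_UD (h : SerrePair q d i j c t κs κf) (m n k k' : ℤ) :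
    vac k' (U m (D n (ket k)))
    = X * (ext κf (m + t * eps i * k' - 1) *
      vac (k' - 2 * t * eps i) (D (n + (m + t * eps i * k' - 1)) (ket k))) := by
  rw [vac_vertex_sq h.sq, ann_opposite_ket h, map_smul, smul_eq_mul]

theorem vac_DU (h : SerrePair q d i j c t κs κf) (m n k k' : ℤ) :
    vac k' (D n (U m (ket k)))
    = X * (ext κf (-(m + t * eps i * k + 1)) *
      vac k' (D (n + (m + t * eps i * k + 1)) (ket (k + 2 * t * eps i)))) := by
  rw [vertex_ket (i := i), map_smul, map_smul, vac_primary_cre primary_vertex h.right.right,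
    smul_eq_mul, sub_neg_eq_add]

theorem vac_UUD (h : SerrePair q d i j c t κs κf) (m m' n k k' : ℤ) :
    vac k' (U m (U m' (D n (ket k))))
    = X * ∑ a ∈ Finset.range 3, PowerSeries.coeff a κs * (ext κf (m + t * eps i * k' - 1 - a) *
      vac (k' - 2 * t * eps i) (U (m' + a) (D (n + (m + t * eps i * k' - 1 - a)) (ket k)))) := by
  rw [vac_vertex_sq h.sq, ann_same h, map_sum]
  simp only [ann_opposite_ket h, map_smul, smul_eq_mul]

theorem vac_UDU (h : SerrePair q d i j c t κs κf) (m m' n k k' : ℤ) :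
    vac k' (U m (D n (U m' (ket k))))
    = X * ∑ a ∈ Finset.range 3, PowerSeries.coeff a κs * (ext κf (m + t * eps i * k' - 1 - a) *
      vac (k' - 2 * t * eps i) (D (n + (m + t * eps i * k' - 1 - a)) (U (m' + a) (ket k)))) := by
  rw [vac_vertex_sq h.sq, ann_primary_of primary_vertex h.left.left
    (fun l => ann_same_ket h l m' k), map_sum]
  simp only [map_smul, smul_eq_mul]
  congr 1
  exact Finset.sum_congr rfl fun a _ => by ring

theorem vac_DUU (h : SerrePair q d i j c t κs κf) (m m' n k k' : ℤ) :
    vac k' (D n (U m (U m' (ket k))))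
    = X * ∑ a ∈ Finset.range 3, PowerSeries.coeff a κs * (ext κf (-(m' + t * eps i * k + 1) - a) *
      vac k' (D (n + (m' + t * eps i * k + 1) + a) (U (m - a) (ket (k + 2 * t * eps i))))) := by
  rw [vertex_ket (i := i) m' k, map_smul, map_smul, map_smul,
    primary_cre_poly primary_vertex h.same.right h.poly, map_sum, map_sum, smul_eq_mul]
  congr 1
  refine Finset.sum_congr rfl fun a _ => ?_
  rw [map_smul, map_smul, vac_primary_cre primary_vertex h.right.right, smul_eq_mul,
    show n - (-(m' + t * eps i * k + 1) - a) = n + (m' + t * eps i * k + 1) + a by ring]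

theorem vac_UUUD (h : SerrePair q d i j c t κs κf) (m m' m'' n k k' : ℤ) :
    vac k' (U m (U m' (U m'' (D n (ket k)))))
    = X * ∑ a ∈ Finset.range 3, ∑ b ∈ Finset.range 3, PowerSeries.coeff a κs * PowerSeries.coeff b κs *
      (ext κf (m + t * eps i * k' - 1 - a - b) * vac (k' - 2 * t * eps i)
        (U (m' + a) (U (m'' + b) (D (n + (m + t * eps i * k' - 1 - a - b)) (ket k))))) := by
  rw [vac_vertex_sq h.sq, ann_same h, map_sum]
  congr 1
  refine Finset.sum_congr rfl fun a _ => ?_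
  rw [ann_same h, map_sum, map_smul, map_sum, smul_eq_mul, Finset.mul_sum]
  refine Finset.sum_congr rfl fun b _ => ?_
  simp only [ann_opposite_ket h, map_smul, smul_eq_mul]
  ring

theorem vac_UUDU (h : SerrePair q d i j c t κs κf) (m m' m'' n k k' : ℤ) :
    vac k' (U m (U m' (D n (U m'' (ket k)))))
    = X * ∑ a ∈ Finset.range 3, ∑ b ∈ Finset.range 3, PowerSeries.coeff a κs * PowerSeries.coeff b κs *
      (ext κf (m + t * eps i * k' - 1 - a - b) * vac (k' - 2 * t * eps i)
        (U (m' + a) (D (n + (m + t * eps i * k' - 1 - a - b)) (U (m'' + b) (ket k))))) := by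
  rw [vac_vertex_sq h.sq, ann_same h, map_sum]
  congr 1
  refine Finset.sum_congr rfl fun a _ => ?_
  rw [ann_primary_of primary_vertex h.left.left (fun l => ann_same_ket h l m'' k), map_sum,
    map_smul, map_sum, smul_eq_mul, Finset.mul_sum]
  refine Finset.sum_congr rfl fun b _ => ?_
  simp only [map_smul, smul_eq_mul]
  ring

theorem vac_UDUU (h : SerrePair q d i j c t κs κf) (m m' m'' n k k' : ℤ) :
    vac k' (U m (D n (U m' (U m'' (ket k)))))
    = X * ∑ a ∈ Finset.range 3, ∑ b ∈ Finset.range 3, PowerSeries.coeff a κs * PowerSeries.coeff b κs *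
      (ext κf (m + t * eps i * k' - 1 - a - b) * vac (k' - 2 * t * eps i)
        (D (n + (m + t * eps i * k' - 1 - a - b)) (U (m' + a) (U (m'' + b) (ket k))))) := by
  rw [vac_vertex_sq h.sq, ann_primary_of primary_vertex h.left.left
    (fun l => ann_same_same_ket h l m' m'' k), map_sum, Finset.sum_product]
  congr 1
  refine Finset.sum_congr rfl fun a _ => Finset.sum_congr rfl fun b _ => ?_
  simp only [map_smul, smul_eq_mul, Nat.cast_add, sub_sub]
  ring_nf

theorem vac_DUUU (h : SerrePair q d i j c t κs κf) (m m' m'' n k k' : ℤ) :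
    vac k' (D n (U m (U m' (U m'' (ket k)))))
    = X * ∑ b ∈ Finset.range 3, ∑ a ∈ Finset.range 3, PowerSeries.coeff b κs * PowerSeries.coeff a κs *
      (ext κf (-(m'' + t * eps i * k + 1) - b - a) *
      vac k' (D (n + (m'' + t * eps i * k + 1) + b + a)
        (U (m - a) (U (m' - b) (ket (k + 2 * t * eps i)))))) := by
  rw [vertex_ket (i := i) m'' k, map_smul, map_smul, map_smul, map_smul,
    primary_cre_poly primary_vertex h.same.right h.poly, map_sum, map_sum, map_sum, smul_eq_mul]
  congr 1
  refine Finset.sum_congr rfl fun b _ => ?_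
  rw [map_smul, primary_cre_poly primary_vertex h.same.right h.poly, map_smul, map_smul, map_sum,
    map_sum, smul_eq_mul, Finset.mul_sum]
  refine Finset.sum_congr rfl fun a _ => ?_
  rw [map_smul, map_smul, vac_primary_cre primary_vertex h.right.right, smul_eq_mul,
    show n - (-(m'' + t * eps i * k + 1) - b - a) = n + (m'' + t * eps i * k + 1) + b + a by ring]
  ring

end

end QToroidal

/-! ### Closed formulas for the words of length four -/

namespace QToroidal

noncomputable section

variable {q d u L : ℂ} {i j : Fin 2} {c : ℤ → ℂ} {t : ℤ} {κs κf : ℂ⟦X⟧}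

/-- The sum over the contractions among three operators of the same kind. -/
def wordSum (s : ℕ → ℂ) (f g h : ℤ → ℂ) (x y z : ℤ) : ℂ :=
  ∑ a ∈ Finset.range 3, ∑ b ∈ Finset.range 3, ∑ e ∈ Finset.range 3,
    s a * s b * s e * (f (x - a - b) * g (y + a - e) * h (z + b + e))

local notation "U" => vertex q d u L i t c
local notation "D" => vertex q d u L j t c
local notation "X" => Complex.exp (t * u * L)

theorem mul_wordSum (r : ℂ) (s : ℕ → ℂ) (f g h : ℤ → ℂ) (x y z : ℤ) : r * wordSum s f g h x y z
    = ∑ a ∈ Finset.range 3, ∑ b ∈ Finset.range 3, ∑ e ∈ Finset.range 3,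
    r * (s a * s b * s e * (f (x - a - b) * g (y + a - e) * h (z + b + e))) := by
  simp only [wordSum, Finset.mul_sum]

/-- In `wordSum` the indices a, b, e belong to the pairs (1,2), (1,3), (2,3) of U's. They shift
individual indices but not their sum, so the conservation condition factors out. -/
theorem vac_word_last (h : SerrePair q d i j c t κs κf) (m m' m'' n k k' : ℤ) :
    vac k' (U m (U m' (U m'' (D n (ket k)))))
      = (if k + 2 * t * eps j = k' - 2 * t * eps i - 2 * t * eps i - 2 * t * eps i ∧
          n + ((m + t * eps i * k' - 1) + (m' + t * eps i * (k' - 2 * t * eps i) - 1)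
            + (m'' + t * eps i * (k' - 2 * t * eps i - 2 * t * eps i) - 1)) + t * eps j * k + 1 = 0
        then X ^ 4 else 0) * wordSum (fun a => PowerSeries.coeff a κs) (ext κf) (ext κf) (ext κf)
          (m + t * eps i * k' - 1) (m' + t * eps i * (k' - 2 * t * eps i) - 1)
          (m'' + t * eps i * (k' - 2 * t * eps i - 2 * t * eps i) - 1) := by
  rw [vac_UUUD h, mul_wordSum]
  simp only [vac_UUD h, vac_UD h, vac_opposite_ket, Finset.mul_sum]
  refine Finset.sum_congr rfl fun a _ => Finset.sum_congr rfl fun b _ =>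
    Finset.sum_congr rfl fun e _ => ?_
  rw [show m' + a + t * eps i * (k' - 2 * t * eps i) - 1 - e
      = m' + t * eps i * (k' - 2 * t * eps i) - 1 + a - e by ring,
    show m'' + b + e + t * eps i * (k' - 2 * t * eps i - 2 * t * eps i) - 1
      = m'' + t * eps i * (k' - 2 * t * eps i - 2 * t * eps i) - 1 + b + e by ring]
  generalize m + t * eps i * k' - 1 = x
  generalize m' + t * eps i * (k' - 2 * t * eps i) - 1 = y
  generalize m'' + t * eps i * (k' - 2 * t * eps i - 2 * t * eps i) - 1 = z
  rw [show n + (x - a - b) + (y + a - e) + (z + b + e) = n + (x + y + z) by ring]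
  split_ifs <;> ring

theorem vac_word_third (h : SerrePair q d i j c t κs κf) (m m' m'' n k k' : ℤ) :
    vac k' (U m (U m' (D n (U m'' (ket k)))))
      = (if k + 2 * t * eps i + 2 * t * eps j = k' - 2 * t * eps i - 2 * t * eps i ∧
          n + ((m + t * eps i * k' - 1) + (m' + t * eps i * (k' - 2 * t * eps i) - 1)
            + (m'' + t * eps i * k + 1)) + t * eps j * (k + 2 * t * eps i) + 1 = 0
        then X ^ 4 else 0) * wordSum (fun a => PowerSeries.coeff a κs) (ext κf) (ext κf)
          (fun x => ext κf (-x))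
          (m + t * eps i * k' - 1) (m' + t * eps i * (k' - 2 * t * eps i) - 1)
          (m'' + t * eps i * k + 1) := by
  rw [vac_UUDU h, mul_wordSum]
  simp only [vac_UDU h, vac_DU h, vac_opposite_ket, Finset.mul_sum]
  refine Finset.sum_congr rfl fun a _ => Finset.sum_congr rfl fun b _ =>
    Finset.sum_congr rfl fun e _ => ?_
  rw [show m' + a + t * eps i * (k' - 2 * t * eps i) - 1 - e
      = m' + t * eps i * (k' - 2 * t * eps i) - 1 + a - e by ring,
    show m'' + b + e + t * eps i * k + 1 = m'' + t * eps i * k + 1 + b + e by ring]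
  generalize m + t * eps i * k' - 1 = x
  generalize m' + t * eps i * (k' - 2 * t * eps i) - 1 = y
  generalize m'' + t * eps i * k + 1 = z
  rw [show n + (x - a - b) + (y + a - e) + (z + b + e) = n + (x + y + z) by ring]
  split_ifs <;> ring

theorem vac_word_second (h : SerrePair q d i j c t κs κf) (m m' m'' n k k' : ℤ) :
    vac k' (U m (D n (U m' (U m'' (ket k)))))
      = (if k + 2 * t * eps i + 2 * t * eps i + 2 * t * eps j = k' - 2 * t * eps i ∧
          n + ((m + t * eps i * k' - 1) + (m' + t * eps i * (k + 2 * t * eps i) + 1)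
            + (m'' + t * eps i * k + 1)) + t * eps j * (k + 2 * t * eps i + 2 * t * eps i) + 1 = 0
        then X ^ 4 else 0) * wordSum (fun a => PowerSeries.coeff a κs) (ext κf)
          (fun x => ext κf (-x)) (fun x => ext κf (-x))
          (m + t * eps i * k' - 1) (m' + t * eps i * (k + 2 * t * eps i) + 1)
          (m'' + t * eps i * k + 1) := by
  rw [vac_UDUU h, mul_wordSum]
  simp only [vac_DUU h, vac_DU h, vac_opposite_ket, Finset.mul_sum]
  refine Finset.sum_congr rfl fun a _ => Finset.sum_congr rfl fun b _ =>
    Finset.sum_congr rfl fun e _ => ?_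
  rw [show m' + a - e + t * eps i * (k + 2 * t * eps i) + 1
      = m' + t * eps i * (k + 2 * t * eps i) + 1 + a - e by ring,
    show -(m'' + b + t * eps i * k + 1) - e = -(m'' + t * eps i * k + 1 + b + e) by ring,
    show m'' + b + t * eps i * k + 1 = m'' + t * eps i * k + 1 + b by ring]
  generalize m + t * eps i * k' - 1 = x
  generalize m' + t * eps i * (k + 2 * t * eps i) + 1 = y
  generalize m'' + t * eps i * k + 1 = z
  rw [show n + (x - a - b) + (z + b) + e + (y + a - e) = n + (x + y + z) by ring]
  split_ifs <;> ring

theorem vac_word_first (h : SerrePair q d i j c t κs κf) (m m' m'' n k k' : ℤ) :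
    vac k' (D n (U m (U m' (U m'' (ket k)))))
      = (if k + 2 * t * eps i + 2 * t * eps i + 2 * t * eps i + 2 * t * eps j = k' ∧
          n + ((m + t * eps i * (k + 2 * t * eps i + 2 * t * eps i) + 1)
            + (m' + t * eps i * (k + 2 * t * eps i) + 1) + (m'' + t * eps i * k + 1))
            + t * eps j * (k + 2 * t * eps i + 2 * t * eps i + 2 * t * eps i) + 1 = 0
        then X ^ 4 else 0) * wordSum (fun a => PowerSeries.coeff a κs) (fun x => ext κf (-x))
          (fun x => ext κf (-x)) (fun x => ext κf (-x))
          (m + t * eps i * (k + 2 * t * eps i + 2 * t * eps i) + 1)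
          (m' + t * eps i * (k + 2 * t * eps i) + 1) (m'' + t * eps i * k + 1) := by
  rw [vac_DUUU h, mul_wordSum]
  simp only [vac_DUU h, vac_DU h, vac_opposite_ket, Finset.mul_sum]
  -- Here the U's were removed from the right, so the three sums appear in another order and are
  -- permuted to match `wordSum`.
  symm
  rw [Finset.sum_comm]
  refine (Finset.sum_congr rfl fun b _ => Finset.sum_comm).trans ?_
  rw [Finset.sum_comm]
  symm
  refine Finset.sum_congr rfl fun e _ => Finset.sum_congr rfl fun b _ =>
    Finset.sum_congr rfl fun a _ => ?_
  rw [show m - b - a + t * eps i * (k + 2 * t * eps i + 2 * t * eps i) + 1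
      = m + t * eps i * (k + 2 * t * eps i + 2 * t * eps i) + 1 - a - b by ring,
    show -(m' - e + t * eps i * (k + 2 * t * eps i) + 1) - a
      = -(m' + t * eps i * (k + 2 * t * eps i) + 1 + a - e) by ring,
    show m' - e + t * eps i * (k + 2 * t * eps i) + 1
      = m' + t * eps i * (k + 2 * t * eps i) + 1 - e by ring,
    show -(m'' + t * eps i * k + 1) - e - b = -(m'' + t * eps i * k + 1 + b + e) by ring]
  generalize m + t * eps i * (k + 2 * t * eps i + 2 * t * eps i) + 1 = x
  generalize m' + t * eps i * (k + 2 * t * eps i) + 1 = y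
  generalize m'' + t * eps i * k + 1 = z
  rw [show n + z + e + b + (y - e) + a + (x - a - b) = n + (x + y + z) by ring]
  split_ifs <;> ring

end

end QToroidal

namespace QToroidal

noncomputable section

variable {q d u L : ℂ} {i j : Fin 2} {c : ℤ → ℂ} {t : ℤ} {κs κf : ℂ⟦X⟧}

/-! ## Words as values of a linear functional on polynomials -/

/-- The functional sending `∏ X_v ^ e_v` to `∏ f (y_v + e_v)`. -/
def shiftFunctional (f : ℤ → ℂ) (y : Fin 3 → ℤ) : MvPolynomial (Fin 3) ℂ →ₗ[ℂ] ℂ :=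
  (MvPolynomial.basisMonomials (Fin 3) ℂ).constr ℂ fun e => ∏ v, f (y v + e v)

variable {f : ℤ → ℂ} {y : Fin 3 → ℤ} {v₁ v₂ v₃ : Fin 3}

/-- The three indices are distinct. -/
def Distinct (v₁ v₂ v₃ : Fin 3) : Prop := v₁ ≠ v₂ ∧ v₁ ≠ v₃ ∧ v₂ ≠ v₃

theorem shiftFunctional_monomial (h : Distinct v₁ v₂ v₃) (α β γ : ℕ) :
    shiftFunctional f y (MvPolynomial.X v₁ ^ α * MvPolynomial.X v₂ ^ β * MvPolynomial.X v₃ ^ γ)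
      = f (y v₁ + α) * f (y v₂ + β) * f (y v₃ + γ) := by
  obtain ⟨h1, h2, h3⟩ := h
  rw [MvPolynomial.X_pow_eq_monomial, MvPolynomial.X_pow_eq_monomial,
    MvPolynomial.X_pow_eq_monomial, MvPolynomial.monomial_mul, MvPolynomial.monomial_mul, one_mul,
    one_mul]
  have e := (MvPolynomial.basisMonomials (Fin 3) ℂ).constr_basis ℂ
    (fun e => ∏ v, f (y v + e v)) (Finsupp.single v₁ α + Finsupp.single v₂ β + Finsupp.single v₃ γ)
  rw [MvPolynomial.coe_basisMonomials] at e
  refine e.trans ?_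
  have hu : (Finset.univ : Finset (Fin 3)) = {v₁, v₂, v₃} := by
    clear e
    revert v₁ v₂ v₃
    decide
  rw [hu, Finset.prod_insert (by simp [h1, h2]), Finset.prod_insert (by simp [h3]),
    Finset.prod_singleton, mul_assoc]
  simp [h1, h2, h3, h1.symm, h2.symm, h3.symm]

/-- The values of the difference operator with symbol `p₀ + p₁ Z + p₂ Z²` on `f`. -/
def diffOp (p₀ p₁ p₂ : ℂ) (f : ℤ → ℂ) (x : ℤ) : ℂ := p₀ * f x + p₁ * f (x + 1) + p₂ * f (x + 2)

open MvPolynomial in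
theorem shiftFunctional_quadratic (h : Distinct v₁ v₂ v₃) (α β γ : ℕ)
    (a₀ a₁ a₂ b₀ b₁ b₂ c₀ c₁ c₂ : ℂ) :
    shiftFunctional f y (X v₁ ^ α * X v₂ ^ β * X v₃ ^ γ * ((C a₀ + C a₁ * X v₁ + C a₂ * X v₁ ^ 2) *
        (C b₀ + C b₁ * X v₂ + C b₂ * X v₂ ^ 2) * (C c₀ + C c₁ * X v₃ + C c₂ * X v₃ ^ 2)))
      = diffOp a₀ a₁ a₂ f (y v₁ + α) * diffOp b₀ b₁ b₂ f (y v₂ + β)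
        * diffOp c₀ c₁ c₂ f (y v₃ + γ) := by
  have hsum : ∀ (v : Fin 3) (α : ℕ) (a₀ a₁ a₂ : ℂ),
      (X v ^ α * (C a₀ + C a₁ * X v + C a₂ * X v ^ 2) : MvPolynomial (Fin 3) ℂ)
        = ∑ l : Fin 3, (![a₀, a₁, a₂] l) • X v ^ (α + l) := by
    intro v α a₀ a₁ a₂
    simp only [Fin.sum_univ_three, smul_eq_C_mul]
    simp
    ring
  have hdiff : ∀ (v : Fin 3) (α : ℕ) (a₀ a₁ a₂ : ℂ), diffOp a₀ a₁ a₂ f (y v + α)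
      = ∑ l : Fin 3, (![a₀, a₁, a₂] l) * f (y v + (α + l : ℕ)) := by
    intro v α a₀ a₁ a₂
    simp [Fin.sum_univ_three, diffOp, add_assoc]
  rw [show ∀ A B C P Q R : MvPolynomial (Fin 3) ℂ, A * B * C * (P * Q * R)
    = (A * P) * (B * Q) * (C * R) by intros; ring, hsum, hsum, hsum, hdiff, hdiff, hdiff]
  simp only [Finset.sum_mul, Finset.mul_sum, map_sum, smul_mul_assoc,
    mul_smul_comm, map_smul, smul_eq_mul, shiftFunctional_monomial h]
  refine Finset.sum_congr rfl fun a _ => Finset.sum_congr rfl fun b _ =>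
    Finset.sum_congr rfl fun e _ => ?_
  ring

/-- The shift by 2 makes both symbols polynomials in Z: this one on the left of D, and by the
symmetry of `theta` the reversed one on the right (`diffOp_theta_aft`). -/
theorem diffOp_theta_bef {a b : ℂ} (hab : a ≠ b) (ha : a ^ 2 ≠ 1) (hb : b ^ 2 ≠ 1)
    (h1 : a * b ≠ 1) (x : ℤ) : diffOp 1 (-(a + b)) (a * b) (fun x => theta a b (x - 2)) x
      = ext (geom a * geom b) (x - 2) := by
  rw [← theta_recurrence hab ha hb h1, diffOp, show x - 2 + 1 = x + 1 - 2 by ring,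
    show x - 2 + 2 = x + 2 - 2 by ring]
  ring

theorem diffOp_theta_aft {a b : ℂ} (hab : a ≠ b) (ha : a ^ 2 ≠ 1) (hb : b ^ 2 ≠ 1)
    (h1 : a * b ≠ 1) (x : ℤ) : diffOp (a * b) (-(a + b)) 1 (fun x => theta a b (x - 2)) x
      = ext (geom a * geom b) (-x) := by
  rw [← theta_recurrence hab ha hb h1, diffOp, ← theta_neg a b (x - 2), ← theta_neg a b (x + 1 - 2),
    ← theta_neg a b (x + 2 - 2), show -(x - 2) = -x + 2 by ring,
    show -(x + 1 - 2) = -x + 1 by ring, show -(x + 2 - 2) = -x by ring]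
  ring

/-- The contractions among the operators of one kind, as a polynomial. -/
theorem wordSum_eq {s : ℕ → ℂ} {r : ℂ} (h0 : s 0 = 1) (h1 : s 1 = -(1 + r)) (h2 : s 2 = r)
    (h : Distinct v₁ v₂ v₃) (a₀ a₁ a₂ b₀ b₁ b₂ c₀ c₁ c₂ : ℂ) :
    wordSum s (diffOp a₀ a₁ a₂ f) (diffOp b₀ b₁ b₂ f) (diffOp c₀ c₁ c₂ f)
        (y v₁ + 4) (y v₂ + 2) (y v₃)
      = shiftFunctional f y (pairPoly (MvPolynomial.C r) (MvPolynomial.X v₁) (MvPolynomial.X v₂)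
          (MvPolynomial.X v₃) *
        ((MvPolynomial.C a₀ + MvPolynomial.C a₁ * MvPolynomial.X v₁
            + MvPolynomial.C a₂ * MvPolynomial.X v₁ ^ 2) *
          (MvPolynomial.C b₀ + MvPolynomial.C b₁ * MvPolynomial.X v₂
            + MvPolynomial.C b₂ * MvPolynomial.X v₂ ^ 2) *
          (MvPolynomial.C c₀ + MvPolynomial.C c₁ * MvPolynomial.X v₃
            + MvPolynomial.C c₂ * MvPolynomial.X v₃ ^ 2))) := by
  -- Each pair contributes (X_i - X_j)(X_i - r X_j), with coefficient s_a at X_i^{2-a} X_j^a. The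
  -- offsets 4, 2, 0 are twice the number of pairs in which a variable comes first.
  have hP : pairPoly (MvPolynomial.C r) (MvPolynomial.X v₁) (MvPolynomial.X v₂)
      (MvPolynomial.X v₃ : MvPolynomial (Fin 3) ℂ)
      = ∑ a ∈ Finset.range 3, ∑ b ∈ Finset.range 3, ∑ e ∈ Finset.range 3,
        (s a * s b * s e) • (MvPolynomial.X v₁ ^ (4 - a - b) * MvPolynomial.X v₂ ^ (2 + a - e) *
          MvPolynomial.X v₃ ^ (b + e)) := by
    simp only [Finset.sum_range_succ, Finset.sum_range_zero, h0, h1, h2, pairPoly,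
      MvPolynomial.smul_eq_C_mul, map_mul, map_neg, map_add, map_one]
    norm_num
    ring
  rw [hP]
  simp only [Finset.sum_mul, map_sum, smul_mul_assoc, map_smul, shiftFunctional_quadratic h,
    smul_eq_mul, wordSum]
  refine Finset.sum_congr rfl fun a ha => Finset.sum_congr rfl fun b hb =>
    Finset.sum_congr rfl fun e he => ?_
  rw [Finset.mem_range] at ha hb he
  rw [show y v₁ + 4 - a - b = y v₁ + (4 - a - b : ℕ) by omega,
    show y v₂ + 2 + a - e = y v₂ + (2 + a - e : ℕ) by omega,
    show y v₃ + b + e = y v₃ + (b + e : ℕ) by omega]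

end

end QToroidal

namespace QToroidal

noncomputable section

variable {q d u L : ℂ} {i j : Fin 2} {c : ℤ → ℂ} {t : ℤ} {κs κf : ℂ⟦X⟧} {a b p r : ℂ}

/-! ## The Serre relations -/

/-- The data of a pair of vertex operators of opposite charges satisfying a Serre relation. -/
structure SerreData (q d : ℂ) (i j : Fin 2) (c : ℤ → ℂ) (t : ℤ) (a b p : ℂ) : Prop where
  pair : SerrePair q d i j c t (oneSub 1 * oneSub (a * b)) (geom a * geom b)
  a_ne_b : a ≠ b
  a_sq : a ^ 2 ≠ 1
  b_sq : b ^ 2 ≠ 1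
  mul_ne_one : a * b ≠ 1
  mul_ne_zero : a * b ≠ 0
  p_ne_zero : p ≠ 0
  p_eq : a * b * (p + 1 + p⁻¹) = (a * b) ^ 2 + a * b + 1

theorem wordSum_congr {s : ℕ → ℂ} {f g h f' g' h' : ℤ → ℂ} {x y z x' y' z' : ℤ}
    (hf : ∀ l, f (x + l) = f' (x' + l)) (hg : ∀ l, g (y + l) = g' (y' + l))
    (hh : ∀ l, h (z + l) = h' (z' + l)) : wordSum s f g h x y z = wordSum s f' g' h' x' y' z' := by
  refine Finset.sum_congr rfl fun a _ => Finset.sum_congr rfl fun b _ =>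
    Finset.sum_congr rfl fun e _ => ?_
  rw [sub_sub, sub_eq_add_neg, hf, add_sub_assoc, hg, add_assoc, hh, sub_sub, ← sub_eq_add_neg,
    add_sub_assoc, add_assoc]

/-- `wordPoly a b P Q R` is the symbol of a word, where `P`, `Q`, `R` say on which side of the
operator of the opposite charge the three operators stand. -/
def wordPoly (a b : ℂ) (P Q R : MvPolynomial (Fin 3) ℂ → MvPolynomial (Fin 3) ℂ)
    (v₁ v₂ v₃ : Fin 3) : MvPolynomial (Fin 3) ℂ :=
  pairPoly (MvPolynomial.C (a * b)) (MvPolynomial.X v₁) (MvPolynomial.X v₂) (MvPolynomial.X v₃) *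
    (P (MvPolynomial.X v₁) * Q (MvPolynomial.X v₂) * R (MvPolynomial.X v₃))

/-- The symbol of an operator on the left of the operator of the opposite charge. -/
def befSymbol (a b : ℂ) : MvPolynomial (Fin 3) ℂ → MvPolynomial (Fin 3) ℂ :=
  befPoly (MvPolynomial.C (a + b)) (MvPolynomial.C (a * b))

/-- The symbol of an operator on the right of the operator of the opposite charge. -/
def aftSymbol (a b : ℂ) : MvPolynomial (Fin 3) ℂ → MvPolynomial (Fin 3) ℂ :=
  aftPoly (MvPolynomial.C (a + b)) (MvPolynomial.C (a * b))

theorem befSymbol_eq (x : MvPolynomial (Fin 3) ℂ) : befSymbol a b x = MvPolynomial.C 1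
    + MvPolynomial.C (-(a + b)) * x + MvPolynomial.C (a * b) * x ^ 2 := by
  rw [befSymbol, befPoly, map_one, map_neg]
  ring

theorem aftSymbol_eq (x : MvPolynomial (Fin 3) ℂ) : aftSymbol a b x = MvPolynomial.C (a * b)
    + MvPolynomial.C (-(a + b)) * x + MvPolynomial.C 1 * x ^ 2 := by
  rw [aftSymbol, aftPoly, map_one, map_neg]
  ring

theorem coeff_oneSub_mul_oneSub (r : ℂ) : PowerSeries.coeff 0 (oneSub 1 * oneSub r) = 1 ∧
    PowerSeries.coeff 1 (oneSub 1 * oneSub r) = -(1 + r) ∧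
    PowerSeries.coeff 2 (oneSub 1 * oneSub r) = r ∧
    ∀ n, 3 ≤ n → PowerSeries.coeff n (oneSub 1 * oneSub r) = 0 := by
  have e : ∀ n : ℕ, PowerSeries.coeff n (oneSub 1 * oneSub r) = ext (oneSub 1 * oneSub r) n :=
    fun n => (ext_natCast _ _).symm
  refine ⟨?_, ?_, ?_, fun n hn => ?_⟩ <;> rw [e, ext_oneSub_oneSub] <;> simp only [ext_one]
  · norm_num
  · norm_num
  · norm_num
  · rw [if_neg (by omega), if_neg (by omega), if_neg (by omega)]
    ring

local notation "U" => vertex q d u L i t c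
local notation "D" => vertex q d u L j t c

section Words

variable {v₁ v₂ v₃ : Fin 3} {n : Fin 3 → ℤ} {S k : ℤ}

/-- The common factor of all words. -/
def wordFactor (u L : ℂ) (i j : Fin 2) (t m k k' S : ℤ) : ℂ :=
  if k' = k + 4 * (t * eps i) ∧ m + (S + 3 * (t * eps i * k + 1)) + t * eps j * k + 1 = 0 then
    Complex.exp (t * u * L) ^ 4 else 0

/-- The functional that computes the words. -/
def wordFunctional (i : Fin 2) (t : ℤ) (a b : ℂ) (n : Fin 3 → ℤ) (k : ℤ) :
    MvPolynomial (Fin 3) ℂ →ₗ[ℂ] ℂ :=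
  shiftFunctional (fun x => theta a b (x - 2)) fun v => n v + (t * eps i * k + 1)

/-- Every slot uses the same sequence `theta`; the side of D only selects the symbol. Hence words of
all four shapes are values of one functional. -/
theorem SerreData.wordFunctional_eq (h : SerreData q d i j c t a b p) (hv : Distinct v₁ v₂ v₃)
    {f₁ f₂ f₃ : ℤ → ℂ} {P Q R : MvPolynomial (Fin 3) ℂ → MvPolynomial (Fin 3) ℂ}
    (hf : (f₁ = (fun x => ext (geom a * geom b) (x - 2)) ∧ P = befSymbol a b) ∨
      (f₁ = (fun x => ext (geom a * geom b) (-x)) ∧ P = aftSymbol a b))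
    (hg : (f₂ = (fun x => ext (geom a * geom b) (x - 2)) ∧ Q = befSymbol a b) ∨
      (f₂ = (fun x => ext (geom a * geom b) (-x)) ∧ Q = aftSymbol a b))
    (hh : (f₃ = (fun x => ext (geom a * geom b) (x - 2)) ∧ R = befSymbol a b) ∨
      (f₃ = (fun x => ext (geom a * geom b) (-x)) ∧ R = aftSymbol a b)) :
    wordFunctional i t a b n k (wordPoly a b P Q R v₁ v₂ v₃)
      = wordSum (fun l => PowerSeries.coeff l (oneSub 1 * oneSub (a * b))) f₁ f₂ f₃
        (n v₁ + (t * eps i * k + 1) + 4) (n v₂ + (t * eps i * k + 1) + 2)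
        (n v₃ + (t * eps i * k + 1)) := by
  obtain ⟨c0, c1, c2, -⟩ := coeff_oneSub_mul_oneSub (a * b)
  have key : ∀ {f : ℤ → ℂ} {P : MvPolynomial (Fin 3) ℂ → MvPolynomial (Fin 3) ℂ},
      (f = (fun x => ext (geom a * geom b) (x - 2)) ∧ P = befSymbol a b) ∨
      (f = (fun x => ext (geom a * geom b) (-x)) ∧ P = aftSymbol a b) →
      ∃ p₀ p₁ p₂, f = diffOp p₀ p₁ p₂ (fun x => theta a b (x - 2)) ∧
        P = fun x => MvPolynomial.C p₀ + MvPolynomial.C p₁ * x + MvPolynomial.C p₂ * x ^ 2 := by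
    rintro f P (⟨rfl, rfl⟩ | ⟨rfl, rfl⟩)
    · exact ⟨_, _, _, funext fun x =>
        (diffOp_theta_bef h.a_ne_b h.a_sq h.b_sq h.mul_ne_one x).symm, funext befSymbol_eq⟩
    · exact ⟨_, _, _, funext fun x =>
        (diffOp_theta_aft h.a_ne_b h.a_sq h.b_sq h.mul_ne_one x).symm, funext aftSymbol_eq⟩
  obtain ⟨_, _, _, rfl, rfl⟩ := key hf
  obtain ⟨_, _, _, rfl, rfl⟩ := key hg
  obtain ⟨_, _, _, rfl, rfl⟩ := key hh
  exact (wordSum_eq (y := fun v => n v + (t * eps i * k + 1)) c0 c1 c2 hv _ _ _ _ _ _ _ _ _).symm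

theorem ite_mul_congr {P P' : Prop} [Decidable P] [Decidable P'] {K w w' : ℂ} (h : P ↔ P')
    (hw : P' → w = w') : (if P then K else 0) * w = (if P' then K else 0) * w' := by
  by_cases hP : P'
  · rw [if_pos (h.2 hP), if_pos hP, hw hP]
  · rw [if_neg (fun h' => hP (h.1 h')), if_neg hP, zero_mul, zero_mul]

/-- The charge g = t eps_i is ±1. Its square is recorded in the two forms that linearize the index
identities. -/
theorem SerrePair.exists_charge (h : SerrePair q d i j c t κs κf) :
    ∃ g : ℤ, 2 * t * eps i = 2 * g ∧ 2 * t * eps j = -(2 * g) ∧ t * eps i = g ∧ t * eps j = -g ∧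
      g * (2 * g) = 2 ∧ g * (4 * g) = 4 := by
  have h1 := eps_mul_self i
  have h2 := eps_mul_eps_ne h.ne
  have h3 : eps j = -eps i := by linear_combination eps i * h2 - eps j * h1
  have h4 := h.sq
  refine ⟨t * eps i, by ring, by rw [h3]; ring, rfl, by rw [h3]; ring, ?_, ?_⟩
  · linear_combination 2 * t ^ 2 * h1 + 2 * h4
  · linear_combination 4 * t ^ 2 * h1 + 4 * h4

/-- Charge conservation gives k' = k + 4g, so the products g k' become g k plus constants. These
constants match the offsets 4, 2, 0 and the shift by 2 in `theta`, so this word and the next three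
share one prefactor and one functional. -/
theorem SerreData.vac_last (h : SerreData q d i j c t a b p) (hv : Distinct v₁ v₂ v₃)
    (hS : n v₁ + n v₂ + n v₃ = S) (m k' : ℤ) :
    vac k' (U (n v₁) (U (n v₂) (U (n v₃) (D m (ket k)))))
      = wordFactor u L i j t m k k' S * wordFunctional i t a b n k
        (wordPoly a b (befSymbol a b) (befSymbol a b) (befSymbol a b) v₁ v₂ v₃) := by
  obtain ⟨g, h1, h2, h3, h4, h5, h6⟩ := h.pair.exists_charge
  rw [vac_word_last h.pair, wordFactor, h.wordFunctional_eq hv (.inl ⟨rfl, rfl⟩)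
    (.inl ⟨rfl, rfl⟩)
    (.inl ⟨rfl, rfl⟩)]
  simp only [h1, h2, h3, h4]
  refine ite_mul_congr ⟨?_, ?_⟩ ?_
  · rintro ⟨e1, e2⟩
    obtain rfl : k' = k + 4 * g := by omega
    refine ⟨rfl, ?_⟩
    simp only [mul_add, mul_sub, neg_mul, h5, h6] at e2 ⊢
    -- With g² eliminated, g k is the only product left, and naming it leaves linear arithmetic.
    generalize g * k = w at *
    omega
  · rintro ⟨rfl, e2⟩
    simp only [mul_add, mul_sub, neg_mul, h5, h6] at e2 ⊢
    generalize g * k = w at *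
    constructor <;> omega
  · rintro ⟨rfl, -⟩
    simp only [mul_add, mul_sub, h5, h6]
    generalize g * k = w at *
    refine wordSum_congr ?_ ?_ ?_ <;> intro l <;> congr 1 <;> omega

theorem SerreData.vac_third (h : SerreData q d i j c t a b p) (hv : Distinct v₁ v₂ v₃)
    (hS : n v₁ + n v₂ + n v₃ = S) (m k' : ℤ) :
    vac k' (U (n v₁) (U (n v₂) (D m (U (n v₃) (ket k)))))
      = wordFactor u L i j t m k k' S * wordFunctional i t a b n k
        (wordPoly a b (befSymbol a b) (befSymbol a b) (aftSymbol a b) v₁ v₂ v₃) := by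
  obtain ⟨g, h1, h2, h3, h4, h5, h6⟩ := h.pair.exists_charge
  rw [vac_word_third h.pair, wordFactor, h.wordFunctional_eq hv (.inl ⟨rfl, rfl⟩)
    (.inl ⟨rfl, rfl⟩)
    (.inr ⟨rfl, rfl⟩)]
  simp only [h1, h2, h3, h4]
  refine ite_mul_congr ⟨?_, ?_⟩ ?_
  · rintro ⟨e1, e2⟩
    obtain rfl : k' = k + 4 * g := by omega
    refine ⟨rfl, ?_⟩
    simp only [mul_add, mul_sub, neg_mul, h5, h6] at e2 ⊢
    generalize g * k = w at *
    omega
  · rintro ⟨rfl, e2⟩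
    simp only [mul_add, mul_sub, neg_mul, h5, h6] at e2 ⊢
    generalize g * k = w at *
    constructor <;> omega
  · rintro ⟨rfl, -⟩
    simp only [mul_add, mul_sub, h5, h6]
    generalize g * k = w at *
    refine wordSum_congr ?_ ?_ ?_ <;> intro l <;> congr 1 <;> omega

theorem SerreData.vac_second (h : SerreData q d i j c t a b p) (hv : Distinct v₁ v₂ v₃)
    (hS : n v₁ + n v₂ + n v₃ = S) (m k' : ℤ) :
    vac k' (U (n v₁) (D m (U (n v₂) (U (n v₃) (ket k)))))
      = wordFactor u L i j t m k k' S * wordFunctional i t a b n k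
        (wordPoly a b (befSymbol a b) (aftSymbol a b) (aftSymbol a b) v₁ v₂ v₃) := by
  obtain ⟨g, h1, h2, h3, h4, h5, h6⟩ := h.pair.exists_charge
  rw [vac_word_second h.pair, wordFactor, h.wordFunctional_eq hv (.inl ⟨rfl, rfl⟩)
    (.inr ⟨rfl, rfl⟩)
    (.inr ⟨rfl, rfl⟩)]
  simp only [h1, h2, h3, h4]
  refine ite_mul_congr ⟨?_, ?_⟩ ?_
  · rintro ⟨e1, e2⟩
    obtain rfl : k' = k + 4 * g := by omega
    refine ⟨rfl, ?_⟩
    simp only [mul_add, neg_mul, h5, h6] at e2 ⊢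
    generalize g * k = w at *
    omega
  · rintro ⟨rfl, e2⟩
    simp only [mul_add, neg_mul, h5, h6] at e2 ⊢
    generalize g * k = w at *
    constructor <;> omega
  · rintro ⟨rfl, -⟩
    simp only [mul_add, h5, h6]
    generalize g * k = w at *
    refine wordSum_congr ?_ ?_ ?_ <;> intro l <;> congr 1 <;> omega

theorem SerreData.vac_first (h : SerreData q d i j c t a b p) (hv : Distinct v₁ v₂ v₃)
    (hS : n v₁ + n v₂ + n v₃ = S) (m k' : ℤ) :
    vac k' (D m (U (n v₁) (U (n v₂) (U (n v₃) (ket k)))))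
      = wordFactor u L i j t m k k' S * wordFunctional i t a b n k
        (wordPoly a b (aftSymbol a b) (aftSymbol a b) (aftSymbol a b) v₁ v₂ v₃) := by
  obtain ⟨g, h1, h2, h3, h4, h5, -⟩ := h.pair.exists_charge
  rw [vac_word_first h.pair, wordFactor, h.wordFunctional_eq hv (.inr ⟨rfl, rfl⟩)
    (.inr ⟨rfl, rfl⟩)
    (.inr ⟨rfl, rfl⟩)]
  simp only [h1, h2, h3, h4]
  refine ite_mul_congr ⟨?_, ?_⟩ ?_
  · rintro ⟨e1, e2⟩
    obtain rfl : k' = k + 4 * g := by omega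
    refine ⟨rfl, ?_⟩
    simp only [mul_add, neg_mul, h5] at e2 ⊢
    generalize g * k = w at *
    omega
  · rintro ⟨rfl, e2⟩
    simp only [mul_add, neg_mul, h5] at e2 ⊢
    generalize g * k = w at *
    constructor <;> omega
  · rintro ⟨rfl, -⟩
    simp only [mul_add, h5]
    generalize g * k = w at *
    refine wordSum_congr ?_ ?_ ?_ <;> intro l <;> congr 1 <;> omega

end Words

/-- `[A, [B, [C, D]_p]]_{p⁻¹}`. -/
def serreBracket {A : Type} [Ring A] [Algebra ℂ A] (p : ℂ) (x y z w : A) : A :=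
  brk p⁻¹ x (brk 1 y (brk p z w))

theorem serreBracket_apply (hp : p ≠ 0) (A B C E : Module.End ℂ Fock) (v : Fock) :
    serreBracket p A B C E v = A (B (C (E v))) - p • A (B (E (C v))) - A (C (E (B v)))
      + p • A (E (C (B v))) - p⁻¹ • B (C (E (A v))) + B (E (C (A v))) + p⁻¹ • C (E (B (A v)))
      - E (C (B (A v))) := by
  simp only [serreBracket, brk, LinearMap.sub_apply, LinearMap.smul_apply, Module.End.mul_apply,
    map_sub, map_smul, smul_sub, smul_smul, inv_mul_cancel₀ hp, one_smul]
  abel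

/-- After symmetrization the bracket's words may be relabelled; by position of D their coefficients
add up to 1, -(p + 1 + p⁻¹), p + 1 + p⁻¹, -1. Then `serre_identity` applies with t = ab, which is
cancelled afterwards. -/
theorem wordPoly_sum_eq_zero (h : SerreData q d i j c t a b p) :
    symSum (fun v₁ v₂ v₃ => wordPoly a b (befSymbol a b) (befSymbol a b) (befSymbol a b) v₁ v₂ v₃
      - (p + 1 + p⁻¹) •
        wordPoly a b (befSymbol a b) (befSymbol a b) (aftSymbol a b) v₁ v₂ v₃
      + (p + 1 + p⁻¹) •
        wordPoly a b (befSymbol a b) (aftSymbol a b) (aftSymbol a b) v₁ v₂ v₃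
      - wordPoly a b (aftSymbol a b) (aftSymbol a b) (aftSymbol a b) v₁ v₂ v₃) = 0 := by
  have hc : (MvPolynomial.C (a * b) : MvPolynomial (Fin 3) ℂ) * MvPolynomial.C (p + 1 + p⁻¹)
      = MvPolynomial.C (a * b) ^ 2 + MvPolynomial.C (a * b) + 1 := by
    rw [← map_mul, h.p_eq]
    simp
  have h1 := serre_identity (s := MvPolynomial.C (a + b)) hc MvPolynomial.X
  have h2 := (mul_eq_zero.1 h1).resolve_left (by simpa using h.mul_ne_zero)
  rw [← h2]
  congr 1
  funext v₁ v₂ v₃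
  simp only [wordPoly, befSymbol, aftSymbol, MvPolynomial.smul_eq_C_mul]
  ring

theorem SerreData.vac_serre (h : SerreData q d i j c t a b p) (n : Fin 3 → ℤ) (m k k' : ℤ) :
    vac k' (symSum (fun v₁ v₂ v₃ => serreBracket p (U (n v₁)) (U (n v₂)) (U (n v₃)) (D m))
      (ket k)) = 0 := by
  have e : ∀ v₁ v₂ v₃, Distinct v₁ v₂ v₃ → n v₁ + n v₂ + n v₃ = n 0 + n 1 + n 2 := by
    intro v₁ v₂ v₃ hv
    have : ∀ v : Fin 3, v = 0 ∨ v = 1 ∨ v = 2 := by decide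
    obtain ⟨h1, h2, h3⟩ := hv
    rcases this v₁ with rfl | rfl | rfl <;> rcases this v₂ with rfl | rfl | rfl <;>
      rcases this v₃ with rfl | rfl | rfl <;> first | contradiction | ring
  have d1 : Distinct 0 1 2 := by unfold Distinct; decide
  have d2 : Distinct 0 2 1 := by unfold Distinct; decide
  have d3 : Distinct 1 0 2 := by unfold Distinct; decide
  have d4 : Distinct 1 2 0 := by unfold Distinct; decide
  have d5 : Distinct 2 0 1 := by unfold Distinct; decide
  have d6 : Distinct 2 1 0 := by unfold Distinct; decide
  have hz := congrArg (fun x => wordFactor u L i j t m k k' (n 0 + n 1 + n 2) *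
    wordFunctional i t a b n k x) (wordPoly_sum_eq_zero h)
  simp only [symSum, map_add, map_sub, map_smul, map_zero, mul_zero,
    smul_eq_mul] at hz
  simp only [symSum, LinearMap.add_apply, serreBracket_apply h.p_ne_zero, map_add, map_sub,
    map_smul, smul_eq_mul, h.vac_last d1 (e _ _ _ d1), h.vac_last d2 (e _ _ _ d2),
    h.vac_last d3 (e _ _ _ d3), h.vac_last d4 (e _ _ _ d4), h.vac_last d5 (e _ _ _ d5),
    h.vac_last d6 (e _ _ _ d6), h.vac_third d1 (e _ _ _ d1), h.vac_third d2 (e _ _ _ d2),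
    h.vac_third d3 (e _ _ _ d3), h.vac_third d4 (e _ _ _ d4), h.vac_third d5 (e _ _ _ d5),
    h.vac_third d6 (e _ _ _ d6), h.vac_second d1 (e _ _ _ d1), h.vac_second d2 (e _ _ _ d2),
    h.vac_second d3 (e _ _ _ d3), h.vac_second d4 (e _ _ _ d4), h.vac_second d5 (e _ _ _ d5),
    h.vac_second d6 (e _ _ _ d6), h.vac_first d1 (e _ _ _ d1), h.vac_first d2 (e _ _ _ d2),
    h.vac_first d3 (e _ _ _ d3), h.vac_first d4 (e _ _ _ d4), h.vac_first d5 (e _ _ _ d5),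
    h.vac_first d6 (e _ _ _ d6)]
  linear_combination hz

theorem lie_brk {A : Type} [Ring A] [Algebra ℂ A] (p : ℂ) (α x y : A) :
    α * brk p x y - brk p x y * α = brk p (α * x - x * α) y + brk p x (α * y - y * α) := by
  simp only [brk, mul_sub, sub_mul, mul_smul_comm, smul_mul_assoc, mul_assoc, smul_sub]
  abel

theorem lie_serreBracket {V W : ℤ → Module.End ℂ Fock} {α : Module.End ℂ Fock} {s s' : ℂ} {l : ℤ}
    (hV : ∀ m, α * V m - V m * α = s • V (m + l)) (hW : ∀ m, α * W m - W m * α = s' • W (m + l))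
    (x y z m : ℤ) :
    α * serreBracket p (V x) (V y) (V z) (W m) - serreBracket p (V x) (V y) (V z) (W m) * α
      = s • (serreBracket p (V (x + l)) (V y) (V z) (W m)
        + serreBracket p (V x) (V (y + l)) (V z) (W m)
        + serreBracket p (V x) (V y) (V (z + l)) (W m))
        + s' • serreBracket p (V x) (V y) (V z) (W (m + l)) := by
  have e1 : ∀ (p r : ℂ) (x y : Module.End ℂ Fock), brk p (r • x) y = r • brk p x y := by
    intro p r x y
    simp only [brk, smul_mul_assoc, mul_smul_comm, smul_sub, smul_comm p r]
  have e2 : ∀ (p r : ℂ) (x y : Module.End ℂ Fock), brk p x (r • y) = r • brk p x y := by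
    intro p r x y
    simp only [brk, smul_mul_assoc, mul_smul_comm, smul_sub, smul_comm p r]
  have e3 : ∀ (p : ℂ) (x y z : Module.End ℂ Fock), brk p x (y + z) = brk p x y + brk p x z := by
    intro p x y z
    simp only [brk, mul_add, add_mul, smul_add]
    abel
  simp only [serreBracket, lie_brk, hV, hW, e1, e2, e3]
  module

/-- The commutator shifts one index at a time, with a weight depending only on the kind of operator,
so symmetrized brackets go to combinations of symmetrized brackets and their span is stable. -/
theorem SerreData.serre (h : SerreData q d i j c t a b p) (hq : q ≠ 0) (hd : d ≠ 0)
    (hqd : ∀ n m : ℤ, n ≠ 0 ∨ m ≠ 0 → q ^ n * d ^ m ≠ 1) (n : Fin 3 → ℤ) (m : ℤ) :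
    symSum (fun v₁ v₂ v₃ => serreBracket p (U (n v₁)) (U (n v₂)) (U (n v₃)) (D m)) = 0 := by
  set R : (Fin 3 → ℤ) → ℤ → Module.End ℂ Fock := fun n m =>
    symSum (fun v₁ v₂ v₃ => serreBracket p (U (n v₁)) (U (n v₂)) (U (n v₃)) (D m)) with hR
  have hlie : ∀ i' l, l ≠ 0 → ∀ n m, alpha q d i' l * R n m - R n m * alpha q d i' l
      = weight q d i c i' l • (R (n + Pi.single 0 l) m + R (n + Pi.single 1 l) m
        + R (n + Pi.single 2 l) m) + weight q d j c i' l • R n (m + l) := by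
    intro i' l hl n m
    have key := lie_serreBracket (p := p) (primary_vertex (q := q) (d := d) (i := i) (c := c)
      (t := t) (u := u) (L := L) i' l hl) (primary_vertex (q := q) (d := d) (i := j) (c := c)
      (t := t) (u := u) (L := L) i' l hl)
    have d1 : (0 : Fin 3) ≠ 1 := by decide
    have d2 : (0 : Fin 3) ≠ 2 := by decide
    have d3 : (1 : Fin 3) ≠ 2 := by decide
    simp only [hR, symSum, mul_add, add_mul, add_sub_add_comm, key, Pi.add_apply, Pi.single_eq_same,
      Pi.single_eq_of_ne d1, Pi.single_eq_of_ne d2, Pi.single_eq_of_ne d3,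
      Pi.single_eq_of_ne d1.symm, Pi.single_eq_of_ne d2.symm, Pi.single_eq_of_ne d3.symm, add_zero]
    module
  refine eq_zero_of_vac hq hd hqd
    (Submodule.span ℂ (Set.range fun x : (Fin 3 → ℤ) × ℤ => R x.1 x.2)) ?_ ?_ (R n m)
    (Submodule.subset_span ⟨(n, m), rfl⟩)
  · intro T hT i' l hl
    induction hT using Submodule.span_induction with
    | mem x hx =>
      obtain ⟨⟨n, m⟩, rfl⟩ := hx
      have hmem : ∀ n m, R n m ∈
          Submodule.span ℂ (Set.range fun x : (Fin 3 → ℤ) × ℤ => R x.1 x.2) :=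
        fun n m => Submodule.subset_span ⟨(n, m), rfl⟩
      dsimp only
      rw [hlie i' l hl]
      exact Submodule.add_mem _ (Submodule.smul_mem _ _ (Submodule.add_mem _ (Submodule.add_mem _
        (hmem _ _) (hmem _ _)) (hmem _ _))) (Submodule.smul_mem _ _ (hmem _ _))
    | zero => simp
    | add x y _ _ hx hy =>
      rw [mul_add, add_mul, add_sub_add_comm]
      exact Submodule.add_mem _ hx hy
    | smul r x _ hx =>
      rw [mul_smul_comm, smul_mul_assoc, ← smul_sub]
      exact Submodule.smul_mem _ _ hx
  · intro T hT k k'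
    induction hT using Submodule.span_induction with
    | mem x hx =>
      obtain ⟨⟨n, m⟩, rfl⟩ := hx
      exact h.vac_serre n m k k'
    | zero => simp
    | add x y _ _ hx hy => rw [LinearMap.add_apply, map_add, hx, hy, add_zero]
    | smul r x _ hx => rw [LinearMap.smul_apply, map_smul, hx, smul_zero]

end

end QToroidal

namespace QToroidal

noncomputable section

/-! ## Naturality of the defining relations -/

section Naturality

variable {A B : Type} [Ring A] [Algebra ℂ A] [Ring B] [Algebra ℂ B] (φ : A →ₐ[ℂ] B)
  (q d : ℂ) (x : Gen → A)

theorem map_coeff_KplusS (i : Fin 2) (n : ℕ) : φ (PowerSeries.coeff n (KplusS q x i))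
    = PowerSeries.coeff n (KplusS q (φ ∘ x) i) := by
  rw [KplusS, KplusS, PowerSeries.coeff_C_mul, PowerSeries.coeff_C_mul, map_mul, map_expSeries]
  congr 4
  ext n
  rw [PowerSeries.coeff_map, PowerSeries.coeff_mk, PowerSeries.coeff_mk]
  split_ifs
  · exact map_smul φ _ _
  · exact map_zero φ

theorem map_coeff_KminusS (i : Fin 2) (n : ℕ) : φ (PowerSeries.coeff n (KminusS q x i))
    = PowerSeries.coeff n (KminusS q (φ ∘ x) i) := by
  rw [KminusS, KminusS, PowerSeries.coeff_C_mul, PowerSeries.coeff_C_mul, map_mul, map_expSeries]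
  congr 4
  ext n
  rw [PowerSeries.coeff_map, PowerSeries.coeff_mk, PowerSeries.coeff_mk]
  split_ifs
  · exact map_smul φ _ _
  · exact map_zero φ

theorem map_Kplus (i : Fin 2) (n : ℤ) : φ (Kplus q x i n) = Kplus q (φ ∘ x) i n := by
  unfold Kplus
  split_ifs
  · exact map_coeff_KplusS φ q x i _
  · exact map_zero φ

theorem map_Kminus (i : Fin 2) (n : ℤ) : φ (Kminus q x i n) = Kminus q (φ ∘ x) i n := by
  unfold Kminus
  split_ifs
  · exact map_coeff_KminusS φ q x i _
  · exact map_zero φ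

theorem map_Cpow (n : ℤ) : φ (Cpow x n) = Cpow (φ ∘ x) n := by
  unfold Cpow
  split_ifs <;> exact map_pow φ _ _

theorem map_scaleC (a : ℤ → A) (n : ℤ) :
    φ (scaleC x a n) = scaleC (φ ∘ x) (fun n => φ (a n)) n := by
  rw [scaleC, scaleC, map_mul, map_Cpow]

theorem map_g_mulZ_mulW (i j : Fin 2) (f : ℤ → ℤ → A) (m n : ℤ) :
    φ (g q d i j (mulZ A) (mulW A) f m n)
      = g q d i j (mulZ B) (mulW B) (fun m n => φ (f m n)) m n := by
  unfold g
  split_ifs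
  · change φ (f (m + 1) n - q2 q • f m (n + 1)) = φ (f (m + 1) n) - q2 q • φ (f m (n + 1))
    rw [map_sub, map_smul]
  · change φ ((f (m + 1 + 1) n - q3 q d • f (m + 1) (n + 1)) -
      q1 q d • (f (m + 1) (n + 1) - q3 q d • f m (n + 1 + 1))) =
      (φ (f (m + 1 + 1) n) - q3 q d • φ (f (m + 1) (n + 1))) -
      q1 q d • (φ (f (m + 1) (n + 1)) - q3 q d • φ (f m (n + 1 + 1)))
    simp only [map_sub, map_smul]

theorem map_g_mulW_mulZ (i j : Fin 2) (f : ℤ → ℤ → A) (m n : ℤ) :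
    φ (g q d i j (mulW A) (mulZ A) f m n)
      = g q d i j (mulW B) (mulZ B) (fun m n => φ (f m n)) m n := by
  unfold g
  split_ifs
  · change φ (f m (n + 1) - q2 q • f (m + 1) n) = φ (f m (n + 1)) - q2 q • φ (f (m + 1) n)
    rw [map_sub, map_smul]
  · change φ ((f m (n + 1 + 1) - q3 q d • f (m + 1) (n + 1)) -
      q1 q d • (f (m + 1) (n + 1) - q3 q d • f (m + 1 + 1) n)) =
      (φ (f m (n + 1 + 1)) - q3 q d • φ (f (m + 1) (n + 1))) -
      q1 q d • (φ (f (m + 1) (n + 1)) - q3 q d • φ (f (m + 1 + 1) n))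
    simp only [map_sub, map_smul]

theorem map_smul_powerSeries (a : ℂ) (f : A⟦X⟧) :
    PowerSeries.map (φ : A →+* B) (a • f) = a • PowerSeries.map (φ : A →+* B) f := by
  ext n
  simp

theorem map_lin (c : A) : PowerSeries.map (φ : A →+* B) (lin c) = lin (φ c) := by
  simp [lin]

theorem map_g_powerSeries (i j : Fin 2) (z w : A⟦X⟧) :
    PowerSeries.map (φ : A →+* B) (g q d i j z w)
      = g q d i j (PowerSeries.map (φ : A →+* B) z) (PowerSeries.map (φ : A →+* B) w) := by
  unfold g
  split_ifs <;> simp only [map_mul, map_sub, map_smul_powerSeries]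

theorem map_invLin (a : ℂ) (c : A) :
    PowerSeries.map (φ : A →+* B) (invLin a c) = invLin a (φ c) := by
  ext n
  simp [invLin]

theorem map_invOneSub (a : ℂ) (c : A) :
    PowerSeries.map (φ : A →+* B) (invOneSub a c) = invOneSub a (φ c) := by
  ext n
  simp [invOneSub]

theorem map_coeff_ratioLeft (i j : Fin 2) (k : ℕ) : φ (PowerSeries.coeff k (ratioLeft q d x i j))
    = PowerSeries.coeff k (ratioLeft q d (φ ∘ x) i j) := by
  have h : PowerSeries.map (φ : A →+* B) (ratioLeft q d x i j) = ratioLeft q d (φ ∘ x) i j := by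
    rw [ratioLeft, ratioLeft, map_mul, map_g_powerSeries, map_lin, map_one, invGLeft, invGLeft]
    congr 1
    split_ifs
    · exact map_invLin φ _ _
    · rw [map_mul, map_invLin, map_invLin]; rfl
  rw [← h, PowerSeries.coeff_map]
  rfl

theorem map_coeff_ratioRight (i j : Fin 2) (k : ℕ) :
    φ (PowerSeries.coeff k (ratioRight q d x i j))
      = PowerSeries.coeff k (ratioRight q d (φ ∘ x) i j) := by
  have h : PowerSeries.map (φ : A →+* B) (ratioRight q d x i j) = ratioRight q d (φ ∘ x) i j := by
    rw [ratioRight, ratioRight, map_mul, map_g_powerSeries, map_lin, map_one, invGRight, invGRight]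
    congr 1
    split_ifs
    · exact map_invOneSub φ _ _
    · rw [map_mul, map_invOneSub, map_invOneSub]; rfl
  rw [← h, PowerSeries.coeff_map]
  rfl

theorem map_brk (p : ℂ) (a b : A) : φ (brk p a b) = brk p (φ a) (φ b) := by
  simp only [brk, map_sub, map_mul, map_smul]

variable {φ q d x}

/-- A homomorphism respects the defining relations if they hold for the images of the generators. -/
theorem DefRel.map_eq (hR : ∀ a b, DefRel q d (φ ∘ x) a b → a = b) {a b : A}
    (h : DefRel q d x a b) : φ a = φ b := by
  have hfam : ∀ (r : ℂ) (f f' : ℤ → ℤ → A) (m n : ℤ),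
      φ ((r • f + f') m n) = (r • (fun m n => φ (f m n)) + fun m n => φ (f' m n)) m n := by
    intro r f f' m n
    simp
  cases h with
  | K_Kinv i => rw [map_mul, map_one]; exact hR _ _ (.K_Kinv i)
  | Kinv_K i => rw [map_mul, map_one]; exact hR _ _ (.Kinv_K i)
  | C_Cinv => rw [map_mul, map_one]; exact hR _ _ .C_Cinv
  | Cinv_C => rw [map_mul, map_one]; exact hR _ _ .Cinv_C
  | C_central y => rw [map_mul, map_mul]; exact hR _ _ (.C_central y)
  | Cinv_central y => rw [map_mul, map_mul]; exact hR _ _ (.Cinv_central y)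
  | KK_plus i j m n =>
    simp only [map_mul, map_Kplus]
    exact hR _ _ (.KK_plus i j m n)
  | KK_minus i j m n =>
    simp only [map_mul, map_Kminus]
    exact hR _ _ (.KK_minus i j m n)
  | KK_mixed i j a b =>
    simp only [map_sum, map_mul, map_coeff_ratioLeft, map_coeff_ratioRight, map_coeff_KplusS,
      map_coeff_KminusS]
    exact hR _ _ (.KK_mixed i j a b)
  | KE_plus i j m n =>
    rw [hfam, map_zero]
    simp only [map_g_mulZ_mulW, map_g_mulW_mulZ, prodZW, prodWZ, map_mul, map_Kplus]
    exact hR _ _ (.KE_plus i j m n)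
  | KE_minus i j m n =>
    rw [hfam, map_zero]
    simp only [map_g_mulZ_mulW, map_g_mulW_mulZ, prodZW, prodWZ, map_mul, map_scaleC, map_Kminus]
    exact hR _ _ (.KE_minus i j m n)
  | KF_plus i j m n =>
    rw [hfam, map_zero]
    simp only [map_g_mulZ_mulW, map_g_mulW_mulZ, prodZW, prodWZ, map_mul, map_scaleC, map_Kplus]
    exact hR _ _ (.KF_plus i j m n)
  | KF_minus i j m n =>
    rw [hfam, map_zero]
    simp only [map_g_mulZ_mulW, map_g_mulW_mulZ, prodZW, prodWZ, map_mul, map_Kminus]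
    exact hR _ _ (.KF_minus i j m n)
  | EE i j m n =>
    rw [hfam, map_zero]
    simp only [map_g_mulZ_mulW, map_g_mulW_mulZ, prodZW, prodWZ, map_mul]
    exact hR _ _ (.EE i j m n)
  | FF i j m n =>
    rw [hfam, map_zero]
    simp only [map_g_mulZ_mulW, map_g_mulW_mulZ, prodZW, prodWZ, map_mul]
    exact hR _ _ (.FF i j m n)
  | EF i j m n =>
    have := hR _ _ (.EF i j m n)
    simp only [← map_Kplus, ← map_Kminus, ← map_Cpow] at this
    rw [map_sub, map_mul, map_mul]
    refine this.trans ?_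
    split_ifs
    · simp only [map_smul, map_sub, map_mul]
    · exact (map_zero φ).symm
  | serreE i j hij n m =>
    simp only [map_sum, map_brk, map_zero]
    exact hR _ _ (.serreE i j hij n m)
  | serreF i j hij n m =>
    simp only [map_sum, map_brk, map_zero]
    exact hR _ _ (.serreF i j hij n m)

end Naturality

/-! ## The series `exp(h)` determines `h` -/

theorem coeff_pow_congr {A : Type} [Ring A] {h h' : A⟦X⟧} {N : ℕ}
    (hh : ∀ m, m < N → PowerSeries.coeff m h = PowerSeries.coeff m h') (k m : ℕ) (hm : m < N) :
    PowerSeries.coeff m (h ^ k) = PowerSeries.coeff m (h' ^ k) := by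
  induction k generalizing m with
  | zero => rw [pow_zero, pow_zero]
  | succ k ih =>
    rw [pow_succ, pow_succ, PowerSeries.coeff_mul, PowerSeries.coeff_mul]
    refine Finset.sum_congr rfl fun p hp => ?_
    rw [Finset.HasAntidiagonal.mem_antidiagonal] at hp
    rw [ih p.1 (by omega), hh p.2 (by omega)]

theorem coeff_zero_pow {A : Type} [Ring A] {h : A⟦X⟧} (h0 : PowerSeries.coeff 0 h = 0) {k : ℕ} (hk : k ≠ 0) :
    PowerSeries.coeff 0 (h ^ k) = 0 := by
  rw [PowerSeries.coeff_zero_eq_constantCoeff_apply] at h0 ⊢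
  rw [map_pow, h0, zero_pow hk]

/-- In degree n the coefficient h_n enters only through the linear term; without a constant term,
every power h^k with k ≠ 1 sees only lower coefficients. -/
theorem expSeries_injective {A : Type} [Ring A] [Algebra ℂ A] {h h' : A⟦X⟧} (h0 : PowerSeries.coeff 0 h = 0)
    (h0' : PowerSeries.coeff 0 h' = 0) (he : expSeries h = expSeries h') : h = h' := by
  ext n
  induction n using Nat.strong_induction_on with
  | _ n ih =>
    rcases Nat.eq_zero_or_pos n with rfl | hn
    · rw [h0, h0']
    have h2 : ∀ k, k ≠ 1 → PowerSeries.coeff n (h ^ k) = PowerSeries.coeff n (h' ^ k) := by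
      intro k hk
      match k, hk with
      | 0, _ => rw [pow_zero, pow_zero]
      | k + 2, _ =>
        rw [pow_succ, pow_succ h', PowerSeries.coeff_mul, PowerSeries.coeff_mul]
        refine Finset.sum_congr rfl fun p hp => ?_
        rw [Finset.HasAntidiagonal.mem_antidiagonal] at hp
        rcases Nat.eq_zero_or_pos p.1 with h1 | h1
        · rw [h1, coeff_zero_pow h0 k.succ_ne_zero, coeff_zero_pow h0' k.succ_ne_zero, zero_mul,
            zero_mul]
        · rcases Nat.eq_zero_or_pos p.2 with h2 | h2
          · rw [h2, h0, h0', mul_zero, mul_zero]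
          · rw [coeff_pow_congr ih _ _ (by omega : p.1 < n), ih p.2 (by omega)]
    have h3 := congrArg (PowerSeries.coeff n) he
    rw [expSeries, expSeries, PowerSeries.coeff_mk, PowerSeries.coeff_mk, ← sub_eq_zero,
      ← Finset.sum_sub_distrib, Finset.sum_eq_single 1] at h3
    · simpa [sub_eq_zero] using h3
    · intro k _ hk
      rw [h2 k hk, sub_self]
    · intro h
      exact absurd (Finset.mem_range.2 (by omega)) h

end

end QToroidal

namespace QToroidal

noncomputable section

variable {q d u L s : ℂ} {i j : Fin 2}

/-! ## The images of the generators -/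

/-- The images of the generators of `𝓔₂` in the endomorphisms of the Fock module. -/
def genImage (q d u L : ℂ) : Gen → Module.End ℂ Fock
  | .E i n => rhoE q d u L i n
  | .F i n => rhoF q d u L i n
  -- The factor (q - q⁻¹)⁻¹ cancels the prefactor in the exponents of K_i^±(z), leaving those of
  -- φ_i^±(q^{-1/2}z).
  | .H i n _ => if 0 < n then ((q - q⁻¹)⁻¹ * phiCoeff q 1 n) • alpha q d i n
      else (-(q - q⁻¹)⁻¹ * phiCoeff q q⁻¹ n) • alpha q d i n
  | .K i => diag fun n => q ^ (eps i * n)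
  | .Kinv i => diag fun n => q ^ (-(eps i * n))
  | .C => algebraMap ℂ _ q
  | .Cinv => algebraMap ℂ _ q⁻¹

theorem coeff_KplusS_genImage (h : q - q⁻¹ ≠ 0) (i : Fin 2) (n : ℕ) :
    PowerSeries.coeff n (KplusS q (genImage q d u L) i) = kPlus q d i (phiCoeff q 1) n := by
  have e : (PowerSeries.mk fun n => if hn : (n : ℤ) ≠ 0 then
      (q - q⁻¹) • genImage q d u L (Gen.H i n hn) else 0)
      = PowerSeries.mk fun n : ℕ => if n = 0 then 0 else phiCoeff q 1 n • alpha q d i n := by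
    ext1 n
    rw [PowerSeries.coeff_mk, PowerSeries.coeff_mk]
    by_cases hn : n = 0
    · rw [dif_neg (by simpa using hn), if_pos hn]
    · rw [dif_pos (by simpa using hn), if_neg hn, genImage, if_pos (by omega), smul_smul,
        mul_inv_cancel_left₀ h]
  rw [KplusS, PowerSeries.coeff_C_mul, e, ← expPos, ← ann_natCast, kPlus]
  exact (diag_commute_ann _ _).eq

theorem coeff_KminusS_genImage (h : q - q⁻¹ ≠ 0) (i : Fin 2) (n : ℕ) :
    PowerSeries.coeff n (KminusS q (genImage q d u L) i)
      = kMinus q d i (phiCoeff q q⁻¹) (-n) := by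
  have e : (PowerSeries.mk fun n : ℕ => if hn : -(n : ℤ) ≠ 0 then
      (-(q - q⁻¹)) • genImage q d u L (Gen.H i (-n) hn) else 0)
      = PowerSeries.mk fun n : ℕ => if n = 0 then 0 else
        phiCoeff q q⁻¹ (-n) • alpha q d i (-n) := by
    ext1 n
    rw [PowerSeries.coeff_mk, PowerSeries.coeff_mk]
    by_cases hn : n = 0
    · rw [dif_neg (by simpa using hn), if_pos hn]
    · rw [dif_pos (by simpa using hn), if_neg hn, genImage, if_neg (by omega), smul_smul,
        ← mul_assoc, neg_mul_neg, mul_inv_cancel₀ h, one_mul]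
  rw [KminusS, PowerSeries.coeff_C_mul, e, ← expNeg, ← cre_natCast, kMinus, neg_neg]
  exact (diag_commute_cre _ _).eq

theorem Kplus_genImage (h : q - q⁻¹ ≠ 0) (i : Fin 2) :
    Kplus q (genImage q d u L) i = kPlus q d i (phiCoeff q 1) := by
  funext n
  unfold Kplus
  split_ifs with hn
  · lift n to ℕ using hn
    exact coeff_KplusS_genImage h i n
  · rw [kPlus, ann_neg (by omega), zero_mul]

theorem Kminus_genImage (h : q - q⁻¹ ≠ 0) (i : Fin 2) :
    Kminus q (genImage q d u L) i = kMinus q d i (phiCoeff q q⁻¹) := by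
  funext n
  unfold Kminus
  split_ifs with hn
  · obtain ⟨k, rfl⟩ : ∃ k : ℕ, n = -k := ⟨(-n).toNat, by omega⟩
    rw [neg_neg, Int.toNat_natCast]
    exact coeff_KminusS_genImage h i k
  · rw [kMinus, cre_neg (by omega), zero_mul]

theorem Cpow_genImage (n : ℤ) :
    Cpow (genImage q d u L) n = algebraMap ℂ (Module.End ℂ Fock) (q ^ n) := by
  unfold Cpow
  split_ifs with hn
  · lift n to ℕ using hn
    rw [Int.toNat_natCast, zpow_natCast, map_pow]
    rfl
  · obtain ⟨k, rfl⟩ : ∃ k : ℕ, n = -k := ⟨(-n).toNat, by omega⟩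
    rw [neg_neg, Int.toNat_natCast, zpow_neg, zpow_natCast, ← inv_pow, map_pow]
    rfl

/-- Rescaling z multiplies degree n by r^n both in the exponent and in the exponential; uniqueness
of the recursion identifies the two. -/
theorem ann_scale {c c' : ℤ → ℂ} {r : ℂ} (h : ∀ n : ℕ, n ≠ 0 → c' n = r ^ n * c n) (n : ℕ) :
    ann q d i c' n = r ^ n • ann q d i c n :=
  congrFun ((isExp_ann (q := q) (d := d) (i := i) (c := c')).unique
    ((isExp_ann.smul_pow r).congr fun n hn => by rw [h n hn, smul_smul])) n

theorem cre_scale {c c' : ℤ → ℂ} {r : ℂ} (h : ∀ n : ℕ, n ≠ 0 → c' (-n) = r ^ n * c (-n)) (n : ℕ) :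
    cre q d i c' n = r ^ n • cre q d i c n :=
  congrFun ((isExp_cre (q := q) (d := d) (i := i) (c := c')).unique
    ((isExp_cre.smul_pow r).congr fun n hn => by rw [h n hn, smul_smul])) n

theorem scaleC_Kplus_genImage (h : q - q⁻¹ ≠ 0) (i : Fin 2) :
    scaleC (genImage q d u L) (Kplus q (genImage q d u L) i) = kPlus q d i (phiCoeff q q⁻¹) := by
  funext n
  rw [scaleC, Cpow_genImage, Kplus_genImage h, Algebra.algebraMap_eq_smul_one, smul_mul_assoc,
    one_mul, kPlus, kPlus]
  rcases lt_or_ge n 0 with hn | hn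
  · rw [ann_neg hn, ann_neg hn, zero_mul, smul_zero]
  · lift n to ℕ using hn
    rw [ann_scale (c' := phiCoeff q q⁻¹) (c := phiCoeff q 1) (r := q⁻¹) (fun n _ => ?_),
      smul_mul_assoc, zpow_neg, zpow_natCast, inv_pow]
    simp only [phiCoeff, Nat.abs_cast, zpow_natCast, one_pow]
    ring

theorem scaleC_Kminus_genImage (hq : q ≠ 0) (h : q - q⁻¹ ≠ 0) (i : Fin 2) :
    scaleC (genImage q d u L) (Kminus q (genImage q d u L) i) = kMinus q d i (phiCoeff q 1) := by
  funext n
  rw [scaleC, Cpow_genImage, Kminus_genImage h, Algebra.algebraMap_eq_smul_one, smul_mul_assoc,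
    one_mul, kMinus, kMinus]
  rcases lt_or_ge 0 n with hn | hn
  · rw [cre_neg (by omega), cre_neg (by omega), zero_mul, smul_zero]
  · obtain ⟨k, rfl⟩ : ∃ k : ℕ, n = -k := ⟨(-n).toNat, by omega⟩
    rw [neg_neg, cre_scale (c' := phiCoeff q 1) (c := phiCoeff q q⁻¹) (r := q) (fun n _ => ?_),
      smul_mul_assoc, zpow_natCast]
    simp only [phiCoeff, abs_neg, Nat.abs_cast, zpow_natCast, one_pow, inv_pow]
    have := pow_ne_zero n hq
    field_simp

/-- The q^{-n/2} in φ^+ cancels against the argument q^{-1/2}z, so the square root disappears; in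
`rhoKminus_eq` the two combine to q^{-n}. -/
theorem rhoKplus_eq (hs : s ^ 2 = q) (hq : q ≠ 0) (i : Fin 2) (k : ℕ) :
    rhoKplus q d s i k = kPlus q d i (phiCoeff q 1) k := by
  have hs0 : s ≠ 0 := by rintro rfl; exact hq (by rw [← hs]; norm_num)
  rw [rhoKplus, kPlus, phiPlus, ← ann_natCast]
  congr 1
  rw [ann_scale (c' := phiCoeff q 1)
    (c := fun n => -((1 - (q2 q) ^ n) / (n : ℂ) * s ^ (-n))) (r := s) (fun n _ => ?_), zpow_neg,
    zpow_natCast, inv_pow, inv_inv]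
  simp only [phiCoeff, Nat.abs_cast, zpow_natCast, one_pow, zpow_neg]
  have := pow_ne_zero n hs0
  push_cast
  field_simp

theorem rhoKminus_eq (hs : s ^ 2 = q) (hq : q ≠ 0) (i : Fin 2) (k : ℕ) :
    rhoKminus q d s i k = kMinus q d i (phiCoeff q q⁻¹) (-k) := by
  have hs0 : s ≠ 0 := by rintro rfl; exact hq (by rw [← hs]; norm_num)
  rw [rhoKminus, kMinus, phiMinus, ← cre_natCast, neg_neg]
  congr 1
  rw [cre_scale (c' := phiCoeff q q⁻¹)
    (c := fun n => (1 - (q2 q) ^ (-n)) / ((-n : ℤ) : ℂ) * s ^ n) (r := s⁻¹) (fun n hn => ?_)]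
  have hn' : (n : ℂ) ≠ 0 := by exact_mod_cast hn
  simp only [phiCoeff, abs_neg, Nat.abs_cast, neg_neg, zpow_natCast, zpow_neg, inv_pow,
    Int.cast_neg, Int.cast_natCast]
  have := pow_ne_zero n hs0
  rw [← hs, ← pow_mul, mul_comm 2 n, pow_mul]
  field_simp

/-! ## The relations -/

/-- The scalars by which `q^c` and `q^{-c}` act. -/
def scalarGen (q : ℂ) : Gen → ℂ
  | .C => q
  | .Cinv => q⁻¹
  | _ => 0

/-- Since q^{±c} act by scalars, naturality along ℂ → End reduces the ratio to a scalar power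
series. -/
theorem ratioLeft_genImage (i j : Fin 2) (k : ℕ) :
    PowerSeries.coeff k (ratioLeft q d (genImage q d u L) i j)
      = algebraMap ℂ _ (PowerSeries.coeff k (ratioLeft q d (scalarGen q) i j)) :=
  (map_coeff_ratioLeft (Algebra.ofId ℂ (Module.End ℂ Fock)) q d (scalarGen q) i j k).symm

theorem ratioRight_genImage (i j : Fin 2) (k : ℕ) :
    PowerSeries.coeff k (ratioRight q d (genImage q d u L) i j)
      = algebraMap ℂ _ (PowerSeries.coeff k (ratioRight q d (scalarGen q) i j)) :=
  (map_coeff_ratioRight (Algebra.ofId ℂ (Module.End ℂ Fock)) q d (scalarGen q) i j k).symm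

theorem eq_mul_of_polynomial_identity {NL DL IL NR DR IR P Q G : ℂ⟦X⟧} (hL : DL * IL = 1)
    (hR : DR * IR = 1) (hG : Q * G = 1) (h : NL * DR * Q = NR * P * DL) :
    NL * IL = NR * IR * (P * G) := by
  linear_combination (IL * IR * G) * h + NR * IR * P * G * hL - NL * IL * Q * G * hR - NL * IL * hG

/-- The mixed relation for K^± holds because the contraction of K_j^+ with K_i^- is the quotient of
the two structure-function ratios; both are products of linear factors and are compared after
cross-multiplication. -/
theorem ratio_contraction (hq : q ≠ 0) (hd : d ≠ 0) (i j : Fin 2) :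
    ∃ κ, IsContraction q d j (phiCoeff q 1) i (phiCoeff q q⁻¹) κ ∧
      ratioLeft q d (scalarGen q) i j = ratioRight q d (scalarGen q) i j * κ := by
  have hlin : ∀ a : ℂ, lin a = PowerSeries.C a * (PowerSeries.X : ℂ⟦X⟧) := fun _ => rfl
  have hC : ∀ a b : ℂ, a * b = 1 → (PowerSeries.C a : ℂ⟦X⟧) * PowerSeries.C b = 1 := by
    intro a b h
    rw [← map_mul, h, map_one]
  have hqq := hC q q⁻¹ (mul_inv_cancel₀ hq)
  have hdd := hC d d⁻¹ (mul_inv_cancel₀ hd)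
  by_cases hij : i = j
  · subst hij
    refine ⟨_, contraction_phi_phi hq, eq_mul_of_polynomial_identity
      (g_mul_invGLeft hq hd i i _) (g_mul_invGRight q d i i _)
      (Q := oneSub q⁻¹ * oneSub q) ?_ ?_⟩
    · rw [mul_mul_mul_comm, oneSub_mul_geom, oneSub_mul_geom, one_mul]
    · simp only [g, if_pos, scalarGen, hlin, oneSub, q2, PowerSeries.smul_eq_C_mul, map_pow,
        ← inv_pow]
      generalize (PowerSeries.C q : ℂ⟦X⟧) = x at *
      generalize (PowerSeries.C q⁻¹ : ℂ⟦X⟧) = y at *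
      generalize (PowerSeries.X : ℂ⟦X⟧) = Z at *
      -- Constants are pulled out so that these factors get the form 1 - aZ found in the
      -- contraction; the constants agree on both sides.
      rw [show y * Z - x ^ 2 * 1 = -x ^ 2 * (1 - y ^ 3 * Z) by
          linear_combination (-(y * Z * (x * y + 1))) * hqq,
        show 1 - x ^ 2 * (y * Z) = 1 - x * Z by linear_combination (-(x * Z)) * hqq,
        show x * Z - x ^ 2 * 1 = -x ^ 2 * (1 - y * Z) by linear_combination (-(x * Z)) * hqq]
      ring
  · have hji : j ≠ i := Ne.symm hij
    refine ⟨_, contraction_phi_phi_ne hq hd hji, eq_mul_of_polynomial_identity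
      (g_mul_invGLeft hq hd i j _) (g_mul_invGRight q d i j _)
      (Q := oneSub (q ^ 2 * d) * oneSub (q ^ 2 * d⁻¹) *
          (oneSub ((q ^ 2)⁻¹ * d) * oneSub ((q ^ 2)⁻¹ * d⁻¹))) ?_ ?_⟩
    · rw [mul_mul_mul_comm, mul_mul_mul_comm (oneSub (q ^ 2 * d)),
        mul_mul_mul_comm (oneSub ((q ^ 2)⁻¹ * d)), oneSub_mul_geom, oneSub_mul_geom,
        oneSub_mul_geom, oneSub_mul_geom]
      simp
    · simp only [g, if_neg hij, if_neg hji, scalarGen, hlin, oneSub, q1, q3,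
        PowerSeries.smul_eq_C_mul, map_mul, map_pow, ← inv_pow]
      generalize (PowerSeries.C q : ℂ⟦X⟧) = x at *
      generalize (PowerSeries.C q⁻¹ : ℂ⟦X⟧) = y at *
      generalize (PowerSeries.C d : ℂ⟦X⟧) = e at *
      generalize (PowerSeries.C d⁻¹ : ℂ⟦X⟧) = f at *
      generalize (PowerSeries.X : ℂ⟦X⟧) = Z at *
      rw [show y * Z - y * e * 1 = -(y * e) * (1 - f * Z) by linear_combination (-(y * Z)) * hdd,
        show y * Z - y * f * 1 = -(y * f) * (1 - e * Z) by linear_combination (-(y * Z)) * hdd,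
        show 1 - y * e * (x * Z) = 1 - e * Z by linear_combination (-(e * Z)) * hqq,
        show 1 - y * f * (x * Z) = 1 - f * Z by linear_combination (-(f * Z)) * hqq,
        show x * Z - y * e * 1 = -(y * e) * (1 - x ^ 2 * f * Z) by
          linear_combination (-(x * Z * e * f)) * hqq - x * Z * hdd,
        show x * Z - y * f * 1 = -(y * f) * (1 - x ^ 2 * e * Z) by
          linear_combination (-(x * Z * e * f)) * hqq - x * Z * hdd]
      ring

end

end QToroidal

/-! ### Serre data of the currents, and all relations for the images of the generators -/

namespace QToroidal

noncomputable section

variable {q d u L s : ℂ} {i j : Fin 2}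

/-- Here ab = q₂⁻¹. The four non-resonance conditions say that d², q^{-2}d², q^{-2}d^{-2} and q^{-2}
differ from 1. -/
theorem serreData_eta (hq : q ≠ 0) (hd : d ≠ 0)
    (hqd : ∀ n m : ℤ, n ≠ 0 ∨ m ≠ 0 → q ^ n * d ^ m ≠ 1) (hij : i ≠ j) :
    SerreData q d i j etaCoeff 1 (q1 q d) (q3 q d) (q2 q) := by
  have hmul : q1 q d * q3 q d = (q2 q)⁻¹ := eq_inv_of_mul_eq_one_right (q2_mul_q1_mul_q3 hq hd)
  have h2 : q2 q ≠ 0 := pow_ne_zero _ hq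
  refine
    { pair := ⟨hij, one_pow 2, ?_, contraction_eta_eta_ne hij, contraction_eta_eta_ne hij.symm,
        (coeff_oneSub_mul_oneSub _).2.2.2⟩
      a_ne_b := fun h => hqd 0 2 (Or.inr two_ne_zero) ?_
      a_sq := fun h => hqd (-2) 2 (Or.inr two_ne_zero) ?_
      b_sq := fun h => hqd (-2) (-2) (Or.inr (by norm_num)) ?_
      mul_ne_one := fun h => hqd (-2) 0 (Or.inl (by norm_num)) ?_
      mul_ne_zero := mul_ne_zero (q1_ne_zero hq hd) (q3_ne_zero hq hd)
      p_ne_zero := h2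
      p_eq := ?_ }
  · rw [hmul]
    exact contraction_eta_eta
  · rw [q1, q3, mul_right_inj' (inv_ne_zero hq)] at h
    rw [zpow_zero, one_mul, zpow_ofNat, sq]
    nth_rewrite 1 [h]
    exact inv_mul_cancel₀ hd
  · rw [← h, q1, mul_pow, inv_pow, zpow_neg, zpow_ofNat, zpow_ofNat]
  · rw [← h, q3, mul_pow, inv_pow, inv_pow, zpow_neg, zpow_neg, zpow_ofNat, zpow_ofNat]
  · rw [hmul] at h
    rw [zpow_zero, mul_one, zpow_neg, zpow_ofNat]
    exact h
  · rw [hmul]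
    field_simp
    ring

theorem serreData_xi (hq : q ≠ 0) (hd : d ≠ 0)
    (hqd : ∀ n m : ℤ, n ≠ 0 ∨ m ≠ 0 → q ^ n * d ^ m ≠ 1) (hij : i ≠ j) :
    SerreData q d i j (xiCoeff q) (-1) (q1 q d)⁻¹ (q3 q d)⁻¹ (q2 q) := by
  have h := serreData_eta hq hd hqd hij
  have hmul : (q1 q d)⁻¹ * (q3 q d)⁻¹ = q2 q := by
    rw [← mul_inv]
    exact inv_eq_of_mul_eq_one_left (q2_mul_q1_mul_q3 hq hd)
  refine
    { pair := ⟨hij, by norm_num, ?_, contraction_xi_xi_ne hq hd hij,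
        contraction_xi_xi_ne hq hd hij.symm, (coeff_oneSub_mul_oneSub _).2.2.2⟩
      a_ne_b := fun e => h.a_ne_b (inv_injective e)
      a_sq := fun e => h.a_sq (inv_eq_one.1 ((inv_pow _ _).symm.trans e))
      b_sq := fun e => h.b_sq (inv_eq_one.1 ((inv_pow _ _).symm.trans e))
      mul_ne_one := fun e => h.mul_ne_one (inv_eq_one.1 ((mul_inv _ _).trans e))
      mul_ne_zero := mul_ne_zero (inv_ne_zero (q1_ne_zero hq hd)) (inv_ne_zero (q3_ne_zero hq hd))
      p_ne_zero := h.p_ne_zero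
      p_eq := ?_ }
  · rw [hmul]
    exact contraction_xi_xi hq
  · have := h.p_ne_zero
    rw [hmul]
    field_simp

theorem diag_zpow_mul_diag_zpow_neg (hq : q ≠ 0) (f : ℤ → ℤ) :
    diag (fun n => q ^ f n) * diag (fun n => q ^ (-f n)) = 1 := by
  refine end_ext fun n p => ?_
  rw [Module.End.mul_apply, diag_inj, diag_inj, smul_smul, ← zpow_add₀ hq,
    add_neg_cancel, zpow_zero, one_smul, Module.End.one_apply]

/-- The images of the generators satisfy the defining relations. -/
theorem genImage_rel (hq : q ≠ 0) (hd : d ≠ 0)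
    (hqd : ∀ n m : ℤ, n ≠ 0 ∨ m ≠ 0 → q ^ n * d ^ m ≠ 1) {a b : Module.End ℂ Fock}
    (hab : DefRel q d (genImage q d u L) a b) : a = b := by
  have h : q - q⁻¹ ≠ 0 := sub_inv_ne_zero hq (by simpa using hqd 2 0 (Or.inl two_ne_zero))
  cases hab with
  | K_Kinv i => exact diag_zpow_mul_diag_zpow_neg hq _
  | Kinv_K i => exact (diag_comm _ _).trans (diag_zpow_mul_diag_zpow_neg hq _)
  | C_Cinv =>
    exact ((map_mul (algebraMap ℂ (Module.End ℂ Fock)) _ _).symm.trans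
      (congrArg _ (mul_inv_cancel₀ hq))).trans (map_one _)
  | Cinv_C =>
    exact ((map_mul (algebraMap ℂ (Module.End ℂ Fock)) _ _).symm.trans
      (congrArg _ (inv_mul_cancel₀ hq))).trans (map_one _)
  | C_central y => exact Algebra.commutes q _
  | Cinv_central y => exact Algebra.commutes q⁻¹ _
  | KK_plus i j m n =>
    rw [Kplus_genImage h, Kplus_genImage h]
    exact (kPlus_commute m n).eq
  | KK_minus i j m n =>
    rw [Kminus_genImage h, Kminus_genImage h]
    exact (kMinus_commute m n).eq
  | KK_mixed i j a b =>
    obtain ⟨κ, hκ, hratio⟩ := ratio_contraction (q := q) (d := d) hq hd i j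
    refine (Finset.sum_congr rfl fun k hk => ?_).trans ((mixed_relation hratio hκ a b).trans
      (Finset.sum_congr rfl fun k hk => ?_))
    all_goals
      have hk' : k ≤ a ∧ k ≤ b := by rw [Finset.mem_range] at hk; omega
      simp only [ratioLeft_genImage, ratioRight_genImage, coeff_KplusS_genImage h,
        coeff_KminusS_genImage h, Algebra.algebraMap_eq_smul_one, smul_mul_assoc, one_mul,
        Nat.cast_sub hk'.1, Nat.cast_sub hk'.2]
  | KE_plus i j m n =>
    rw [Kplus_genImage h]
    exact kPlus_rhoE hq hd hqd m n
  | KE_minus i j m n =>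
    rw [scaleC_Kminus_genImage hq h]
    exact kMinus_rhoE hq hd hqd m n
  | KF_plus i j m n =>
    rw [scaleC_Kplus_genImage h]
    exact kPlus_rhoF hq hd hqd m n
  | KF_minus i j m n =>
    rw [Kminus_genImage h]
    exact kMinus_rhoF hq hd hqd m n
  | EE i j m n => exact rhoE_rhoE hq hd hqd m n
  | FF i j m n => exact rhoF_rhoF hq hd hqd m n
  | EF i j m n =>
    split_ifs with hij
    · subst hij
      rw [Cpow_genImage, Cpow_genImage, Kplus_genImage h, Kminus_genImage h,
        Algebra.algebraMap_eq_smul_one, Algebra.algebraMap_eq_smul_one, smul_mul_assoc,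
        smul_mul_assoc, one_mul, one_mul]
      exact rhoE_rhoF_same hq hd hqd m n
    · exact rhoE_rhoF_of_ne hq hd hqd hij m n
  | serreE i j hij n m =>
    exact (sum_perm_fin_three fun v₁ v₂ v₃ => serreBracket (q2 q) (rhoE q d u L i (n v₁))
      (rhoE q d u L i (n v₂)) (rhoE q d u L i (n v₃)) (rhoE q d u L j m)).trans
      ((serreData_eta hq hd hqd hij).serre hq hd hqd n m)
  | serreF i j hij n m =>
    exact (sum_perm_fin_three fun v₁ v₂ v₃ => serreBracket (q2 q) (rhoF q d u L i (n v₁))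
      (rhoF q d u L i (n v₂)) (rhoF q d u L i (n v₃)) (rhoF q d u L j m)).trans
      ((serreData_xi hq hd hqd hij).serre hq hd hqd n m)

end

end QToroidal

/-! ### Existence and uniqueness of the representation -/

namespace QToroidal

noncomputable section

variable {q d u L s : ℂ}

/-- The representation of `𝓔₂` on the Fock module. -/
def fockRep (hq : q ≠ 0) (hd : d ≠ 0) (hqd : ∀ n m : ℤ, n ≠ 0 ∨ m ≠ 0 → q ^ n * d ^ m ≠ 1)
    (u L : ℂ) : E2 q d →ₐ[ℂ] Module.End ℂ Fock :=
  RingQuot.liftAlgHom ℂ ⟨FreeAlgebra.lift ℂ (genImage q d u L), fun _ _ h => h.map_eq fun _ _ h' =>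
    genImage_rel (u := u) (L := L) hq hd hqd (by rwa [FreeAlgebra.ι_comp_lift] at h')⟩

theorem fockRep_comp_gen (hq : q ≠ 0) (hd : d ≠ 0)
    (hqd : ∀ n m : ℤ, n ≠ 0 ∨ m ≠ 0 → q ^ n * d ^ m ≠ 1) :
    fockRep hq hd hqd u L ∘ E2.gen q d = genImage q d u L := by
  funext y
  rw [Function.comp_apply, E2.gen, fockRep, RingQuot.liftAlgHom_mkAlgHom_apply,
    FreeAlgebra.lift_ι_apply]

theorem E2.algHom_ext {B : Type} [Ring B] [Algebra ℂ B] {ρ σ : E2 q d →ₐ[ℂ] B}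
    (h : ρ ∘ E2.gen q d = σ ∘ E2.gen q d) : ρ = σ :=
  RingQuot.ringQuot_ext' _ _ _ (FreeAlgebra.hom_ext h)

theorem E2.gen_Kinv_mul_gen_K (i : Fin 2) :
    E2.gen q d (Gen.Kinv i) * E2.gen q d (Gen.K i) = 1 := by
  rw [E2.gen, E2.gen, ← map_mul, RingQuot.mkAlgHom_rel ℂ (DefRel.Kinv_K i), map_one]

theorem E2.gen_K_mul_gen_Kinv (i : Fin 2) :
    E2.gen q d (Gen.K i) * E2.gen q d (Gen.Kinv i) = 1 := by
  rw [E2.gen, E2.gen, ← map_mul, RingQuot.mkAlgHom_rel ℂ (DefRel.K_Kinv i), map_one]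

/-- If `κ exp(h) = κ' exp(h')` with `κ` left invertible, then `κ = κ'` and `h = h'`. -/
theorem C_mul_expSeries_injective {A : Type} [Ring A] [Algebra ℂ A] {κ κ' v : A} {h h' : A⟦X⟧}
    (hv : v * κ = 1) (h0 : PowerSeries.coeff 0 h = 0) (h0' : PowerSeries.coeff 0 h' = 0)
    (e : PowerSeries.C κ * expSeries h = PowerSeries.C κ' * expSeries h') : κ = κ' ∧ h = h' := by
  have hκ : κ = κ' := by
    have := congrArg (PowerSeries.coeff 0) e
    rwa [PowerSeries.coeff_C_mul, PowerSeries.coeff_C_mul, coeff_zero_expSeries,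
      coeff_zero_expSeries, mul_one, mul_one] at this
  subst hκ
  refine ⟨rfl, expSeries_injective h0 h0' ?_⟩
  have := congrArg (PowerSeries.C v * ·) e
  simpa only [← mul_assoc, ← map_mul, hv, map_one, one_mul] using this

/-- A homomorphism on `𝓔₂` is determined by its values on the coefficients of the currents. -/
theorem E2.algHom_ext_currents (h : q - q⁻¹ ≠ 0) {B : Type} [Ring B] [Algebra ℂ B]
    {ρ σ : E2 q d →ₐ[ℂ] B}
    (hE : ∀ i m, ρ (E2.gen q d (Gen.E i m)) = σ (E2.gen q d (Gen.E i m)))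
    (hF : ∀ i m, ρ (E2.gen q d (Gen.F i m)) = σ (E2.gen q d (Gen.F i m)))
    (hKp : ∀ i k, ρ (PowerSeries.coeff k (KplusS q (E2.gen q d) i))
      = σ (PowerSeries.coeff k (KplusS q (E2.gen q d) i)))
    (hKm : ∀ i k, ρ (PowerSeries.coeff k (KminusS q (E2.gen q d) i))
      = σ (PowerSeries.coeff k (KminusS q (E2.gen q d) i)))
    (hC : ρ (E2.gen q d Gen.C) = σ (E2.gen q d Gen.C))
    (hCinv : ρ (E2.gen q d Gen.Cinv) = σ (E2.gen q d Gen.Cinv)) : ρ = σ := by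
  have hp : ∀ i, KplusS q (ρ ∘ E2.gen q d) i = KplusS q (σ ∘ E2.gen q d) i := fun i =>
    PowerSeries.ext fun k => by rw [← map_coeff_KplusS, ← map_coeff_KplusS, hKp]
  have hm : ∀ i, KminusS q (ρ ∘ E2.gen q d) i = KminusS q (σ ∘ E2.gen q d) i := fun i =>
    PowerSeries.ext fun k => by rw [← map_coeff_KminusS, ← map_coeff_KminusS, hKm]
  -- The constant coefficient determines the image of K_i; as K_i is invertible in 𝓔₂, it can be
  -- cancelled and the exponent is determined too.
  have hp' := fun i => C_mul_expSeries_injective (v := ρ (E2.gen q d (Gen.Kinv i)))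
    (by rw [Function.comp_apply, ← map_mul, E2.gen_Kinv_mul_gen_K, map_one])
    (by rw [PowerSeries.coeff_mk, dif_neg (by simp)])
    (by rw [PowerSeries.coeff_mk, dif_neg (by simp)]) (hp i)
  have hm' := fun i => C_mul_expSeries_injective (v := ρ (E2.gen q d (Gen.K i)))
    (by rw [Function.comp_apply, ← map_mul, E2.gen_K_mul_gen_Kinv, map_one])
    (by rw [PowerSeries.coeff_mk, dif_neg (by simp)])
    (by rw [PowerSeries.coeff_mk, dif_neg (by simp)]) (hm i)
  refine E2.algHom_ext (funext fun y => ?_)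
  match y with
  | .E i m => exact hE i m
  | .F i m => exact hF i m
  | .K i => exact (hp' i).1
  | .Kinv i => exact (hm' i).1
  | .C => exact hC
  | .Cinv => exact hCinv
  | .H i n hn =>
    -- Positive modes are read off from K^+, negative ones from K^-, after division by ±(q - q⁻¹).
    obtain ⟨k, rfl | rfl⟩ := n.eq_nat_or_neg
    · have e := congrArg (PowerSeries.coeff k) (hp' i).2
      rw [PowerSeries.coeff_mk, PowerSeries.coeff_mk, dif_pos hn, dif_pos hn] at e
      exact smul_right_injective B h e
    · have e := congrArg (PowerSeries.coeff k) (hm' i).2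
      rw [PowerSeries.coeff_mk, PowerSeries.coeff_mk, dif_pos hn, dif_pos hn] at e
      exact smul_right_injective B (neg_ne_zero.2 h) e

end

end QToroidal

theorem mainTheorem10 (q d : ℂ) (hq : q ≠ 0) (hd : d ≠ 0)
    (hqd : ∀ n m : ℤ, n ≠ 0 ∨ m ≠ 0 → q ^ n * d ^ m ≠ 1)
    (s L u : ℂ) (hs : s ^ 2 = q) (hL : Complex.exp L = QToroidal.q1 q d) :
    ∃! ρ : QToroidal.E2 q d →ₐ[ℂ] Module.End ℂ QToroidal.Fock,
      (∀ (i : Fin 2) (m : ℤ),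
        ρ (QToroidal.E2.gen q d (QToroidal.Gen.E i m)) = QToroidal.rhoE q d u L i m) ∧
      (∀ (i : Fin 2) (m : ℤ),
        ρ (QToroidal.E2.gen q d (QToroidal.Gen.F i m)) = QToroidal.rhoF q d u L i m) ∧
      (∀ (i : Fin 2) (k : ℕ),
        ρ (PowerSeries.coeff k (QToroidal.KplusS q (QToroidal.E2.gen q d) i))
          = QToroidal.rhoKplus q d s i k) ∧
      (∀ (i : Fin 2) (k : ℕ),
        ρ (PowerSeries.coeff k (QToroidal.KminusS q (QToroidal.E2.gen q d) i))
          = QToroidal.rhoKminus q d s i k) ∧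
      ρ (QToroidal.E2.gen q d QToroidal.Gen.C)
        = algebraMap ℂ (Module.End ℂ QToroidal.Fock) q ∧
      ρ (QToroidal.E2.gen q d QToroidal.Gen.Cinv)
        = algebraMap ℂ (Module.End ℂ QToroidal.Fock) q⁻¹ := by
  -- This is the instance q² ≠ 1 of genericity.
  have h : q - q⁻¹ ≠ 0 := QToroidal.sub_inv_ne_zero hq (by simpa using hqd 2 0 (Or.inl two_ne_zero))
  have hgen := fun y => congrFun (QToroidal.fockRep_comp_gen (u := u) (L := L) hq hd hqd) y
  have hKp : ∀ (i : Fin 2) (k : ℕ), QToroidal.fockRep hq hd hqd u L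
      (PowerSeries.coeff k (QToroidal.KplusS q (QToroidal.E2.gen q d) i))
        = QToroidal.rhoKplus q d s i k := fun i k => by
    rw [QToroidal.map_coeff_KplusS, QToroidal.fockRep_comp_gen,
      QToroidal.coeff_KplusS_genImage h, QToroidal.rhoKplus_eq hs hq]
  have hKm : ∀ (i : Fin 2) (k : ℕ), QToroidal.fockRep hq hd hqd u L
      (PowerSeries.coeff k (QToroidal.KminusS q (QToroidal.E2.gen q d) i))
        = QToroidal.rhoKminus q d s i k := fun i k => by
    rw [QToroidal.map_coeff_KminusS, QToroidal.fockRep_comp_gen,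
      QToroidal.coeff_KminusS_genImage h, QToroidal.rhoKminus_eq hs hq]
  refine ⟨QToroidal.fockRep hq hd hqd u L,
    ⟨fun i m => hgen _, fun i m => hgen _, hKp, hKm, hgen _, hgen _⟩, ?_⟩
  rintro σ ⟨hE, hF, hKp', hKm', hC, hCinv⟩
  exact QToroidal.E2.algHom_ext_currents h
    (fun i m => (hE i m).trans (hgen (QToroidal.Gen.E i m)).symm)
    (fun i m => (hF i m).trans (hgen (QToroidal.Gen.F i m)).symm)
    (fun i k => (hKp' i k).trans (hKp i k).symm) (fun i k => (hKm' i k).trans (hKm i k).symm)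
    (hC.trans (hgen QToroidal.Gen.C).symm) (hCinv.trans (hgen QToroidal.Gen.Cinv).symm)
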